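/- Let $k$ be a commutative ring. A dg algebra over $k$ is a $\mathbb{Z}$-graded (unbounded) associative unital $k$-algebra with a differential of degree $+1$ satisfying the graded Leibniz rule. A complex of $k$-modules is cofibrant if it has the left lifting property with respect to all degreewise surjective quasi-isomorphisms of (unbounded) complexes of $k$-modules. For a dg algebra $A$ over $k$ let $A^\vee=\bigoplus_{n\ge 0}A^{\otimes n}[n]$ be the counital cofree graded coassociative coalgebra on $A[1]$, with the deconcatenation coproduct $\Delta$, and endow it with the differential $D$, which is the coderivation of degree $1$ whose components are $a\mapsto -da$ and $a\otimes b\mapsto(-1)^{|a|}ab$, encoding the differential and the multiplication of $A$. The shifted Hochschild cochain complex $C(A)[1]$ is the dg Lie algebra of graded coderivations of $A^\vee$: its component of degree $p$ consists of the $k$-linear maps $\delta:A^\vee\to A^\vee$ of degree $p$ with $\Delta\circ\delta=(\delta\otimes\mathrm{id}+\mathrm{id}\otimes\delta)\circ\Delta$ (with the Koszul sign rule), the bracket is the graded commutator, and the differential is $\delta\mapsto[D,\delta]$. Two dg algebras (respectively, two dg Lie algebras) over $k$ are called quasi-isomorphic if they are connected by a finite zigzag of quasi-isomorphisms of dg algebras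 (respectively, of dg Lie algebras). **Corollary (Comparison of Hochschild complexes).** Let $A$ and $A'$ be dg algebras over $k$ whose underlying complexes of $k$-modules are cofibrant. If $A$ and $A'$ are quasi-isomorphic, then the dg Lie algebras $C(A)[1]$ and $C(A')[1]$ are quasi-isomorphic. -/

import Mathlib

open CategoryTheory TensorProduct

universe u

/-- The sign `(-1) ^ n` as a scalar of `k`. -/
def koszulSign (k : Type u) [CommRing k] (n : ℤ) : k := ((n.negOnePow : ℤ) : k)

section Signs

variable {k : Type u} [CommRing k]

theorem koszulSign_add (m n : ℤ) :
    koszulSign k (m + n) = koszulSign k m * koszulSign k n := by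
  simp [koszulSign, Int.negOnePow_add]

theorem koszulSign_sq (m : ℤ) : koszulSign k m * koszulSign k m = 1 := by
  rw [← koszulSign_add]
  simp [koszulSign, ← two_mul]

theorem koszulSign_zero : koszulSign k 0 = 1 := by simp [koszulSign]

theorem koszulSign_one : koszulSign k 1 = -1 := by simp [koszulSign]

theorem koszulSign_neg (m : ℤ) : koszulSign k (-m) = koszulSign k m := by
  simp only [koszulSign, Int.negOnePow_neg]

theorem koszulSign_even {m : ℤ} (h : Even m) : koszulSign k m = 1 := by
  simp [koszulSign, Int.negOnePow_even m h]

theorem koszulSign_odd {m : ℤ} (h : Odd m) : koszulSign k m = -1 := by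
  simp [koszulSign, Int.negOnePow_odd m h]

end Signs

/-! ### Complexes -/

/-- A (cochain, unbounded) complex of `k`-modules is cofibrant (for the projective model structure:
weak equivalences are the quasi-isomorphisms, fibrations are the degreewise surjections) if
it has the left lifting property with respect to the degreewise surjective quasi-isomorphisms. -/
def IsCofibrantComplex {k : Type u} [CommRing k] (K : CochainComplex (ModuleCat.{u} k) ℤ) : Prop :=
  ∀ ⦃X Y : CochainComplex (ModuleCat.{u} k) ℤ⦄ (p : X ⟶ Y),
    (∀ n, Function.Surjective (p.f n)) → QuasiIso p →
      ∀ g : K ⟶ Y, ∃ l : K ⟶ X, l ≫ p = g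

/-! ### Dg algebras -/

/-- A differential graded algebra over `k`: a `ℤ`-graded associative unital algebra with
a differential of degree `+1` satisfying the graded Leibniz rule. -/
structure DGAlgebra (k : Type u) [CommRing k] where
  carrier : Type u
  [ring : Ring carrier]
  [algebra : Algebra k carrier]
  gr : ℤ → Submodule k carrier
  [graded : GradedAlgebra gr]
  d : carrier →ₗ[k] carrier
  d_mem : ∀ {i : ℤ} {a : carrier}, a ∈ gr i → d a ∈ gr (i + 1)
  d_d : ∀ a : carrier, d (d a) = 0
  leibniz : ∀ {i : ℤ} {a : carrier}, a ∈ gr i → ∀ b : carrier,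
    d (a * b) = d a * b + koszulSign k i • (a * d b)

namespace DGAlgebra

variable {k : Type u} [CommRing k]

attribute [instance] DGAlgebra.ring DGAlgebra.algebra DGAlgebra.graded

/-- The underlying complex of `k`-modules of a dg algebra. -/
noncomputable def toComplex (A : DGAlgebra k) : CochainComplex (ModuleCat.{u} k) ℤ where
  X i := ModuleCat.of k (A.gr i)
  d i j := if h : i + 1 = j then
      ModuleCat.ofHom (A.d.restrict (p := A.gr i) (q := A.gr j) fun _ ha => h ▸ A.d_mem ha)
    else 0
  shape i j h := dif_neg h
  d_comp_d' := by
    rintro i j l (rfl : i + 1 = j) (rfl : i + 1 + 1 = l)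
    ext x
    simp [A.d_d]

/-- Morphisms of dg algebras: (unital) algebra maps of degree zero commuting with the
differentials. -/
structure Hom (A B : DGAlgebra k) where
  toAlgHom : A.carrier →ₐ[k] B.carrier
  map_mem : ∀ {i : ℤ} {a : A.carrier}, a ∈ A.gr i → toAlgHom a ∈ B.gr i
  map_d : ∀ a : A.carrier, toAlgHom (A.d a) = B.d (toAlgHom a)

/-- The map of complexes underlying a morphism of dg algebras. -/
noncomputable def Hom.toComplexHom {A B : DGAlgebra k} (f : Hom A B) :
    A.toComplex ⟶ B.toComplex where
  f i := ModuleCat.ofHom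
    (f.toAlgHom.toLinearMap.restrict (p := A.gr i) (q := B.gr i) fun _ ha => f.map_mem ha)
  comm' := by
    rintro i j (rfl : i + 1 = j)
    simp only [toComplex, dif_pos]
    ext1
    exact LinearMap.ext fun x => Subtype.ext (f.map_d x.1).symm

/-- Two dg algebras are quasi-isomorphic if they are connected by a finite zigzag of
quasi-isomorphisms of dg algebras. -/
def QuasiIsomorphic (A B : DGAlgebra k) : Prop :=
  Relation.EqvGen (fun A B : DGAlgebra k => ∃ f : Hom A B, QuasiIso f.toComplexHom) A B

end DGAlgebra

/-! ### Dg Lie algebras -/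

/-- A differential graded Lie algebra over `k`: a complex with a bracket of degree zero which is
graded antisymmetric, satisfies the graded Jacobi identity and for which the differential is a
derivation. Since `2` and `3` need not be invertible in `k`, the
identities `[x, x] = 0` for `x` even and `[x, [x, x]] = 0` for `x` odd are required as well. -/
structure DGLieAlgebra (k : Type u) [CommRing k] where
  toComplex : CochainComplex (ModuleCat.{u} k) ℤ
  bracket : ∀ {i j n : ℤ}, i + j = n →
    (toComplex.X i →ₗ[k] toComplex.X j →ₗ[k] toComplex.X n)
  antisymm : ∀ {i j n : ℤ} (h : i + j = n) (h' : j + i = n) (x : toComplex.X i)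
    (y : toComplex.X j), bracket h x y = -(koszulSign k (i * j) • bracket h' y x)
  bracket_self : ∀ {i n : ℤ} (h : i + i = n) (x : toComplex.X i), Even i → bracket h x x = 0
  bracket_bracket_self : ∀ {i n m : ℤ} (h : i + i = n) (h' : i + n = m) (x : toComplex.X i),
    Odd i → bracket h' x (bracket h x x) = 0
  jacobi : ∀ {i j l ij jl il n : ℤ} (hij : i + j = ij) (hjl : j + l = jl) (hil : i + l = il)
    (h₁ : i + jl = n) (h₂ : ij + l = n) (h₃ : j + il = n)
    (x : toComplex.X i) (y : toComplex.X j) (z : toComplex.X l),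
    bracket h₁ x (bracket hjl y z) =
      bracket h₂ (bracket hij x y) z + koszulSign k (i * j) • bracket h₃ y (bracket hil x z)
  leibniz : ∀ {i j n i' j' n' : ℤ} (h : i + j = n) (_hi : i + 1 = i') (_hj : j + 1 = j')
    (_hn : n + 1 = n') (h₁ : i' + j = n') (h₂ : i + j' = n')
    (x : toComplex.X i) (y : toComplex.X j),
    toComplex.d n n' (bracket h x y) =
      bracket h₁ (toComplex.d i i' x) y + koszulSign k i • bracket h₂ x (toComplex.d j j' y)

namespace DGLieAlgebra

variable {k : Type u} [CommRing k]

/-- Morphisms of dg Lie algebras: maps of complexes preserving the bracket. -/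
structure Hom (L M : DGLieAlgebra k) where
  toComplexHom : L.toComplex ⟶ M.toComplex
  map_bracket : ∀ {i j n : ℤ} (h : i + j = n) (x : L.toComplex.X i) (y : L.toComplex.X j),
    toComplexHom.f n (L.bracket h x y) =
      M.bracket h (toComplexHom.f i x) (toComplexHom.f j y)

/-- Two dg Lie algebras are quasi-isomorphic if they are connected by a finite zigzag of
quasi-isomorphisms of dg Lie algebras. -/
def QuasiIsomorphic (L M : DGLieAlgebra k) : Prop :=
  Relation.EqvGen (fun L M : DGLieAlgebra k => ∃ f : Hom L M, QuasiIso f.toComplexHom) L M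

end DGLieAlgebra

/-! ### Recursion on tensor words -/

namespace TensorAlgebra

variable {k : Type u} [CommRing k] {V : Type u} [AddCommGroup V] [Module k V]
  {N : Type u} [AddCommGroup N] [Module k N]

/-- Recursion on words: the linear map `F` on the tensor module with `F 1 = n₀` and
`F (a ⬝ w) = step a (w, F w)` for a letter `a` and a word `w`
(see `wordRec_one` and `wordRec_ι_mul`). -/
noncomputable def wordRec (n₀ : N) (step : V →ₗ[k] (TensorAlgebra k V × N) →ₗ[k] N) :
    TensorAlgebra k V →ₗ[k] N :=
  LinearMap.snd k (TensorAlgebra k V) N ∘ₗ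
    LinearMap.applyₗ ((1, n₀) : TensorAlgebra k V × N) ∘ₗ
      (TensorAlgebra.lift k (A := Module.End k (TensorAlgebra k V × N))
        (LinearMap.mk₂ k (fun a z => (ι k a * z.1, step a z))
          (by intros; simp [add_mul]) (by intros; simp)
          (by intros; simp [mul_add]) (by intros; simp))).toLinearMap

theorem word_induction {p : TensorAlgebra k V → Prop} (one : p 1)
    (smul : ∀ (r : k) w, p w → p (r • w)) (add : ∀ v w, p v → p w → p (v + w))
    (cons : ∀ a w, p w → p (ι k a * w)) (w : TensorAlgebra k V) : p w := by
  have key : ∀ x w : TensorAlgebra k V, p w → p (x * w) := by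
    intro x
    induction x using TensorAlgebra.induction with
    | algebraMap r => intro w hw; rw [← Algebra.smul_def]; exact smul r w hw
    | ι a => exact cons a
    | mul x y hx hy => intro w hw; rw [mul_assoc]; exact hx _ (hy _ hw)
    | add x y hx hy => intro w hw; rw [add_mul]; exact add _ _ (hx _ hw) (hy _ hw)
  simpa using key w 1 one

theorem word_ext {f g : TensorAlgebra k V →ₗ[k] N} (one : f 1 = g 1)
    (cons : ∀ a w, f w = g w → f (ι k a * w) = g (ι k a * w)) : f = g := by
  ext w
  induction w using word_induction with
  | one => exact one
  | smul r w hw => simp [hw]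
  | add v w hv hw => simp [hv, hw]
  | cons a w hw => exact cons a w hw

section

variable (n₀ : N) (step : V →ₗ[k] (TensorAlgebra k V × N) →ₗ[k] N)

theorem wordRec_one : wordRec n₀ step 1 = n₀ := by
  simp [wordRec]

theorem wordRec_ι_mul (a : V) (w : TensorAlgebra k V) :
    wordRec n₀ step (ι k a * w) = step a (w, wordRec n₀ step w) := by
  set φ := TensorAlgebra.lift k (A := Module.End k (TensorAlgebra k V × N))
        (LinearMap.mk₂ k (fun a z => (ι k a * z.1, step a z))
          (by intros; simp [add_mul]) (by intros; simp)
          (by intros; simp [mul_add]) (by intros; simp)) with hφ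
  have h1 : ∀ w, (φ w (1, n₀)).1 = w := by
    intro w
    induction w using word_induction with
    | one => simp
    | smul r w hw => simp [hw]
    | add v w hv hw => simp [hv, hw]
    | cons a w hw => rw [map_mul, Module.End.mul_apply, hφ, lift_ι_apply, ← hφ]; simp [hw]
  have h2 : ∀ w, wordRec n₀ step w = (φ w (1, n₀)).2 := fun w => rfl
  rw [h2, h2, map_mul, Module.End.mul_apply]
  conv_lhs => rw [hφ, lift_ι_apply, ← hφ]
  simp only [LinearMap.mk₂_apply]
  congr 1
  exact Prod.ext (h1 w) rfl

end

/-- The deconcatenation coproduct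
`Δ(a₁ ⋯ aₙ) = ∑_{0 ≤ i ≤ n} (a₁ ⋯ aᵢ) ⊗ (aᵢ₊₁ ⋯ aₙ)` of the cofree coalgebra, given by
`Δ(1) = 1 ⊗ 1` and `Δ(a ⬝ w) = 1 ⊗ (a ⬝ w) + (a ⬝ -) ⊗ id (Δ w)`. -/
noncomputable def deconcat :
    TensorAlgebra k V →ₗ[k] TensorAlgebra k V ⊗[k] TensorAlgebra k V :=
  wordRec (1 ⊗ₜ 1) <| LinearMap.mk₂ k
    (fun a z => 1 ⊗ₜ (ι k a * z.1) + (LinearMap.mulLeft k (ι k a)).rTensor _ z.2)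
    (by
      intro a b z
      have h : LinearMap.mulLeft k (ι k (a + b)) =
        LinearMap.mulLeft k (ι k a) + LinearMap.mulLeft k (ι k b) := by
          ext; simp [add_mul]
      simp only [h]
      simp only [map_add, add_mul, tmul_add, LinearMap.rTensor_add, LinearMap.add_apply]
      abel)
    (by
      intro r a z
      have h : LinearMap.mulLeft k (ι k (r • a)) = r • LinearMap.mulLeft k (ι k a) := by
          ext; simp
      simp only [h]
      simp only [map_smul, smul_mul_assoc, tmul_smul, LinearMap.rTensor_smul,
        LinearMap.smul_apply, smul_add])
    (by
      intro a z z'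
      simp only [Prod.fst_add, Prod.snd_add, mul_add, tmul_add, map_add]
      abel)
    (by
      intro r a z
      simp only [Prod.smul_fst, Prod.smul_snd, mul_smul_comm, tmul_smul, map_smul, smul_add])

theorem deconcat_one : deconcat (1 : TensorAlgebra k V) = 1 ⊗ₜ 1 := wordRec_one _ _

theorem deconcat_ι_mul (a : V) (w : TensorAlgebra k V) :
    deconcat (ι k a * w) =
      1 ⊗ₜ (ι k a * w) + (LinearMap.mulLeft k (ι k a)).rTensor _ (deconcat w) :=
  wordRec_ι_mul _ _ _ _

end TensorAlgebra

/-! ### The dg coalgebra `A^∨` -/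

namespace DGAlgebra

open TensorAlgebra

variable {k : Type u} [CommRing k] (A : DGAlgebra k)

/-- The module underlying `A^∨ = ⨁ₙ A^{⊗ n}[n]`, the cofree coalgebra on `A[1]`. The letter
`ι k a` stands for the element `a` of `A[1]`; it has degree `|a| - 1`. -/
abbrev Bar : Type u := TensorAlgebra k A.carrier

/-- The component of degree `q` of `A^∨`: it is spanned by the words `a₁ ⋯ aₙ`
(with `n ≥ 0`) in homogeneous letters with `∑ (|aᵢ| - 1) = q`. -/
def barGr (q : ℤ) : Submodule k A.Bar :=
  Submodule.span k {w | ∃ l : List (Σ i : ℤ, A.gr i),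
    (l.map fun x => x.1 - 1).sum = q ∧ (l.map fun x => ι k (x.2 : A.carrier)).prod = w}

/-- The map `a ↦ (-1) ^ (p (|a| - 1)) a` on `A`. -/
noncomputable def letterTwist (p : ℤ) : A.carrier →ₗ[k] A.carrier :=
  DirectSum.toModule k ℤ A.carrier
      (fun i => koszulSign k (p * (i - 1)) • (A.gr i).subtype) ∘ₗ
    (DirectSum.decomposeLinearEquiv A.gr).toLinearMap

/-- The map `w ↦ (-1) ^ (p |w|) w` on `A^∨`; see `barTwist_apply`. -/
noncomputable def barTwist (p : ℤ) : A.Bar →ₗ[k] A.Bar :=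
  (TensorAlgebra.lift k (ι k ∘ₗ A.letterTwist p)).toLinearMap

/-- Multiplication into the first letter: `(a, b ⬝ w) ↦ (a b) ⬝ w`, and `(a, 1) ↦ 0`. -/
noncomputable def mulHead : A.carrier →ₗ[k] A.Bar →ₗ[k] A.Bar :=
  (wordRec (k := k) (V := A.carrier) (N := A.carrier →ₗ[k] A.Bar) 0
    (LinearMap.mk₂ k
      (fun b z => LinearMap.mulRight k z.1 ∘ₗ ι k ∘ₗ LinearMap.mulRight k b)
      (by intros; ext; simp [mul_add, add_mul]) (by intros; ext; simp)
      (by intros; ext; simp [mul_add]) (by intros; ext; simp))).flip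

/-- The differential of `A^∨` encoding the differential and the multiplication of `A`: it is the
coderivation of degree `1` with the components `a ↦ -(d a)` and
`a ⬝ b ↦ (-1) ^ |a| (a b)`, that is
`D(a ⬝ w) = -(d a) ⬝ w + (-1) ^ |a| (a b) ⬝ w' + (-1) ^ (|a| - 1) a ⬝ D w` for `w = b ⬝ w'`
(the middle term is absent for `w = 1`), and `D(1) = 0`. -/
noncomputable def barD : A.Bar →ₗ[k] A.Bar :=
  wordRec (k := k) (V := A.carrier) (N := A.Bar) 0 <| LinearMap.mk₂ k
    (fun a z => -(ι k (A.d a) * z.1) - A.mulHead (A.letterTwist 1 a) z.1 +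
      ι k (A.letterTwist 1 a) * z.2)
    (by intros; simp only [map_add, add_mul, LinearMap.add_apply]; abel)
    (by intros; simp only [map_smul, smul_mul_assoc, LinearMap.smul_apply]; module)
    (by intros; simp only [Prod.fst_add, Prod.snd_add, map_add, mul_add]; abel)
    (by intros; simp only [Prod.smul_fst, Prod.smul_snd, map_smul, mul_smul_comm]; module)

/-- The module of graded coderivations of degree `p` of `A^∨`: the maps `δ` of degree `p` with
`Δ ∘ δ = (δ ⊗ id + id ⊗ δ) ∘ Δ`, where by the Koszul rule
`(id ⊗ δ)(x ⊗ y) = (-1) ^ (p |x|) x ⊗ δ y`. -/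
def coder (p : ℤ) : Submodule k (A.Bar →ₗ[k] A.Bar) where
  carrier := {δ | (∀ (q : ℤ) (x : A.Bar), x ∈ A.barGr q → δ x ∈ A.barGr (q + p)) ∧
    deconcat ∘ₗ δ =
      (TensorProduct.map δ LinearMap.id + TensorProduct.map (A.barTwist p) δ) ∘ₗ deconcat}
  zero_mem' := ⟨fun _ _ _ => Submodule.zero_mem _, by simp⟩
  add_mem' := by
    rintro δ ε ⟨h1, h2⟩ ⟨h1', h2'⟩
    refine ⟨fun q x hx => Submodule.add_mem _ (h1 q x hx) (h1' q x hx), ?_⟩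
    rw [LinearMap.comp_add, h2, h2', TensorProduct.map_add_left, TensorProduct.map_add_right,
      ← LinearMap.add_comp]
    congr 1
    abel
  smul_mem' := by
    rintro r δ ⟨h1, h2⟩
    refine ⟨fun q x hx => Submodule.smul_mem _ _ (h1 q x hx), ?_⟩
    rw [LinearMap.comp_smul, h2, TensorProduct.map_smul_left, TensorProduct.map_smul_right,
      ← smul_add, LinearMap.smul_comp]

/-! #### Properties needed to see that the coderivations form a dg Lie algebra -/

variable {A}

theorem letterTwist_apply (p : ℤ) {i : ℤ} {a : A.carrier} (ha : a ∈ A.gr i) :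
    A.letterTwist p a = koszulSign k (p * (i - 1)) • a := by
  rw [letterTwist, LinearMap.comp_apply, LinearEquiv.coe_coe, DirectSum.decomposeLinearEquiv_apply,
    DirectSum.decompose_of_mem A.gr ha, ← DirectSum.lof_eq_of k, DirectSum.toModule_lof]
  rfl

theorem letter_induction {p : A.carrier → Prop} (hom : ∀ i a, a ∈ A.gr i → p a)
    (add : ∀ a b, p a → p b → p (a + b)) (a : A.carrier) : p a :=
  DirectSum.Decomposition.inductionOn A.gr (hom 0 0 (Submodule.zero_mem _))
    (fun {i} m => hom i m m.2) add a

theorem letterTwist_twist (a : A.carrier) : A.letterTwist 1 (A.letterTwist 1 a) = a := by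
  induction a using letter_induction with
  | hom i a ha => rw [letterTwist_apply 1 ha, map_smul, letterTwist_apply 1 ha, smul_smul,
      koszulSign_sq, one_smul]
  | add a b ha hb => simp [ha, hb]

theorem letterTwist_d (a : A.carrier) : A.letterTwist 1 (A.d a) = -A.d (A.letterTwist 1 a) := by
  induction a using letter_induction with
  | hom i a ha =>
    rw [letterTwist_apply 1 ha, map_smul, letterTwist_apply 1 (A.d_mem ha), ← neg_smul,
      show (1 : ℤ) * (i + 1 - 1) = 1 * (i - 1) + 1 by ring, koszulSign_add, koszulSign_one,
      mul_neg_one]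
  | add a b ha hb => simp only [map_add, ha, hb]; abel

theorem letterTwist_mul (a b : A.carrier) :
    A.letterTwist 1 (a * b) = -(A.letterTwist 1 a * A.letterTwist 1 b) := by
  induction a using letter_induction with
  | add a a' ha ha' => simp only [map_add, add_mul, ha, ha']; abel
  | hom i a ha =>
  induction b using letter_induction with
  | add b b' hb hb' => simp only [map_add, mul_add, hb, hb']; abel
  | hom j b hb =>
    rw [letterTwist_apply 1 ha, letterTwist_apply 1 hb,
      letterTwist_apply 1 (SetLike.GradedMul.mul_mem ha hb), smul_mul_smul_comm, ← neg_smul,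
      ← koszulSign_add, show (1 : ℤ) * (i + j - 1) = 1 * (i - 1) + 1 * (j - 1) + 1 by ring,
      koszulSign_add _ 1, koszulSign_one, mul_neg_one]

theorem d_mul (a b : A.carrier) : A.d (a * b) = A.d a * b - A.letterTwist 1 a * A.d b := by
  induction a using letter_induction with
  | add a a' ha ha' => simp only [map_add, add_mul, ha, ha']; abel
  | hom i a ha =>
    rw [letterTwist_apply 1 ha, A.leibniz ha, sub_eq_add_neg, smul_mul_assoc, ← neg_smul,
      show i = 1 * (i - 1) + 1 by ring, koszulSign_add, koszulSign_one]
    simp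

theorem one_mem_barGr : (1 : A.Bar) ∈ A.barGr 0 :=
  Submodule.subset_span ⟨[], by simp⟩

theorem cons_mem_barGr {i q n : ℤ} (h : i - 1 + q = n) {a : A.carrier} (ha : a ∈ A.gr i)
    {w : A.Bar} (hw : w ∈ A.barGr q) : ι k a * w ∈ A.barGr n := by
  subst h
  induction hw using Submodule.span_induction with
  | mem w hw =>
    obtain ⟨l, rfl, rfl⟩ := hw
    exact Submodule.subset_span ⟨⟨i, a, ha⟩ :: l, by simp⟩
  | zero => simp
  | add v w _ _ hv hw => rw [mul_add]; exact Submodule.add_mem _ hv hw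
  | smul r w _ hw => rw [mul_smul_comm]; exact Submodule.smul_mem _ _ hw

theorem barGr_induction {p : ∀ (q : ℤ) (w : A.Bar), w ∈ A.barGr q → Prop}
    (one : p 0 1 one_mem_barGr) (zero : ∀ q, p q 0 (Submodule.zero_mem _))
    (smul : ∀ q (r : k) w hw, p q w hw → p q (r • w) (Submodule.smul_mem _ r hw))
    (add : ∀ q v w hv hw, p q v hv → p q w hw → p q (v + w) (Submodule.add_mem _ hv hw))
    (cons : ∀ i q a w (ha : a ∈ A.gr i) (hw : w ∈ A.barGr q), p q w hw →
      p (i - 1 + q) (ι k a * w) (cons_mem_barGr rfl ha hw))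
    {q : ℤ} {w : A.Bar} (hw : w ∈ A.barGr q) : p q w hw := by
  induction hw using Submodule.span_induction with
  | mem w hw =>
    obtain ⟨l, rfl, rfl⟩ := hw
    induction l with
    | nil => simpa using one
    | cons x l ih =>
      simp only [List.map_cons, List.sum_cons, List.prod_cons]
      exact cons _ _ _ _ x.2.2 (Submodule.subset_span ⟨l, rfl, rfl⟩) ih
  | zero => exact zero q
  | add v w _ _ hv hw => exact add q v w _ _ hv hw
  | smul r w _ hw => exact smul q r w _ hw

theorem iSup_barGr : (⨆ q, A.barGr q) = ⊤ := by
  rw [eq_top_iff]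
  rintro w -
  induction w using word_induction with
  | one => exact Submodule.mem_iSup_of_mem 0 one_mem_barGr
  | smul r w hw => exact Submodule.smul_mem _ _ hw
  | add v w hv hw => exact Submodule.add_mem _ hv hw
  | cons a w hw =>
    induction a using letter_induction with
    | add a b ha hb => rw [map_add, add_mul]; exact Submodule.add_mem _ ha hb
    | hom i a ha =>
      induction hw using Submodule.iSup_induction' with
      | mem q w hw => exact Submodule.mem_iSup_of_mem _ (cons_mem_barGr rfl ha hw)
      | zero => simp
      | add v w _ _ hv hw => rw [mul_add]; exact Submodule.add_mem _ hv hw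

theorem bar_ext {N : Type u} [AddCommGroup N] [Module k N] {f g : A.Bar →ₗ[k] N}
    (h : ∀ q, ∀ x ∈ A.barGr q, f x = g x) : f = g := by
  ext w
  have hw : w ∈ ⨆ q, A.barGr q := by rw [iSup_barGr]; trivial
  induction hw using Submodule.iSup_induction' with
  | mem q w hw => exact h q w hw
  | zero => simp
  | add v w _ _ hv hw => simp [hv, hw]

theorem barTwist_one (p : ℤ) : A.barTwist p 1 = 1 := by simp [barTwist]

theorem barTwist_ι_mul (p : ℤ) (a : A.carrier) (w : A.Bar) :
    A.barTwist p (ι k a * w) = ι k (A.letterTwist p a) * A.barTwist p w := by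
  simp [barTwist]

theorem barTwist_apply (p : ℤ) {q : ℤ} {w : A.Bar} (hw : w ∈ A.barGr q) :
    A.barTwist p w = koszulSign k (p * q) • w := by
  induction hw using barGr_induction with
  | one => simp [barTwist_one, koszulSign_zero]
  | zero => simp
  | smul q r w _ hw => rw [map_smul, hw, smul_comm]
  | add q v w _ _ hv hw => rw [map_add, hv, hw, smul_add]
  | cons i q a w ha _ hw =>
    rw [barTwist_ι_mul, hw, letterTwist_apply p ha, map_smul, smul_mul_smul_comm,
      ← koszulSign_add, mul_add]

theorem barTwist_comp (p q : ℤ) : A.barTwist p ∘ₗ A.barTwist q = A.barTwist (p + q) :=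
  bar_ext fun r x hx => by
    rw [LinearMap.comp_apply, barTwist_apply q hx, map_smul, barTwist_apply p hx,
      barTwist_apply (p + q) hx, smul_smul, ← koszulSign_add]
    congr 2; ring

theorem comp_barTwist {p : ℤ} (q : ℤ) {δ : A.Bar →ₗ[k] A.Bar} (hδ : δ ∈ A.coder p) :
    δ ∘ₗ A.barTwist q = koszulSign k (p * q) • (A.barTwist q ∘ₗ δ) :=
  bar_ext fun r x hx => by
    rw [LinearMap.comp_apply, barTwist_apply q hx, map_smul, LinearMap.smul_apply,
      LinearMap.comp_apply, barTwist_apply q (hδ.1 r x hx), smul_smul, mul_add, koszulSign_add,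
      mul_comm q p, mul_left_comm, koszulSign_sq, mul_one]

theorem mulHead_one (a : A.carrier) : A.mulHead a 1 = 0 := by
  simp [mulHead, wordRec_one]

theorem mulHead_ι_mul (a b : A.carrier) (w : A.Bar) :
    A.mulHead a (ι k b * w) = ι k (a * b) * w := by
  simp [mulHead, wordRec_ι_mul]

theorem mulHead_mem {i q n : ℤ} (h : i + q = n) {a : A.carrier} (ha : a ∈ A.gr i) {w : A.Bar}
    (hw : w ∈ A.barGr q) : A.mulHead a w ∈ A.barGr n := by
  subst h
  induction hw using barGr_induction with
  | one => rw [mulHead_one]; exact Submodule.zero_mem _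
  | zero => simp
  | smul q r w _ hw => rw [map_smul]; exact Submodule.smul_mem _ _ hw
  | add q v w _ _ hv hw => rw [map_add]; exact Submodule.add_mem _ hv hw
  | cons j q b w hb hw _ =>
    rw [mulHead_ι_mul]
    exact cons_mem_barGr (by ring) (SetLike.GradedMul.mul_mem ha hb) hw

theorem mulHead_mulHead (a b : A.carrier) (w : A.Bar) :
    A.mulHead a (A.mulHead b w) = A.mulHead (a * b) w := by
  have : A.mulHead a ∘ₗ A.mulHead b = A.mulHead (a * b) := by
    refine word_ext ?_ fun c w _ => ?_
    · simp [mulHead_one]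
    · simp [mulHead_ι_mul, mul_assoc]
  exact LinearMap.congr_fun this w

theorem deconcat_mulHead (a : A.carrier) (w : A.Bar) :
    deconcat (A.mulHead a w) =
      1 ⊗ₜ[k] A.mulHead a w + (A.mulHead a).rTensor A.Bar (deconcat w) := by
  induction w using word_induction with
  | one => simp [mulHead_one, deconcat_one]
  | smul r w hw => simp only [map_smul, hw, smul_add, tmul_smul]
  | add v w hv hw => simp only [map_add, hv, hw, tmul_add]; abel
  | cons b w _ =>
    have h : A.mulHead a ∘ₗ LinearMap.mulLeft k (ι k b) = LinearMap.mulLeft k (ι k (a * b)) := by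
      ext x; simp [mulHead_ι_mul]
    rw [mulHead_ι_mul, deconcat_ι_mul, deconcat_ι_mul, map_add, LinearMap.rTensor_tmul,
      mulHead_one, zero_tmul, zero_add, ← LinearMap.rTensor_comp_apply, h]

theorem barD_one : A.barD 1 = 0 := wordRec_one _ _

theorem barD_ι_mul (a : A.carrier) (w : A.Bar) :
    A.barD (ι k a * w) = -(ι k (A.d a) * w) - A.mulHead (A.letterTwist 1 a) w +
      ι k (A.letterTwist 1 a) * A.barD w :=
  wordRec_ι_mul _ _ _ _

theorem barD_mulHead (a : A.carrier) (w : A.Bar) :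
    A.barD (A.mulHead a w) =
      -A.mulHead (A.d a) w - A.mulHead (A.letterTwist 1 a) (A.barD w) := by
  induction w using word_induction with
  | one => simp [mulHead_one, barD_one]
  | smul r w hw => simp only [map_smul, hw]; module
  | add v w hv hw => simp only [map_add, hv, hw]; abel
  | cons b w _ =>
    rw [mulHead_ι_mul, barD_ι_mul, barD_ι_mul, d_mul, letterTwist_mul]
    simp only [map_add, map_sub, map_neg, mulHead_ι_mul, mulHead_mulHead, sub_mul, neg_mul,
      LinearMap.neg_apply]
    abel

theorem barD_barD (w : A.Bar) : A.barD (A.barD w) = 0 := by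
  induction w using word_induction with
  | one => simp [barD_one]
  | smul r w hw => simp [hw]
  | add v w hv hw => simp [hv, hw]
  | cons a w hw =>
    rw [barD_ι_mul]
    simp only [map_add, map_sub, map_neg, barD_ι_mul, barD_mulHead, hw, letterTwist_twist,
      letterTwist_d, A.d_d, LinearMap.neg_apply, neg_mul, mul_zero, zero_mul, map_zero]
    abel

theorem barD_mem_coder : A.barD ∈ A.coder 1 := by
  refine ⟨fun q x hx => ?_, ?_⟩
  · induction hx using barGr_induction with
    | one => rw [barD_one]; exact Submodule.zero_mem _
    | zero => simp
    | smul q r w _ hw => rw [map_smul]; exact Submodule.smul_mem _ _ hw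
    | add q v w _ _ hv hw => rw [map_add]; exact Submodule.add_mem _ hv hw
    | cons i q a w ha hw ih =>
      have ha' : A.letterTwist 1 a ∈ A.gr i := by
        rw [letterTwist_apply 1 ha]; exact Submodule.smul_mem _ _ ha
      rw [barD_ι_mul]
      exact Submodule.add_mem _ (Submodule.sub_mem _
        (Submodule.neg_mem _ (cons_mem_barGr (by ring) (A.d_mem ha) hw))
        (mulHead_mem (by ring) ha' hw)) (cons_mem_barGr (by ring) ha' ih)
  · refine word_ext ?_ fun a w hw => ?_
    · simp [barD_one, deconcat_one]
    · have h1 : A.barD ∘ₗ LinearMap.mulLeft k (ι k a) =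
          -LinearMap.mulLeft k (ι k (A.d a)) - A.mulHead (A.letterTwist 1 a) +
            LinearMap.mulLeft k (ι k (A.letterTwist 1 a)) ∘ₗ A.barD := by
        ext x; simp [barD_ι_mul]
      have h2 : A.barTwist 1 ∘ₗ LinearMap.mulLeft k (ι k a) =
          LinearMap.mulLeft k (ι k (A.letterTwist 1 a)) ∘ₗ A.barTwist 1 := by
        ext x; simp [barTwist_ι_mul]
      simp only [LinearMap.comp_apply] at hw ⊢
      rw [barD_ι_mul, map_add, map_sub, map_neg, deconcat_ι_mul, deconcat_ι_mul,
        deconcat_mulHead, hw, deconcat_ι_mul]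
      simp only [map_add, LinearMap.add_apply, TensorProduct.map_tmul, barD_one, barTwist_one,
        zero_tmul, zero_add, barD_ι_mul, LinearMap.id_apply]
      have mm : ∀ (f g f' g' : A.Bar →ₗ[k] A.Bar) (x : A.Bar ⊗[k] A.Bar),
          TensorProduct.map f g (TensorProduct.map f' g' x) =
            TensorProduct.map (f ∘ₗ f') (g ∘ₗ g') x :=
        fun f g f' g' x => (LinearMap.congr_fun (TensorProduct.map_comp f g f' g') x).symm
      have h3 : ∀ f g : A.Bar →ₗ[k] A.Bar, -f - g = (-1 : k) • f + (-1 : k) • g := by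
        intros; module
      simp only [LinearMap.rTensor, mm, h1, h2, LinearMap.id_comp, LinearMap.comp_id]
      simp only [h3, TensorProduct.map_add_left, TensorProduct.map_smul_left, sub_eq_add_neg,
        tmul_add, tmul_neg, LinearMap.add_apply, LinearMap.smul_apply]
      module

theorem commutator_mem_coder {p q n : ℤ} (h : p + q = n) {δ ε : A.Bar →ₗ[k] A.Bar}
    (hδ : δ ∈ A.coder p) (hε : ε ∈ A.coder q) :
    δ ∘ₗ ε - koszulSign k (p * q) • (ε ∘ₗ δ) ∈ A.coder n := by
  subst h
  refine ⟨fun r x hx => Submodule.sub_mem _ ?_ (Submodule.smul_mem _ _ ?_), ?_⟩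
  · have := hδ.1 _ _ (hε.1 _ _ hx)
    rwa [show r + q + p = r + (p + q) by ring] at this
  · have := hε.1 _ _ (hδ.1 _ _ hx)
    rwa [show r + p + q = r + (p + q) by ring] at this
  · have e1 := comp_barTwist q hδ
    have e2 := comp_barTwist p hε
    have t2 : A.barTwist q ∘ₗ A.barTwist p = A.barTwist (p + q) := by
      rw [barTwist_comp, add_comm]
    rw [LinearMap.comp_sub, LinearMap.comp_smul, ← LinearMap.comp_assoc, ← LinearMap.comp_assoc,
      hδ.2, hε.2, LinearMap.comp_assoc, LinearMap.comp_assoc, hδ.2, hε.2, ← LinearMap.comp_assoc,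
      ← LinearMap.comp_assoc, ← LinearMap.smul_comp, ← LinearMap.sub_comp]
    congr 1
    have h3 : δ ∘ₗ ε - koszulSign k (p * q) • (ε ∘ₗ δ) =
        δ ∘ₗ ε + (-koszulSign k (p * q)) • (ε ∘ₗ δ) := by module
    have h4 : koszulSign k (p * q) * koszulSign k (q * p) = 1 := by
      rw [mul_comm q p, koszulSign_sq]
    rw [h3]
    simp only [LinearMap.add_comp, LinearMap.comp_add, ← TensorProduct.map_comp, e1, e2,
      barTwist_comp, t2, LinearMap.id_comp, LinearMap.comp_id, TensorProduct.map_smul_left,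
      TensorProduct.map_smul_right, TensorProduct.map_add_left,
      TensorProduct.map_add_right, smul_add, smul_smul, h4]
    module

variable (A)

/-- The graded commutator `[δ, ε] = δ ε - (-1) ^ (|δ| |ε|) ε δ` of coderivations. -/
noncomputable def coderBracket {p q n : ℤ} (h : p + q = n) :
    A.coder p →ₗ[k] A.coder q →ₗ[k] A.coder n :=
  LinearMap.mk₂ k
    (fun δ ε => ⟨δ.1 ∘ₗ ε.1 - koszulSign k (p * q) • (ε.1 ∘ₗ δ.1),
      commutator_mem_coder h δ.2 ε.2⟩)
    (by
      intros; ext1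
      simp only [Submodule.coe_add, LinearMap.add_comp, LinearMap.comp_add]; module)
    (by
      intros; ext1
      simp only [Submodule.coe_smul, LinearMap.smul_comp, LinearMap.comp_smul]; module)
    (by
      intros; ext1
      simp only [Submodule.coe_add, LinearMap.add_comp, LinearMap.comp_add]; module)
    (by
      intros; ext1
      simp only [Submodule.coe_smul, LinearMap.smul_comp, LinearMap.comp_smul]; module)

variable {A} in
theorem coderBracket_coe {p q n : ℤ} (h : p + q = n) (δ : A.coder p) (ε : A.coder q) :
    (A.coderBracket h δ ε : A.Bar →ₗ[k] A.Bar) =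
      δ.1 ∘ₗ ε.1 - koszulSign k (p * q) • (ε.1 ∘ₗ δ.1) := rfl

/-- The differential `δ ↦ [D, δ]` on coderivations. -/
noncomputable def coderD {p q : ℤ} (h : p + 1 = q) : A.coder p →ₗ[k] A.coder q :=
  A.coderBracket (show 1 + p = q by omega) ⟨A.barD, barD_mem_coder⟩

variable {A} in
theorem coderD_coe {p q : ℤ} (h : p + 1 = q) (δ : A.coder p) :
    (A.coderD h δ : A.Bar →ₗ[k] A.Bar) =
      A.barD ∘ₗ δ.1 - koszulSign k p • (δ.1 ∘ₗ A.barD) := by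
  rw [coderD, coderBracket_coe, one_mul]

variable {A} in
theorem coderD_coderD {p q r : ℤ} (h : p + 1 = q) (h' : q + 1 = r) (δ : A.coder p) :
    A.coderD h' (A.coderD h δ) = 0 := by
  have hD : A.barD ∘ₗ A.barD = 0 := LinearMap.ext barD_barD
  subst h
  refine Subtype.ext ?_
  rw [coderD_coe, coderD_coe]
  simp only [LinearMap.comp_sub, LinearMap.sub_comp, LinearMap.comp_smul, LinearMap.smul_comp,
    LinearMap.comp_assoc, hD, LinearMap.comp_zero, koszulSign_add, koszulSign_one]
  rw [← LinearMap.comp_assoc, hD, LinearMap.zero_comp]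
  simp only [ZeroMemClass.coe_zero]
  module

/-- The complex of coderivations of `A^∨`, with the differential `δ ↦ [D, δ]`. -/
noncomputable def coderComplex : CochainComplex (ModuleCat.{u} k) ℤ where
  X p := ModuleCat.of k (A.coder p)
  d p q := if h : p + 1 = q then ModuleCat.ofHom (A.coderD h) else 0
  shape p q h := dif_neg h
  d_comp_d' := by
    rintro i j l (h : i + 1 = j) (h' : j + 1 = l)
    rw [dif_pos h, dif_pos h']
    ext1
    exact LinearMap.ext fun x => coderD_coderD h h' x

variable {A} in
theorem coderComplex_d {p q : ℤ} (h : p + 1 = q) (x : A.coder p) :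
    A.coderComplex.d p q x = A.coderD h x := by
  simp only [coderComplex, dif_pos h]
  rfl

variable {A}

theorem coderBracket_antisymm {i j n : ℤ} (h : i + j = n) (h' : j + i = n) (x : A.coder i)
    (y : A.coder j) :
    A.coderBracket h x y = -(koszulSign k (i * j) • A.coderBracket h' y x) := by
  refine Subtype.ext ?_
  simp only [Submodule.coe_neg, Submodule.coe_smul, coderBracket_coe, smul_sub, smul_smul,
    mul_comm j i, koszulSign_sq]
  module

theorem coderBracket_self {i n : ℤ} (h : i + i = n) (x : A.coder i) (hi : Even i) :
    A.coderBracket h x x = 0 := by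
  refine Subtype.ext ?_
  simp only [coderBracket_coe, koszulSign_even (hi.mul_right i), ZeroMemClass.coe_zero]
  module

theorem coderBracket_bracket_self {i n m : ℤ} (h : i + i = n) (h' : i + n = m) (x : A.coder i)
    (hi : Odd i) : A.coderBracket h' x (A.coderBracket h x x) = 0 := by
  refine Subtype.ext ?_
  subst h
  simp only [coderBracket_coe, koszulSign_odd (hi.mul hi), ZeroMemClass.coe_zero,
    koszulSign_even ((show Even (i + i) from ⟨i, rfl⟩).mul_left i), LinearMap.comp_sub,
    LinearMap.sub_comp, LinearMap.comp_smul, LinearMap.smul_comp, LinearMap.comp_assoc]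
  module

theorem coderBracket_jacobi {i j l ij jl il n : ℤ} (hij : i + j = ij) (hjl : j + l = jl)
    (hil : i + l = il) (h₁ : i + jl = n) (h₂ : ij + l = n) (h₃ : j + il = n)
    (x : A.coder i) (y : A.coder j) (z : A.coder l) :
    A.coderBracket h₁ x (A.coderBracket hjl y z) =
      A.coderBracket h₂ (A.coderBracket hij x y) z +
        koszulSign k (i * j) • A.coderBracket h₃ y (A.coderBracket hil x z) := by
  subst hij hjl hil
  refine Subtype.ext ?_
  have hs := koszulSign_sq (k := k) (i * j)
  simp only [Submodule.coe_add, Submodule.coe_smul, coderBracket_coe, LinearMap.comp_sub,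
    LinearMap.sub_comp, LinearMap.comp_smul, LinearMap.smul_comp, LinearMap.comp_assoc,
    mul_add, add_mul, koszulSign_add, smul_sub, smul_smul, mul_comm j i]
  match_scalars <;> grind

theorem coderD_leibniz {i j n i' j' n' : ℤ} (h : i + j = n) (hi : i + 1 = i') (hj : j + 1 = j')
    (hn : n + 1 = n') (h₁ : i' + j = n') (h₂ : i + j' = n') (x : A.coder i) (y : A.coder j) :
    A.coderD hn (A.coderBracket h x y) =
      A.coderBracket h₁ (A.coderD hi x) y +
        koszulSign k i • A.coderBracket h₂ x (A.coderD hj y) := by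
  have := coderBracket_jacobi (show 1 + i = i' by omega) h (show 1 + j = j' by omega)
    (show 1 + n = n' by omega) h₁ h₂ ⟨A.barD, barD_mem_coder⟩ x y
  rwa [one_mul] at this

variable (A)

/-- The shifted Hochschild cochain complex `C(A)[1]`: the dg Lie algebra of graded coderivations
of the dg coalgebra `A^∨`. -/
noncomputable def hochschildLie : DGLieAlgebra k where
  toComplex := A.coderComplex
  bracket h := A.coderBracket h
  antisymm h h' x y := coderBracket_antisymm h h' x y
  bracket_self h x hi := coderBracket_self h x hi
  bracket_bracket_self h h' x hi := coderBracket_bracket_self h h' x hi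
  jacobi hij hjl hil h₁ h₂ h₃ x y z := coderBracket_jacobi hij hjl hil h₁ h₂ h₃ x y z
  leibniz {i j n i' j' n'} h hi hj hn h₁ h₂ x y := by
    have key : ∀ (dx : A.coder i') (dy : A.coder j') (dz : A.coder n'), dx = A.coderD hi x →
        dy = A.coderD hj y → dz = A.coderD hn (A.coderBracket h x y) →
        dz = A.coderBracket h₁ dx y + koszulSign k i • A.coderBracket h₂ x dy := by
      rintro _ _ _ rfl rfl rfl
      exact coderD_leibniz h hi hj hn h₁ h₂ x y
    exact key _ _ _ (coderComplex_d hi x) (coderComplex_d hj y) (coderComplex_d hn _)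

end DGAlgebra

/-!
Quasi-isomorphic dg algebras `A` and `A'` are connected by a single span `A ← Z → A'` of degreewise
surjective quasi-isomorphisms, called acyclic fibrations below, because homotopy pullbacks of dg
algebras turn cospans into spans (`DGAlgebra.QuasiIsomorphic.exists_span`). If `Z` were cofibrant as
a complex, it would remain to compare the coderivations along each leg. In general it is replaced by
an `A∞`-algebra, that is, by a graded module `V` with a differential on its tensor coalgebra, which
is cofibrant and maps to `Z` by an acyclic fibration `f` that is a strict morphism, in two steps.

* Since `A` is cofibrant, the acyclic fibration `Z → A` has a section. Adding to `A` the cone on a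
  free module that surjects onto `Z` gives a cofibrant complex `V` with an acyclic fibration
  `f : V → Z` (`DGModule.exists_cofibrant`).
* The structure of `Z` is lifted along `f` by induction on the length of words
  (`DGModule.exists_transfer`). The obstruction to extending the structure to words of length `n` is
  a cocycle in the complex of multilinear maps `V ^ ⊗ n → V`, and it is removed because this complex
  maps to that of the multilinear maps `V ^ ⊗ n → Z` by an acyclic fibration. The latter holds by
  currying, one cofibrant factor at a time (`DGModule.isAcyclicFibration_wordHom`).

The composites `V → A` and `V → A'` are strict acyclic fibrations between cofibrant
`A∞`-algebras. Such a map `g : V → B` has a section `s`, compatible with the linear part of the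
differentials, and a homotopy `h` from `s ∘ g` to the identity with `g ∘ h = 0`
(`AInfinityAlgebra.exists_isContraction`). The coderivations of the tensor coalgebra of `V` that
induce a coderivation of that of `B` form a dg Lie algebra `P`, with morphisms
`Coder V ← P → Coder B`, and both are quasi-isomorphisms:

* the projection to `Coder B` is surjective, and post-composition with `h` contracts its kernel, up
  to terms of higher order in the length of words (`IsContraction.exists_comm_eq_of_ker`);
* `P` consists of the coderivations whose corestriction, followed by `g`, vanishes on the kernel of
  the tensor powers of `g`, and precomposition with the homotopy on words induced by `h` contracts
  the quotient of `Coder V` by `P` in the same sense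
  (`IsContraction.exists_sub_comm_mem_projectable`).

A coderivation is determined by its corestriction, and its value on a word involves the corestriction
only on subwords. Hence corrections that start on longer and longer words have a limit, and
successive approximation (`AInfinityAlgebra.exists_sub_comm`) shows that the kernel and the quotient
are acyclic.
-/

/-! ### Quasi-isomorphisms in terms of elements -/

section QuasiIso

variable {k : Type u} [CommRing k]

theorem shortComplex_quasiIso_iff {S T : ShortComplex (ModuleCat.{u} k)} (φ : S ⟶ T) :
    ShortComplex.QuasiIso φ ↔
      (∀ x : S.X₂, S.g x = 0 → ∀ y : T.X₁, T.f y = φ.τ₂ x → ∃ x' : S.X₁, S.f x' = x) ∧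
      (∀ y : T.X₂, T.g y = 0 → ∃ x : S.X₂, S.g x = 0 ∧ ∃ y' : T.X₁, T.f y' = φ.τ₂ x - y) := by
  have c12 : ∀ x, φ.τ₂ (S.f x) = T.f (φ.τ₁ x) := fun x =>
    (congr($(φ.comm₁₂).hom x)).symm
  have c23 : ∀ x, φ.τ₃ (S.g x) = T.g (φ.τ₂ x) := fun x =>
    (congr($(φ.comm₂₃).hom x)).symm
  let K : LinearMap.ker S.g.hom →ₗ[k] LinearMap.ker T.g.hom :=
    φ.τ₂.hom.restrict fun x hx => by
      rw [LinearMap.mem_ker] at hx ⊢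
      rw [← c23, hx, map_zero]
  have hle : LinearMap.range S.moduleCatToCycles ≤
      (LinearMap.range T.moduleCatToCycles).comap K := by
    rintro _ ⟨x, rfl⟩
    exact ⟨φ.τ₁ x, Subtype.ext (c12 x).symm⟩
  let γ : ShortComplex.LeftHomologyMapData φ S.moduleCatLeftHomologyData
      T.moduleCatLeftHomologyData :=
    { φK := ModuleCat.ofHom K
      φH := ModuleCat.ofHom (Submodule.mapQ _ _ K hle)
      commi := rfl
      commf' := by
        ext x
        exact Subtype.ext (c12 x)
      commπ := by ext x; rfl }
  rw [γ.quasiIso_iff, ConcreteCategory.isIso_iff_bijective, Function.Bijective]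
  change Function.Injective (Submodule.mapQ _ _ K hle) ∧
    Function.Surjective (Submodule.mapQ _ _ K hle) ↔ _
  refine and_congr ?_ ?_
  · rw [injective_iff_map_eq_zero]
    constructor
    · intro h x hx y hy
      have := h (Submodule.Quotient.mk ⟨x, hx⟩) (by
        rw [Submodule.mapQ_apply, Submodule.Quotient.mk_eq_zero]
        exact ⟨y, Subtype.ext hy⟩)
      rw [Submodule.Quotient.mk_eq_zero] at this
      obtain ⟨x', hx'⟩ := this
      exact ⟨x', congrArg Subtype.val hx'⟩
    · intro h a ha
      obtain ⟨x, rfl⟩ := Submodule.Quotient.mk_surjective _ a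
      rw [Submodule.mapQ_apply, Submodule.Quotient.mk_eq_zero] at ha
      obtain ⟨y, hy⟩ := ha
      obtain ⟨x', hx'⟩ := h x.1 x.2 y (congrArg Subtype.val hy)
      rw [Submodule.Quotient.mk_eq_zero]
      exact ⟨x', Subtype.ext hx'⟩
  · constructor
    · intro h y hy
      obtain ⟨a, ha⟩ := h (Submodule.Quotient.mk ⟨y, hy⟩)
      obtain ⟨x, rfl⟩ := Submodule.Quotient.mk_surjective _ a
      rw [Submodule.mapQ_apply, Submodule.Quotient.eq] at ha
      obtain ⟨y', hy'⟩ := ha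
      exact ⟨x.1, x.2, y', congrArg Subtype.val hy'⟩
    · intro h b
      obtain ⟨y, rfl⟩ := Submodule.Quotient.mk_surjective _ b
      obtain ⟨x, hx, y', hy'⟩ := h y.1 y.2
      refine ⟨Submodule.Quotient.mk ⟨x, hx⟩, ?_⟩
      rw [Submodule.mapQ_apply, Submodule.Quotient.eq]
      exact ⟨y', Subtype.ext hy'⟩

theorem quasiIso_iff_elements {K L : CochainComplex (ModuleCat.{u} k) ℤ} (φ : K ⟶ L) :
    QuasiIso φ ↔ ∀ i,
      (∀ x : K.X (i + 1), K.d (i + 1) (i + 1 + 1) x = 0 → ∀ y : L.X i, L.d i (i + 1) y = φ.f _ x →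
        ∃ x' : K.X i, K.d i (i + 1) x' = x) ∧
      (∀ y : L.X (i + 1), L.d (i + 1) (i + 1 + 1) y = 0 →
        ∃ x : K.X (i + 1), K.d (i + 1) (i + 1 + 1) x = 0 ∧
          ∃ y' : L.X i, L.d i (i + 1) y' = φ.f _ x - y) := by
  have key : ∀ i, QuasiIsoAt φ (i + 1) ↔ _ := fun i => (quasiIsoAt_iff' φ i (i + 1) (i + 1 + 1)
    (by simp) (by simp)).trans (shortComplex_quasiIso_iff _)
  rw [quasiIso_iff]
  constructor
  · intro h i
    exact (key i).1 (h _)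
  · intro h i
    obtain ⟨j, rfl⟩ : ∃ j, i = j + 1 := ⟨i - 1, by ring⟩
    exact (key j).2 (h j)

end QuasiIso

/-! ### Complexes inside a module -/

/-- A cochain complex whose components are submodules of a fixed module. The sum of the
components need not be direct, and the differential in degree `i` is the restriction of `d i`. -/
structure InternalComplex (k : Type u) [CommRing k] where
  carrier : Type u
  [addCommGroup : AddCommGroup carrier]
  [module : Module k carrier]
  gr : ℤ → Submodule k carrier
  d : ℤ → carrier →ₗ[k] carrier
  d_mem : ∀ {i : ℤ} {x : carrier}, x ∈ gr i → d i x ∈ gr (i + 1)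
  d_d : ∀ {i : ℤ} {x : carrier}, x ∈ gr i → d (i + 1) (d i x) = 0

namespace InternalComplex

attribute [instance] InternalComplex.addCommGroup InternalComplex.module

variable {k : Type u} [CommRing k]

/-- The cochain complex of modules given by the components. -/
noncomputable def toComplex (M : InternalComplex k) : CochainComplex (ModuleCat.{u} k) ℤ where
  X i := ModuleCat.of k (M.gr i)
  d i j := if h : i + 1 = j then
      ModuleCat.ofHom ((M.d i).restrict (p := M.gr i) (q := M.gr j) fun _ ha => h ▸ M.d_mem ha)
    else 0
  shape i j h := dif_neg h
  d_comp_d' := by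
    rintro i j l (rfl : i + 1 = j) (rfl : i + 1 + 1 = l)
    ext x
    simp [M.d_d x.2]

theorem toComplex_d (M : InternalComplex k) (i : ℤ) (x : M.gr i) :
    M.toComplex.d i (i + 1) x = (⟨M.d i x, M.d_mem x.2⟩ : M.gr (i + 1)) := by
  simp only [toComplex, dif_pos]
  rfl

/-- A chain map: a linear map that respects the degrees and, on homogeneous elements, the
differentials. -/
structure IsChainMap (M N : InternalComplex k) (f : M.carrier →ₗ[k] N.carrier) : Prop where
  map_mem : ∀ {i x}, x ∈ M.gr i → f x ∈ N.gr i
  map_d : ∀ {i x}, x ∈ M.gr i → f (M.d i x) = N.d i (f x)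

/-- `f` induces injective and surjective maps on cohomology. -/
structure IsQuasiIso (M N : InternalComplex k) (f : M.carrier →ₗ[k] N.carrier) : Prop where
  inj : ∀ i, ∀ x ∈ M.gr (i + 1), M.d (i + 1) x = 0 → ∀ y ∈ N.gr i, N.d i y = f x →
    ∃ x' ∈ M.gr i, M.d i x' = x
  surj : ∀ i, ∀ y ∈ N.gr (i + 1), N.d (i + 1) y = 0 →
    ∃ x ∈ M.gr (i + 1), M.d (i + 1) x = 0 ∧ ∃ y' ∈ N.gr i, N.d i y' = f x - y

/-- A degreewise surjective quasi-isomorphism. -/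
structure IsAcyclicFibration (M N : InternalComplex k) (f : M.carrier →ₗ[k] N.carrier) : Prop
    extends IsChainMap M N f where
  surj : ∀ {i}, ∀ y ∈ N.gr i, ∃ x ∈ M.gr i, f x = y
  quasiIso : IsQuasiIso M N f

variable {M N : InternalComplex k} {f : M.carrier →ₗ[k] N.carrier}

/-- The map of complexes underlying a chain map. -/
noncomputable def IsChainMap.toComplexHom (hf : IsChainMap M N f) :
    M.toComplex ⟶ N.toComplex where
  f i := ModuleCat.ofHom (f.restrict (p := M.gr i) (q := N.gr i) fun _ h => hf.map_mem h)
  comm' := by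
    rintro i j (rfl : i + 1 = j)
    simp only [toComplex, dif_pos]
    ext1
    exact LinearMap.ext fun x => Subtype.ext (hf.map_d x.2).symm

theorem IsChainMap.quasiIso_iff (hf : IsChainMap M N f) :
    QuasiIso hf.toComplexHom ↔ IsQuasiIso M N f := by
  rw [quasiIso_iff_elements]
  constructor
  · intro h
    refine ⟨fun i x hx hdx y hy hxy => ?_, fun i y hy hdy => ?_⟩
    · obtain ⟨x', hx'⟩ := (h i).1 ⟨x, hx⟩ ((M.toComplex_d _ _).trans (Subtype.ext hdx)) ⟨y, hy⟩
        ((N.toComplex_d _ _).trans (Subtype.ext hxy))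
      exact ⟨x'.1, x'.2, congrArg Subtype.val ((M.toComplex_d _ _).symm.trans hx')⟩
    · obtain ⟨x, hx, y', hy'⟩ := (h i).2 ⟨y, hy⟩ ((N.toComplex_d _ _).trans (Subtype.ext hdy))
      exact ⟨x.1, x.2, congrArg Subtype.val ((M.toComplex_d _ _).symm.trans hx), y'.1, y'.2,
        congrArg Subtype.val ((N.toComplex_d _ _).symm.trans hy')⟩
  · intro h i
    refine ⟨fun x hx y hxy => ?_, fun y hy => ?_⟩
    · obtain ⟨x', hx', e⟩ := h.inj i x.1 x.2
        (congrArg Subtype.val ((M.toComplex_d _ _).symm.trans hx)) y.1 y.2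
        (congrArg Subtype.val ((N.toComplex_d _ _).symm.trans hxy))
      exact ⟨⟨x', hx'⟩, (M.toComplex_d _ _).trans (Subtype.ext e)⟩
    · obtain ⟨x, hx, hdx, y', hy', e⟩ := h.surj i y.1 y.2
        (congrArg Subtype.val ((N.toComplex_d _ _).symm.trans hy))
      exact ⟨⟨x, hx⟩, (M.toComplex_d _ _).trans (Subtype.ext hdx), ⟨y', hy'⟩,
        (N.toComplex_d _ _).trans (Subtype.ext e)⟩

/-- A surjective chain map with acyclic kernel is a quasi-isomorphism. -/
theorem IsAcyclicFibration.of_acyclic_ker (hf : IsChainMap M N f)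
    (surj : ∀ {i}, ∀ y ∈ N.gr i, ∃ x ∈ M.gr i, f x = y)
    (ker : ∀ i, ∀ x ∈ M.gr (i + 1), M.d (i + 1) x = 0 → f x = 0 →
      ∃ x' ∈ M.gr i, f x' = 0 ∧ M.d i x' = x) : IsAcyclicFibration M N f := by
  refine ⟨hf, surj, fun i x hx hdx y hy hxy => ?_, fun i y hy hdy => ?_⟩
  · obtain ⟨z, hz, rfl⟩ := surj y hy
    obtain ⟨x', hx', -, e⟩ := ker i (x - M.d i z) (Submodule.sub_mem _ hx (M.d_mem hz))
      (by rw [map_sub, hdx, M.d_d hz, sub_zero]) (by rw [map_sub, hf.map_d hz, hxy, sub_self])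
    exact ⟨x' + z, Submodule.add_mem _ hx' hz, by rw [map_add, e, sub_add_cancel]⟩
  · obtain ⟨x, hx, rfl⟩ := surj y hy
    obtain ⟨x', hx', h0, e⟩ := ker (i + 1) (M.d (i + 1) x) (M.d_mem hx) (M.d_d hx)
      (by rw [hf.map_d hx, hdy])
    exact ⟨x - x', Submodule.sub_mem _ hx hx', by rw [map_sub, e, sub_self], 0,
      Submodule.zero_mem _, by rw [map_sub, h0]; simp⟩

theorem IsAcyclicFibration.acyclic_ker (hf : IsAcyclicFibration M N f) {i : ℤ} {x : M.carrier}
    (hx : x ∈ M.gr (i + 1)) (hdx : M.d (i + 1) x = 0) (h0 : f x = 0) :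
      ∃ x' ∈ M.gr i, f x' = 0 ∧ M.d i x' = x := by
  obtain ⟨j, rfl⟩ : ∃ j, i = j + 1 := ⟨i - 1, by ring⟩
  obtain ⟨x', hx', e⟩ := hf.quasiIso.inj _ x hx hdx 0 (Submodule.zero_mem _)
    (by rw [h0, map_zero])
  obtain ⟨z, hz, hdz, y', hy', e'⟩ := hf.quasiIso.surj j (f x') (hf.map_mem hx')
    (by rw [← hf.map_d hx', e, h0])
  obtain ⟨w, hw, rfl⟩ := hf.surj y' hy'
  refine ⟨x' - (z - M.d j w), Submodule.sub_mem _ hx' (Submodule.sub_mem _ hz (M.d_mem hw)),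
    ?_, ?_⟩
  · rw [map_sub, map_sub, hf.map_d hw, e']; abel
  · rw [map_sub, map_sub, hdz, M.d_d hw, e]; simp

/-- The lifting property against acyclic fibrations, among complexes inside a module. -/
def IsCofibrant (V : InternalComplex k) : Prop :=
  ∀ ⦃M N : InternalComplex k⦄ (p : M.carrier →ₗ[k] N.carrier), IsAcyclicFibration M N p →
    ∀ g : V.carrier →ₗ[k] N.carrier, IsChainMap V N g →
      ∃ l : V.carrier →ₗ[k] M.carrier, IsChainMap V M l ∧ ∀ x, p (l x) = g x

/-- The mapping cocone of the chain map `q : M → N`, shifted by `p`: a chain map into it is a pair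
of a cocycle `o` of degree `p + 1` in `M` and a map `b` of degree `p` to `N` with boundary
`q ∘ o`. -/
def cocone (M N : InternalComplex k) (q : M.carrier →ₗ[k] N.carrier) (hq : IsChainMap M N q)
    (p : ℤ) : InternalComplex k where
  carrier := M.carrier × N.carrier
  gr i := (M.gr (i + p + 1)).prod (N.gr (i + p))
  d i := LinearMap.prod (-koszulSign k p • M.d (i + p + 1) ∘ₗ LinearMap.fst k _ _)
    (koszulSign k p • (N.d (i + p) ∘ₗ LinearMap.snd k _ _ - q ∘ₗ LinearMap.fst k _ _))
  d_mem := by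
    rintro i ⟨x, y⟩ ⟨hx, hy⟩
    rw [show i + 1 + p = i + p + 1 by ring]
    exact ⟨Submodule.smul_mem _ _ (M.d_mem hx),
      Submodule.smul_mem _ _ (Submodule.sub_mem _ (N.d_mem hy) (hq.map_mem hx))⟩
  d_d := by
    rintro i ⟨x, y⟩ ⟨hx, hy⟩
    have h1 : M.d (i + p + 1 + 1) (M.d (i + p + 1) x) = 0 := M.d_d hx
    have h2 : N.d (i + p + 1) (N.d (i + p) y) = 0 := N.d_d hy
    have h3 : q (M.d (i + p + 1) x) = N.d (i + p + 1) (q x) := hq.map_d hx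
    have e : i + 1 + p = i + p + 1 := by ring
    refine Prod.ext ?_ ?_
    · simp [e, h1]
    · simp [e, h2, h3]

theorem IsChainMap.id (M : InternalComplex k) : IsChainMap M M LinearMap.id :=
  ⟨fun h => h, fun _ => rfl⟩

/-- A complex with the lifting property also lifts nullhomotopies: for an acyclic fibration `q`,
the map `Hom(V, M) → Hom(V, N)` of complexes is again an acyclic fibration. -/
theorem IsCofibrant.lift_homotopy {V M N : InternalComplex k} (hV : IsCofibrant V)
    {q : M.carrier →ₗ[k] N.carrier} (hq : IsAcyclicFibration M N q) (p : ℤ)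
    (o : V.carrier →ₗ[k] M.carrier) (b : V.carrier →ₗ[k] N.carrier)
    (ho : ∀ i, ∀ x ∈ V.gr i, o x ∈ M.gr (i + p + 1))
    (hb : ∀ i, ∀ x ∈ V.gr i, b x ∈ N.gr (i + p))
    (hdo : ∀ i, ∀ x ∈ V.gr i, M.d (i + p + 1) (o x) + koszulSign k p • o (V.d i x) = 0)
    (hqo : ∀ i, ∀ x ∈ V.gr i,
      q (o x) = N.d (i + p) (b x) - koszulSign k p • b (V.d i x)) :
    ∃ l : V.carrier →ₗ[k] M.carrier, (∀ i, ∀ x ∈ V.gr i, l x ∈ M.gr (i + p)) ∧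
      (∀ x, q (l x) = b x) ∧
      ∀ i, ∀ x ∈ V.gr i, M.d (i + p) (l x) - koszulSign k p • l (V.d i x) = o x := by
  have hs := koszulSign_sq (k := k) p
  set s := koszulSign k p with hsdef
  let P := cocone M M LinearMap.id (.id M) p
  let R := cocone M N q hq.toIsChainMap p
  have hPR : IsAcyclicFibration P R (LinearMap.prodMap LinearMap.id q) := by
    refine .of_acyclic_ker ⟨?_, ?_⟩ ?_ ?_
    · rintro i ⟨x, y⟩ ⟨hx, hy⟩
      exact ⟨hx, hq.map_mem hy⟩
    · rintro i ⟨x, y⟩ ⟨hx, hy⟩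
      have : q (M.d (i + p) y) = N.d (i + p) (q y) := hq.map_d hy
      refine Prod.ext rfl ?_
      change q (s • (M.d (i + p) y - x)) = s • (N.d (i + p) (q y) - q x)
      rw [map_smul, map_sub, this]
    · rintro i ⟨x, y⟩ ⟨hx, hy⟩
      obtain ⟨z, hz, rfl⟩ := hq.surj y hy
      exact ⟨(x, z), ⟨hx, hz⟩, rfl⟩
    · rintro i ⟨x, y⟩ ⟨hx, hy⟩ hd h0
      obtain rfl : x = 0 := congrArg Prod.fst h0
      have h0' : q y = 0 := congrArg Prod.snd h0
      have hy' : y ∈ M.gr (i + p + 1) := by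
        have e : i + 1 + p = i + p + 1 := by ring
        rw [← e]; exact hy
      have hd' : M.d (i + p + 1) y = 0 := by
        have h2 : s • (M.d (i + 1 + p) y - 0) = 0 := congrArg Prod.snd hd
        have e : i + 1 + p = i + p + 1 := by ring
        rw [e, sub_zero] at h2
        rw [← one_smul k (M.d _ y), ← hs, mul_smul, h2, smul_zero]
      obtain ⟨z, hz, hz0, rfl⟩ := hq.acyclic_ker hy' hd' h0'
      refine ⟨(0, s • z), ⟨Submodule.zero_mem _, Submodule.smul_mem _ _ hz⟩, ?_, ?_⟩
      · refine Prod.ext rfl ?_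
        change q (s • z) = 0
        rw [map_smul, hz0, smul_zero]
      · refine Prod.ext ?_ ?_
        · change -s • M.d (i + p + 1) 0 = 0
          rw [map_zero, smul_zero]
        · change s • (M.d (i + p) (s • z) - 0) = M.d (i + p) z
          rw [sub_zero, map_smul, smul_smul, hs, one_smul]
  obtain ⟨l, hl, e⟩ := hV _ hPR (LinearMap.prod o b) (by
    refine ⟨fun {i x} hx => ⟨ho i x hx, hb i x hx⟩, fun {i x} hx => ?_⟩
    have h1 := hdo i x hx
    have h2 := hqo i x hx
    have h1' : o (V.d i x) = -s • M.d (i + p + 1) (o x) := by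
      have : s • (M.d (i + p + 1) (o x) + s • o (V.d i x)) = 0 := by rw [h1, smul_zero]
      rw [smul_add, smul_smul, hs, one_smul] at this
      rw [eq_neg_of_add_eq_zero_right this, neg_smul]
    have h2' : b (V.d i x) = s • (N.d (i + p) (b x) - q (o x)) := by
      rw [h2, sub_sub_cancel, smul_smul, hs, one_smul]
    exact Prod.ext h1' h2')
  refine ⟨LinearMap.snd k _ _ ∘ₗ l, fun i x hx => (hl.map_mem hx).2,
    fun x => congrArg Prod.snd (e x), fun i x hx => ?_⟩
  have h1 : (l x).1 = o x := congrArg Prod.fst (e x)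
  have h2 : (l (V.d i x)).2 = s • (M.d (i + p) (l x).2 - (l x).1) :=
    congrArg Prod.snd (hl.map_d hx)
  change M.d (i + p) (l x).2 - s • (l (V.d i x)).2 = o x
  rw [h2, smul_smul, hs, one_smul, h1, sub_sub_cancel]

end InternalComplex

/-! ### Convolution on the tensor coalgebra -/

namespace TensorAlgebra

variable {k : Type u} [CommRing k] {V W X : Type u} [AddCommGroup V] [Module k V]
  [AddCommGroup W] [Module k W] [AddCommGroup X] [Module k X]

/-- The map `a₁ ⋯ aₙ ↦ f a₁ ⋯ f aₙ` of tensor coalgebras induced by a map of letters. -/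
noncomputable def wordMap (f : V →ₗ[k] W) : TensorAlgebra k V →ₗ[k] TensorAlgebra k W :=
  (lift k (ι k ∘ₗ f)).toLinearMap

@[simp] theorem wordMap_one (f : V →ₗ[k] W) : wordMap f 1 = 1 := by simp [wordMap]

@[simp] theorem wordMap_ι (f : V →ₗ[k] W) (a : V) : wordMap f (ι k a) = ι k (f a) := by
  simp [wordMap]

@[simp] theorem wordMap_ι_mul (f : V →ₗ[k] W) (a : V) (w : TensorAlgebra k V) :
    wordMap f (ι k a * w) = ι k (f a) * wordMap f w := by simp [wordMap]

theorem wordMap_comp (g : W →ₗ[k] X) (f : V →ₗ[k] W) :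
    wordMap g ∘ₗ wordMap f = wordMap (g ∘ₗ f) :=
  word_ext (by simp) fun a w h => by simp_all

theorem wordMap_id : wordMap (LinearMap.id : V →ₗ[k] V) = LinearMap.id :=
  word_ext (by simp) fun a w h => by simp_all

@[simp] theorem algebraMapInv_ι_mul (a : V) (w : TensorAlgebra k V) :
    algebraMapInv (ι k a * w) = 0 := by simp [algebraMapInv]

@[simp] theorem algebraMapInv_wordMap (f : V →ₗ[k] W) (w : TensorAlgebra k V) :
    algebraMapInv (wordMap f w) = algebraMapInv w := by
  have : algebraMapInv.toLinearMap ∘ₗ wordMap f = algebraMapInv.toLinearMap :=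
    word_ext (by simp) fun a w _ => by simp
  exact LinearMap.congr_fun this w

@[simp] theorem ιInv_one : ιInv (1 : TensorAlgebra k V) = 0 := by
  let : Module kᵐᵒᵖ V := Module.compHom _ ((RingHom.id k).fromOpposite mul_comm)
  have : IsCentralScalar k V := ⟨fun r m => rfl⟩
  change (toTrivSqZeroExt (1 : TensorAlgebra k V) : TrivSqZeroExt k V).snd = 0
  simp

@[simp] theorem ιInv_ι (a : V) : ιInv (ι k a) = a := ι_leftInverse a

@[simp] theorem ιInv_ι_mul (a : V) (w : TensorAlgebra k V) :
    ιInv (ι k a * w) = algebraMapInv w • a := by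
  let : Module kᵐᵒᵖ V := Module.compHom _ ((RingHom.id k).fromOpposite mul_comm)
  have : IsCentralScalar k V := ⟨fun r m => rfl⟩
  have h : (toTrivSqZeroExt w : TrivSqZeroExt k V).fst = algebraMapInv w := by
    have : (TrivSqZeroExt.fstHom k k V).toLinearMap ∘ₗ
        (toTrivSqZeroExt (R := k) (M := V)).toLinearMap = algebraMapInv.toLinearMap :=
      word_ext (by simp) fun a w _ => by simp
    exact LinearMap.congr_fun this w
  have e : ∀ x : TensorAlgebra k V, ιInv x = (toTrivSqZeroExt x : TrivSqZeroExt k V).snd :=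
    fun x => rfl
  simp [e, h]

theorem ιInv_wordMap (f : V →ₗ[k] W) (w : TensorAlgebra k V) :
    ιInv (wordMap f w) = f (ιInv w) := by
  have : ιInv ∘ₗ wordMap f = f ∘ₗ ιInv :=
    word_ext (by simp) fun a w _ => by simp
  exact LinearMap.congr_fun this w

theorem map_map_apply {M N M' N' M'' N'' : Type u} [AddCommGroup M] [Module k M] [AddCommGroup N]
    [Module k N] [AddCommGroup M'] [Module k M'] [AddCommGroup N'] [Module k N']
    [AddCommGroup M''] [Module k M''] [AddCommGroup N''] [Module k N''] (f : M' →ₗ[k] M'')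
    (g : N' →ₗ[k] N'') (f' : M →ₗ[k] M') (g' : N →ₗ[k] N') (x : M ⊗[k] N) :
    TensorProduct.map f g (TensorProduct.map f' g' x) =
      TensorProduct.map (f ∘ₗ f') (g ∘ₗ g') x :=
  (LinearMap.congr_fun (TensorProduct.map_comp f g f' g') x).symm

/-- The convolution `w ↦ ∑ f w₁ ⬝ g w₂` of two maps. -/
noncomputable def conv (f g : TensorAlgebra k V →ₗ[k] TensorAlgebra k W) :
    TensorAlgebra k V →ₗ[k] TensorAlgebra k W :=
  LinearMap.mul' k _ ∘ₗ TensorProduct.map f g ∘ₗ deconcat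

theorem conv_one (f g : TensorAlgebra k V →ₗ[k] TensorAlgebra k W) :
    conv f g 1 = f 1 * g 1 := by simp [conv, deconcat_one]

theorem conv_cons (f g : TensorAlgebra k V →ₗ[k] TensorAlgebra k W) (a : V)
    (w : TensorAlgebra k V) :
    conv f g (ι k a * w) = f 1 * g (ι k a * w) + conv (f ∘ₗ LinearMap.mulLeft k (ι k a)) g w := by
  simp only [conv, LinearMap.comp_apply, deconcat_ι_mul, map_add, map_tmul, LinearMap.mul'_apply,
    LinearMap.rTensor, map_map_apply, LinearMap.comp_id]

theorem conv_smul_left (r : k) (f g : TensorAlgebra k V →ₗ[k] TensorAlgebra k W) :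
    conv (r • f) g = r • conv f g := by
  simp [conv, map_smul_left, LinearMap.smul_comp, LinearMap.comp_smul]

theorem conv_zero_left (g : TensorAlgebra k V →ₗ[k] TensorAlgebra k W) :
    conv 0 g = 0 := by
  simpa using conv_smul_left 0 0 g

theorem conv_mulLeft (x : TensorAlgebra k W) (f g : TensorAlgebra k V →ₗ[k] TensorAlgebra k W)
    (w : TensorAlgebra k V) : conv (LinearMap.mulLeft k x ∘ₗ f) g w = x * conv f g w := by
  have : LinearMap.mul' k _ ∘ₗ TensorProduct.map (LinearMap.mulLeft k x ∘ₗ f) g =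
      LinearMap.mulLeft k x ∘ₗ LinearMap.mul' k _ ∘ₗ TensorProduct.map f g :=
    TensorProduct.ext' fun a b => by simp [mul_assoc]
  exact LinearMap.congr_fun this (deconcat w)

/-- The counit followed by the unit. -/
noncomputable def unitCounit : TensorAlgebra k V →ₗ[k] TensorAlgebra k W :=
  Algebra.linearMap k _ ∘ₗ algebraMapInv.toLinearMap

theorem unitCounit_one : unitCounit (1 : TensorAlgebra k V) = (1 : TensorAlgebra k W) := by
  simp [unitCounit]

theorem unitCounit_cons (a : V) :
    unitCounit ∘ₗ LinearMap.mulLeft k (ι k a) =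
      (0 : TensorAlgebra k V →ₗ[k] TensorAlgebra k W) := by
  ext w; simp [unitCounit]

theorem unitCounit_conv (g : TensorAlgebra k V →ₗ[k] TensorAlgebra k W) :
    conv unitCounit g = g :=
  word_ext (by simp [conv_one, unitCounit_one]) fun a w _ => by
    simp [conv_cons, unitCounit_one, unitCounit_cons, conv_zero_left]

theorem conv_unitCounit (g : TensorAlgebra k V →ₗ[k] TensorAlgebra k W) :
    conv g unitCounit = g := by
  ext w
  induction w using word_induction generalizing g with
  | one => simp [conv_one, unitCounit_one]
  | smul r w hw => simp [hw]
  | add v w hv hw => simp [hv, hw]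
  | cons a w hw =>
    have := LinearMap.congr_fun (unitCounit_cons (k := k) (W := W) a) w
    simp only [LinearMap.comp_apply, LinearMap.mulLeft_apply, LinearMap.zero_apply] at this
    rw [conv_cons, this, hw]
    simp

theorem deconcat_wordMap (f : V →ₗ[k] W) :
    deconcat ∘ₗ wordMap f = TensorProduct.map (wordMap f) (wordMap f) ∘ₗ deconcat := by
  refine word_ext (by simp [deconcat_one]) fun a w h => ?_
  simp only [LinearMap.comp_apply, wordMap_ι_mul, deconcat_ι_mul, map_add, map_tmul,
    wordMap_one] at h ⊢
  rw [h, LinearMap.rTensor, LinearMap.rTensor, map_map_apply, map_map_apply]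
  congr 3
  ext; simp

/-! ### Coderivations and their corestrictions -/

/-- `g` is a coderivation along the map `F` of coalgebras, where `τ` is the Koszul sign:
`Δ g = (g ⊗ F + F τ ⊗ g) Δ`. -/
def IsCoderAlong (F : TensorAlgebra k V →ₗ[k] TensorAlgebra k W)
    (τ : TensorAlgebra k V →ₗ[k] TensorAlgebra k V)
    (g : TensorAlgebra k V →ₗ[k] TensorAlgebra k W) : Prop :=
  deconcat ∘ₗ g = (TensorProduct.map g F + TensorProduct.map (F ∘ₗ τ) g) ∘ₗ deconcat

/-- Every word is the sum of its value under the counit and of the convolution of the projection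
to letters with the identity. -/
theorem eq_counit_add_conv (x : TensorAlgebra k V) :
    x = unitCounit x + conv (ι k ∘ₗ ιInv) LinearMap.id x := by
  have : LinearMap.id = unitCounit + conv (ι k ∘ₗ ιInv) (LinearMap.id (R := k)
      (M := TensorAlgebra k V)) := by
    refine word_ext (by simp [conv_one, unitCounit_one]) fun a w _ => ?_
    have h1 : (ι k ∘ₗ ιInv) ∘ₗ LinearMap.mulLeft k (ι k a) =
        LinearMap.mulLeft k (ι k a) ∘ₗ unitCounit := by
      ext x; simp [unitCounit, Algebra.algebraMap_eq_smul_one]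
    have h2 := LinearMap.congr_fun (unitCounit_cons (k := k) (W := V) a) w
    simp only [LinearMap.comp_apply, LinearMap.mulLeft_apply, LinearMap.zero_apply] at h2
    rw [LinearMap.add_apply, conv_cons, h1, conv_mulLeft, unitCounit_conv, h2]
    simp
  exact LinearMap.congr_fun this x

namespace IsCoderAlong

variable {f : V →ₗ[k] W} {t : V →ₗ[k] V} {g g' : TensorAlgebra k V →ₗ[k] TensorAlgebra k W}

section

variable {F : TensorAlgebra k V →ₗ[k] TensorAlgebra k W}
  {τ : TensorAlgebra k V →ₗ[k] TensorAlgebra k V}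

theorem sub (hg : IsCoderAlong F τ g) (hg' : IsCoderAlong F τ g') :
    IsCoderAlong F τ (g - g') := by
  rw [IsCoderAlong, LinearMap.comp_sub, hg, hg', ← LinearMap.sub_comp]
  congr 1
  have h3 : g - g' = g + (-1 : k) • g' := by module
  rw [h3]
  simp only [TensorProduct.map_add_left, TensorProduct.map_add_right, TensorProduct.map_smul_left,
    TensorProduct.map_smul_right]
  module

theorem add (hg : IsCoderAlong F τ g) (hg' : IsCoderAlong F τ g') :
    IsCoderAlong F τ (g + g') := by
  rw [IsCoderAlong, LinearMap.comp_add, hg, hg', ← LinearMap.add_comp]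
  congr 1
  simp only [TensorProduct.map_add_left, TensorProduct.map_add_right]
  abel

theorem smul (r : k) (hg : IsCoderAlong F τ g) : IsCoderAlong F τ (r • g) := by
  rw [IsCoderAlong, LinearMap.comp_smul, hg, ← LinearMap.smul_comp]
  congr 1
  simp only [TensorProduct.map_smul_left, TensorProduct.map_smul_right, smul_add]

end

theorem counit (hg : IsCoderAlong (wordMap f) (wordMap t) g) (w : TensorAlgebra k V) :
    unitCounit (g w) = (0 : TensorAlgebra k W) := by
  have e1 : (unitCounit : TensorAlgebra k W →ₗ[k] TensorAlgebra k W) =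
      conv unitCounit unitCounit := (unitCounit_conv _).symm
  have e2 : (unitCounit : TensorAlgebra k W →ₗ[k] TensorAlgebra k W) ∘ₗ g =
      unitCounit ∘ₗ g + unitCounit ∘ₗ g := by
    conv_lhs => rw [e1]
    have h1 : ∀ h : V →ₗ[k] W, unitCounit ∘ₗ wordMap h =
        (unitCounit : TensorAlgebra k V →ₗ[k] TensorAlgebra k W) := by
      intro h; ext x; simp [unitCounit]
    rw [conv, LinearMap.comp_assoc, LinearMap.comp_assoc, hg]
    nth_rw 1 [← conv_unitCounit (unitCounit ∘ₗ g)]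
    nth_rw 2 [← unitCounit_conv (unitCounit ∘ₗ g)]
    ext w
    simp only [conv, LinearMap.comp_apply, LinearMap.add_apply, map_add, map_map_apply,
      wordMap_comp, h1]
  have := LinearMap.congr_fun e2 w
  simpa using this

/-- A coderivation is determined recursively by its corestriction `ιInv ∘ g`. -/
theorem apply_eq (hg : IsCoderAlong (wordMap f) (wordMap t) g) (w : TensorAlgebra k V) :
    g w = conv (ι k ∘ₗ ιInv ∘ₗ g) (wordMap f) w +
      conv (ι k ∘ₗ f ∘ₗ t ∘ₗ ιInv) g w := by
  conv_lhs => rw [eq_counit_add_conv (g w), hg.counit, zero_add]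
  have h1 : ιInv ∘ₗ wordMap f ∘ₗ wordMap t = f ∘ₗ t ∘ₗ ιInv := by
    ext x; simp [ιInv_wordMap]
  have h2 := LinearMap.congr_fun hg w
  simp only [LinearMap.comp_apply] at h2
  simp only [conv, LinearMap.comp_apply, h2, LinearMap.add_apply, map_add, map_map_apply,
    LinearMap.comp_assoc, LinearMap.id_comp, h1]

theorem apply_one (hg : IsCoderAlong (wordMap f) (wordMap t) g) : g 1 = ι k (ιInv (g 1)) := by
  conv_lhs => rw [hg.apply_eq, conv_one, conv_one]
  simp

theorem apply_cons (hg : IsCoderAlong (wordMap f) (wordMap t) g) (a : V) (w : TensorAlgebra k V) :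
    g (ι k a * w) = conv (ι k ∘ₗ ιInv ∘ₗ g) (wordMap f) (ι k a * w) + ι k (f (t a)) * g w := by
  conv_lhs => rw [hg.apply_eq, conv_cons (ι k ∘ₗ f ∘ₗ t ∘ₗ ιInv)]
  have h : (ι k ∘ₗ f ∘ₗ t ∘ₗ ιInv) ∘ₗ LinearMap.mulLeft k (ι k a) =
      LinearMap.mulLeft k (ι k (f (t a))) ∘ₗ unitCounit := by
    ext x; simp [unitCounit, Algebra.algebraMap_eq_smul_one]
  rw [h, conv_mulLeft, unitCounit_conv]
  simp

end IsCoderAlong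

/-- The coderivation with corestriction `φ`; the map `t` of letters gives the Koszul sign. -/
noncomputable def coderOf (t : V →ₗ[k] V) (φ : TensorAlgebra k V →ₗ[k] V) :
    TensorAlgebra k V →ₗ[k] TensorAlgebra k V :=
  wordRec (ι k (φ 1)) <| LinearMap.mk₂ k
    (fun a z => conv (ι k ∘ₗ φ) LinearMap.id (ι k a * z.1) + ι k (t a) * z.2)
    (by intros; simp only [map_add, add_mul]; abel)
    (by intros; simp only [map_smul, smul_mul_assoc, smul_add])
    (by intros; simp only [Prod.fst_add, Prod.snd_add, mul_add, map_add]; abel)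
    (by intros; simp only [Prod.smul_fst, Prod.smul_snd, mul_smul_comm, map_smul, smul_add])

section coderOf

variable (t : V →ₗ[k] V) (φ : TensorAlgebra k V →ₗ[k] V)

theorem coderOf_one : coderOf t φ 1 = ι k (φ 1) := wordRec_one _ _

theorem coderOf_cons (a : V) (w : TensorAlgebra k V) : coderOf t φ (ι k a * w) =
    conv (ι k ∘ₗ φ) LinearMap.id (ι k a * w) + ι k (t a) * coderOf t φ w :=
  wordRec_ι_mul _ _ _ _

theorem deconcat_ι (a : V) : deconcat (ι k a) = 1 ⊗ₜ ι k a + ι k a ⊗ₜ 1 := by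
  rw [← mul_one (ι k a), deconcat_ι_mul, deconcat_one]
  simp

theorem deconcat_conv (w : TensorAlgebra k V) :
    deconcat (conv (ι k ∘ₗ φ) LinearMap.id w) = 1 ⊗ₜ conv (ι k ∘ₗ φ) LinearMap.id w +
      TensorProduct.map (conv (ι k ∘ₗ φ) LinearMap.id) LinearMap.id (deconcat w) := by
  induction w using word_induction generalizing φ with
  | one => simp [conv_one, deconcat_one, deconcat_ι]
  | smul r w hw => simp only [map_smul, hw, smul_add, tmul_smul]
  | add v w hv hw => simp only [map_add, hv, hw, tmul_add]; abel
  | cons a w hw =>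
    have h : conv (ι k ∘ₗ φ) LinearMap.id ∘ₗ LinearMap.mulLeft k (ι k a) =
        LinearMap.mulLeft k (ι k (φ 1)) ∘ₗ LinearMap.mulLeft k (ι k a) +
          conv (ι k ∘ₗ φ ∘ₗ LinearMap.mulLeft k (ι k a)) LinearMap.id := by
      ext x; simp [conv_cons, LinearMap.comp_assoc]
    have h2 : deconcat (ι k (φ 1) * (ι k a * w)) = 1 ⊗ₜ (ι k (φ 1) * (ι k a * w)) +
        (ι k (φ 1) ⊗ₜ (ι k a * w) + TensorProduct.map (LinearMap.mulLeft k (ι k (φ 1)) ∘ₗ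
          LinearMap.mulLeft k (ι k a)) LinearMap.id (deconcat w)) := by
      rw [deconcat_ι_mul, deconcat_ι_mul, map_add, LinearMap.rTensor_tmul, LinearMap.rTensor,
        LinearMap.rTensor, map_map_apply]
      simp
    rw [conv_cons, map_add, LinearMap.comp_assoc, hw]
    simp only [LinearMap.comp_apply, LinearMap.id_apply, h2, deconcat_ι_mul, map_add, map_tmul,
      conv_one, mul_one, LinearMap.rTensor, map_map_apply, h, TensorProduct.map_add_left, tmul_add,
      LinearMap.add_apply, LinearMap.comp_id]
    abel

theorem isCoderAlong_coderOf : IsCoderAlong LinearMap.id (wordMap t) (coderOf t φ) := by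
  refine word_ext ?_ fun a w hw => ?_
  · simp only [LinearMap.comp_apply, coderOf_one, deconcat_ι, deconcat_one, LinearMap.add_apply,
      map_tmul, LinearMap.id_apply, wordMap_one]
    abel
  · have h1 : coderOf t φ ∘ₗ LinearMap.mulLeft k (ι k a) =
        conv (ι k ∘ₗ φ) LinearMap.id ∘ₗ LinearMap.mulLeft k (ι k a) +
          LinearMap.mulLeft k (ι k (t a)) ∘ₗ coderOf t φ := by
      ext x; simp [coderOf_cons]
    have h2 : wordMap t ∘ₗ LinearMap.mulLeft k (ι k a) =
        LinearMap.mulLeft k (ι k (t a)) ∘ₗ wordMap t := by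
      ext x; simp
    simp only [LinearMap.comp_apply, LinearMap.id_comp] at hw ⊢
    simp only [coderOf_cons, map_add, deconcat_conv, deconcat_ι_mul, hw, LinearMap.add_apply,
      map_tmul, coderOf_one, wordMap_one, LinearMap.id_apply, LinearMap.rTensor, map_map_apply,
      h1, h2, TensorProduct.map_add_left, tmul_add, LinearMap.comp_id, LinearMap.id_comp, conv_one,
      LinearMap.comp_apply, mul_one]
    abel

theorem ιInv_conv {F : TensorAlgebra k V →ₗ[k] TensorAlgebra k W}
    (hF : ∀ w, algebraMapInv (F w) = algebraMapInv w)
    (φ : TensorAlgebra k V →ₗ[k] W) (w : TensorAlgebra k V) :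
    ιInv (conv (ι k ∘ₗ φ) F w) = φ w := by
  induction w using word_induction generalizing φ with
  | one => simp [conv_one, hF]
  | smul r w hw => simp [hw]
  | add v w hv hw => simp [hv, hw]
  | cons a w hw => rw [conv_cons, map_add, LinearMap.comp_assoc, hw]; simp [hF]

theorem ιInv_coderOf (w : TensorAlgebra k V) : ιInv (coderOf t φ w) = φ w := by
  have : ιInv ∘ₗ coderOf t φ = φ := by
    refine word_ext (by simp [coderOf_one]) fun a w _ => ?_
    have h := (isCoderAlong_coderOf t φ)
    rw [← wordMap_id] at h
    have := LinearMap.congr_fun (show unitCounit ∘ₗ coderOf t φ =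
      (0 : TensorAlgebra k V →ₗ[k] TensorAlgebra k V) from LinearMap.ext h.counit) w
    have h0 : algebraMapInv (coderOf t φ w) = 0 := by
      have := congrArg algebraMapInv this
      simpa [unitCounit] using this
    simp [coderOf_cons, ιInv_conv (F := LinearMap.id) (fun _ => rfl), h0]
  exact LinearMap.congr_fun this w

end coderOf

end TensorAlgebra

namespace TensorAlgebra

/-! ### The filtration of the tensor coalgebra by word length -/

section Length

variable {k : Type u} [CommRing k] {V W X : Type u} [AddCommGroup V] [Module k V]
  [AddCommGroup W] [Module k W] [AddCommGroup X] [Module k X]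

variable (k V) in
/-- The span of the words with fewer than `n` letters. -/
def lenLT (n : ℕ) : Submodule k (TensorAlgebra k V) :=
  Submodule.span k {w | ∃ l : List V, l.length < n ∧ (l.map (ι k)).prod = w}

theorem lenLT_zero : lenLT k V 0 = ⊥ := by
  rw [lenLT, Submodule.span_eq_bot]
  rintro w ⟨l, hl, -⟩
  simp at hl

theorem one_mem_lenLT (n : ℕ) : (1 : TensorAlgebra k V) ∈ lenLT k V (n + 1) :=
  Submodule.subset_span ⟨[], by simp⟩

theorem cons_mem_lenLT {n : ℕ} (a : V) {w : TensorAlgebra k V} (hw : w ∈ lenLT k V n) :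
    ι k a * w ∈ lenLT k V (n + 1) := by
  induction hw using Submodule.span_induction with
  | mem w hw =>
    obtain ⟨l, hl, rfl⟩ := hw
    exact Submodule.subset_span ⟨a :: l, by simpa using hl, by simp⟩
  | zero => simp
  | add v w _ _ hv hw => rw [mul_add]; exact Submodule.add_mem _ hv hw
  | smul r w _ hw => rw [mul_smul_comm]; exact Submodule.smul_mem _ _ hw

theorem ι_mem_lenLT (n : ℕ) (a : V) : ι k a ∈ lenLT k V (n + 2) := by
  simpa using cons_mem_lenLT a (one_mem_lenLT (k := k) (V := V) n)

theorem lenLT_succ_le {n : ℕ} {S : Submodule k (TensorAlgebra k V)} (one : 1 ∈ S)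
    (cons : ∀ a, ∀ w ∈ lenLT k V n, ι k a * w ∈ S) : lenLT k V (n + 1) ≤ S := by
  refine Submodule.span_le.2 ?_
  rintro w ⟨l, hl, rfl⟩
  cases l with
  | nil => simpa using one
  | cons a l =>
    rw [List.map_cons, List.prod_cons]
    exact cons a _ (Submodule.subset_span ⟨l, by simpa using hl, rfl⟩)

theorem lenLT_mono {m n : ℕ} (h : m ≤ n) : lenLT k V m ≤ lenLT k V n :=
  Submodule.span_mono fun _ ⟨l, hl, e⟩ => ⟨l, hl.trans_le h, e⟩

theorem exists_mem_lenLT (w : TensorAlgebra k V) : ∃ n, w ∈ lenLT k V n := by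
  induction w using word_induction with
  | one => exact ⟨1, one_mem_lenLT 0⟩
  | smul r w hw => exact hw.imp fun n h => Submodule.smul_mem _ _ h
  | add v w hv hw =>
    obtain ⟨m, hm⟩ := hv
    obtain ⟨n, hn⟩ := hw
    exact ⟨max m n, Submodule.add_mem _ (lenLT_mono (le_max_left _ _) hm)
      (lenLT_mono (le_max_right _ _) hn)⟩
  | cons a w hw =>
    obtain ⟨n, hn⟩ := hw
    exact ⟨n + 1, cons_mem_lenLT a hn⟩

theorem wordMap_mem_lenLT (f : V →ₗ[k] W) {n : ℕ} {w : TensorAlgebra k V}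
    (hw : w ∈ lenLT k V n) : wordMap f w ∈ lenLT k W n := by
  suffices lenLT k V n ≤ (lenLT k W n).comap (wordMap f) from this hw
  clear hw
  induction n with
  | zero => simp [lenLT_zero]
  | succ n ih =>
    refine lenLT_succ_le ?_ fun a w hw => ?_
    · simpa using one_mem_lenLT n
    · simpa using cons_mem_lenLT _ (ih hw)

theorem conv_mem_lenLT_succ (f : V →ₗ[k] W) {n : ℕ} (φ : TensorAlgebra k V →ₗ[k] W)
    {w : TensorAlgebra k V} (hw : w ∈ lenLT k V n) :
    conv (ι k ∘ₗ φ) (wordMap f) w ∈ lenLT k W (n + 1) := by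
  suffices lenLT k V n ≤ (lenLT k W (n + 1)).comap (conv (ι k ∘ₗ φ) (wordMap f)) from this hw
  clear hw w
  induction n generalizing φ with
  | zero => simp [lenLT_zero]
  | succ n ih =>
    refine lenLT_succ_le ?_ fun a w hw => ?_
    · rw [Submodule.mem_comap, conv_one]
      simpa using ι_mem_lenLT n (φ 1)
    · rw [Submodule.mem_comap, conv_cons, LinearMap.comp_assoc]
      exact Submodule.add_mem _ (cons_mem_lenLT _ (wordMap_mem_lenLT f (cons_mem_lenLT a hw)))
        (lenLT_mono (by omega) (ih _ hw))

/-- If `φ` vanishes on the words of length `< m`, then `w ↦ ∑ φ w₁ ⬝ F w₂` lowers the length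
by `m - 1`. -/
theorem conv_mem_lenLT (f : V →ₗ[k] W) {m n : ℕ} {φ : TensorAlgebra k V →ₗ[k] W}
    (hφ : ∀ w ∈ lenLT k V m, φ w = 0) {w : TensorAlgebra k V} (hw : w ∈ lenLT k V (n + m)) :
    conv (ι k ∘ₗ φ) (wordMap f) w ∈ lenLT k W (n + 1) := by
  induction m generalizing φ w with
  | zero => exact conv_mem_lenLT_succ f φ hw
  | succ m ih =>
    suffices lenLT k V (n + m + 1) ≤ (lenLT k W (n + 1)).comap (conv (ι k ∘ₗ φ) (wordMap f)) from
      this hw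
    have h1 : φ 1 = 0 := hφ 1 (one_mem_lenLT m)
    refine lenLT_succ_le ?_ fun a w hw => ?_
    · simp [conv_one, h1]
    · rw [Submodule.mem_comap, conv_cons, LinearMap.comp_assoc]
      simp only [LinearMap.comp_apply, h1, map_zero, zero_mul, zero_add]
      exact ih (φ := φ ∘ₗ LinearMap.mulLeft k (ι k a))
        (fun w hw => hφ _ (cons_mem_lenLT a hw)) hw

theorem conv_eq_of_vanish (f : V →ₗ[k] W) {n : ℕ} {φ : TensorAlgebra k V →ₗ[k] W}
    (hφ : ∀ w ∈ lenLT k V n, φ w = 0) {w : TensorAlgebra k V} (hw : w ∈ lenLT k V (n + 1)) :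
    conv (ι k ∘ₗ φ) (wordMap f) w = ι k (φ w) := by
  suffices lenLT k V (n + 1) ≤
    LinearMap.eqLocus (conv (ι k ∘ₗ φ) (wordMap f)) (ι k ∘ₗ φ) from this hw
  clear hw w
  induction n generalizing φ with
  | zero =>
    refine lenLT_succ_le ?_ fun a w hw => ?_
    · simp [conv_one]
    · rw [lenLT_zero, Submodule.mem_bot] at hw
      simp [hw]
  | succ n ih =>
    refine lenLT_succ_le ?_ fun a w hw => ?_
    · simp [conv_one]
    · have h1 := ih (φ := φ ∘ₗ LinearMap.mulLeft k (ι k a))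
        (fun w hw => hφ _ (cons_mem_lenLT a hw)) hw
      rw [LinearMap.mem_eqLocus] at h1 ⊢
      rw [conv_cons, LinearMap.comp_assoc, h1]
      simp [hφ 1 (one_mem_lenLT n)]

namespace IsCoderAlong

variable {f : V →ₗ[k] W} {t : V →ₗ[k] V} {g g' : TensorAlgebra k V →ₗ[k] TensorAlgebra k W}

/-- If the corestriction of a coderivation vanishes on the words of length `< n`, then the
coderivation agrees with its corestriction on the words of length `n`. -/
theorem eq_of_vanish (hg : IsCoderAlong (wordMap f) (wordMap t) g) {n : ℕ}
    (h : ∀ w ∈ lenLT k V n, ιInv (g w) = 0) {w : TensorAlgebra k V}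
    (hw : w ∈ lenLT k V (n + 1)) : g w = ι k (ιInv (g w)) := by
  suffices ∀ m ≤ n, lenLT k V (m + 1) ≤ LinearMap.eqLocus g (ι k ∘ₗ ιInv ∘ₗ g) from
    this n le_rfl hw
  clear hw w
  intro m hm
  induction m with
  | zero =>
    refine lenLT_succ_le ?_ fun a w hw => ?_
    · simpa using! hg.apply_one
    · rw [lenLT_zero, Submodule.mem_bot] at hw
      simp [hw]
  | succ m ih =>
    refine lenLT_succ_le ?_ fun a w hw => ?_
    · simpa using! hg.apply_one
    · have h1 : g w = ι k (ιInv (g w)) := ih (by omega) hw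
      rw [h w (lenLT_mono hm hw), map_zero] at h1
      rw [LinearMap.mem_eqLocus, hg.apply_cons, h1, mul_zero, add_zero]
      have h2 := lenLT_mono (k := k) (V := V) (show m + 1 + 1 ≤ n + 1 by omega)
        (cons_mem_lenLT a hw)
      rw [conv_eq_of_vanish f (φ := ιInv ∘ₗ g) h h2]
      rfl

theorem eq_zero_of_vanish (hg : IsCoderAlong (wordMap f) (wordMap t) g) {n : ℕ}
    (h : ∀ w ∈ lenLT k V n, ιInv (g w) = 0) {w : TensorAlgebra k V}
    (hw : w ∈ lenLT k V n) : g w = 0 := by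
  rw [hg.eq_of_vanish h (lenLT_mono n.le_succ hw), h w hw, map_zero]

/-- A coderivation is determined by its corestriction. -/
theorem ext (hg : IsCoderAlong (wordMap f) (wordMap t) g)
    (hg' : IsCoderAlong (wordMap f) (wordMap t) g')
    (h : ∀ w, ιInv (g w) = ιInv (g' w)) : g = g' := by
  ext w
  obtain ⟨n, hn⟩ := exists_mem_lenLT w
  rw [← sub_eq_zero]
  exact (hg.sub hg').eq_zero_of_vanish (n := n) (fun w _ => by simp [h]) hn

theorem mem_lenLT (hg : IsCoderAlong (wordMap f) (wordMap t) g) {m n : ℕ}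
    (h : ∀ w ∈ lenLT k V m, ιInv (g w) = 0) {w : TensorAlgebra k V}
    (hw : w ∈ lenLT k V (n + m)) : g w ∈ lenLT k W (n + 1) := by
  suffices ∀ N n, N = n + m → lenLT k V N ≤ (lenLT k W (n + 1)).comap g from this _ n rfl hw
  clear hw w n
  intro N
  induction N with
  | zero => simp [lenLT_zero]
  | succ N ih =>
    intro n hN
    refine lenLT_succ_le ?_ fun a w hw => ?_
    · rw [Submodule.mem_comap, hg.apply_one]
      rcases n with _ | n
      · rw [h 1 (by rw [← show N + 1 = m by omega]; exact one_mem_lenLT N)]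
        simp
      · exact ι_mem_lenLT _ _
    · rw [Submodule.mem_comap, hg.apply_cons]
      refine Submodule.add_mem _ (conv_mem_lenLT f (φ := ιInv ∘ₗ g) h ?_) ?_
      · rw [← hN]; exact cons_mem_lenLT a hw
      · rcases n with _ | n
        · rw [hg.eq_zero_of_vanish h (lenLT_mono (by omega) hw)]
          simp
        · exact cons_mem_lenLT _ (ih n (by omega) hw)

end IsCoderAlong

/-- A sequence of maps which is eventually constant on the words of bounded length has a
limit. -/
theorem exists_limit (φ : ℕ → TensorAlgebra k V →ₗ[k] W)
    (h : ∀ n, ∀ w ∈ lenLT k V n, φ (n + 1) w = φ n w) :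
    ∃ ψ : TensorAlgebra k V →ₗ[k] W, ∀ n, ∀ w ∈ lenLT k V n, ψ w = φ n w := by
  have hmn : ∀ m n, m ≤ n → ∀ w ∈ lenLT k V m, φ n w = φ m w := by
    intro m n hmn w hw
    induction n, hmn using Nat.le_induction with
    | base => rfl
    | succ n hn ih => rw [h n w (lenLT_mono hn hw), ih]
  choose N hN using fun w : TensorAlgebra k V => exists_mem_lenLT w
  have hψ : ∀ n, ∀ w ∈ lenLT k V n, φ (N w) w = φ n w := fun n w hw => by
    rw [← hmn _ _ (le_max_left (N w) n) w (hN w), hmn _ _ (le_max_right (N w) n) w hw]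
  refine ⟨⟨⟨fun w => φ (N w) w, fun v w => ?_⟩, fun r w => ?_⟩, hψ⟩
  · have hv := lenLT_mono (le_max_left (N v) (N w)) (hN v)
    have hw := lenLT_mono (le_max_right (N v) (N w)) (hN w)
    rw [hψ _ _ (Submodule.add_mem _ hv hw), hψ _ _ hv, hψ _ _ hw, map_add]
  · simp [hψ _ _ (Submodule.smul_mem _ r (hN w))]

/-- The linear map on words sending `1` to `0` and `a ⬝ w` to `F a w`. -/
noncomputable def uncurryWord (F : V →ₗ[k] TensorAlgebra k V →ₗ[k] W) :
    TensorAlgebra k V →ₗ[k] W :=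
  wordRec 0 (LinearMap.mk₂ k (fun a z => F a z.1) (by intros; simp) (by intros; simp)
    (by intros; simp) (by intros; simp))

@[simp] theorem uncurryWord_one (F : V →ₗ[k] TensorAlgebra k V →ₗ[k] W) :
    uncurryWord F 1 = 0 := wordRec_one _ _

@[simp] theorem uncurryWord_cons (F : V →ₗ[k] TensorAlgebra k V →ₗ[k] W) (a : V)
    (w : TensorAlgebra k V) : uncurryWord F (ι k a * w) = F a w := wordRec_ι_mul _ _ _ _

variable (k V) in
/-- The projection onto the words of length `n`. -/
noncomputable def lenProj : ℕ → (TensorAlgebra k V →ₗ[k] TensorAlgebra k V)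
  | 0 => unitCounit
  | n + 1 => uncurryWord ((LinearMap.mul k _).compl₂ (lenProj n) ∘ₗ ι k)

theorem lenProj_zero : lenProj k V 0 = unitCounit := rfl

theorem lenProj_succ_one (n : ℕ) : lenProj k V (n + 1) 1 = 0 := by simp [lenProj]

theorem lenProj_succ_cons (n : ℕ) (a : V) (w : TensorAlgebra k V) :
    lenProj k V (n + 1) (ι k a * w) = ι k a * lenProj k V n w := by simp [lenProj]

theorem lenProj_mem (n : ℕ) (w : TensorAlgebra k V) : lenProj k V n w ∈ lenLT k V (n + 1) := by
  induction n generalizing w with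
  | zero =>
    simp only [lenProj_zero, unitCounit, LinearMap.comp_apply, Algebra.linearMap_apply,
      Algebra.algebraMap_eq_smul_one]
    exact Submodule.smul_mem _ _ (one_mem_lenLT 0)
  | succ n ih =>
    induction w using word_induction with
    | one => rw [lenProj_succ_one]; exact Submodule.zero_mem _
    | smul r w hw => rw [map_smul]; exact Submodule.smul_mem _ _ hw
    | add v w hv hw => rw [map_add]; exact Submodule.add_mem _ hv hw
    | cons a w _ => rw [lenProj_succ_cons]; exact cons_mem_lenLT a (ih w)

theorem lenProj_eq_zero {n : ℕ} {w : TensorAlgebra k V} (hw : w ∈ lenLT k V n) :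
    lenProj k V n w = 0 := by
  suffices lenLT k V n ≤ LinearMap.ker (lenProj k V n) from this hw
  clear hw w
  induction n with
  | zero => simp [lenLT_zero]
  | succ n ih =>
    refine lenLT_succ_le ?_ fun a w hw => ?_
    · exact lenProj_succ_one n
    · have : lenProj k V n w = 0 := ih hw
      rw [LinearMap.mem_ker, lenProj_succ_cons, this, mul_zero]

theorem sub_lenProj_mem {n : ℕ} {w : TensorAlgebra k V} (hw : w ∈ lenLT k V (n + 1)) :
    w - lenProj k V n w ∈ lenLT k V n := by
  suffices lenLT k V (n + 1) ≤ (lenLT k V n).comap (LinearMap.id - lenProj k V n) from this hw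
  clear hw w
  induction n with
  | zero =>
    refine lenLT_succ_le ?_ fun a w hw => ?_
    · simp [lenProj_zero, unitCounit]
    · rw [lenLT_zero, Submodule.mem_bot] at hw
      simp [hw]
  | succ n ih =>
    refine lenLT_succ_le ?_ fun a w hw => ?_
    · simpa [lenProj_succ_one] using one_mem_lenLT n
    · have := cons_mem_lenLT a (ih hw)
      simpa [lenProj_succ_cons, mul_sub] using this

theorem lenProj_lenProj (n : ℕ) (w : TensorAlgebra k V) :
    lenProj k V n (lenProj k V n w) = lenProj k V n w := by
  induction n generalizing w with
  | zero => simp [lenProj_zero, unitCounit]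
  | succ n ih =>
    induction w using word_induction with
    | one => simp [lenProj_succ_one]
    | smul r w hw => simp [hw]
    | add v w hv hw => simp [hv, hw]
    | cons a w _ => rw [lenProj_succ_cons, lenProj_succ_cons, ih]

end Length

end TensorAlgebra

/-! ### Graded coderivations -/

namespace TensorAlgebra

section Graded

variable {k : Type u} [CommRing k] {V W X : Type u} [AddCommGroup V] [Module k V]
  [AddCommGroup W] [Module k W] [AddCommGroup X] [Module k X]

/-- The words of degree `q` in graded letters; the degree of a word is the sum of the degrees of
its letters. -/
def wordGr (gr : ℤ → Submodule k V) (q : ℤ) : Submodule k (TensorAlgebra k V) :=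
  Submodule.span k {w | ∃ l : List (Σ i : ℤ, gr i),
    (l.map fun x => x.1).sum = q ∧ (l.map fun x => ι k (x.2 : V)).prod = w}

/-- The map `a ↦ (-1) ^ (p |a|) a`. -/
noncomputable def letterSign (gr : ℤ → Submodule k V) [DirectSum.Decomposition gr] (p : ℤ) :
    V →ₗ[k] V :=
  DirectSum.toModule k ℤ V (fun i => koszulSign k (p * i) • (gr i).subtype) ∘ₗ
    (DirectSum.decomposeLinearEquiv gr).toLinearMap

section

variable {gr : ℤ → Submodule k V}

theorem one_mem_wordGr : (1 : TensorAlgebra k V) ∈ wordGr gr 0 :=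
  Submodule.subset_span ⟨[], by simp⟩

theorem cons_mem_wordGr {i q n : ℤ} (h : i + q = n) {a : V} (ha : a ∈ gr i)
    {w : TensorAlgebra k V} (hw : w ∈ wordGr gr q) : ι k a * w ∈ wordGr gr n := by
  subst h
  induction hw using Submodule.span_induction with
  | mem w hw =>
    obtain ⟨l, rfl, rfl⟩ := hw
    exact Submodule.subset_span ⟨⟨i, a, ha⟩ :: l, by simp⟩
  | zero => simp
  | add v w _ _ hv hw => rw [mul_add]; exact Submodule.add_mem _ hv hw
  | smul r w _ hw => rw [mul_smul_comm]; exact Submodule.smul_mem _ _ hw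

theorem ι_mem_wordGr {i : ℤ} {a : V} (ha : a ∈ gr i) : ι k a ∈ wordGr gr i := by
  simpa using cons_mem_wordGr (add_zero i) ha one_mem_wordGr

theorem wordGr_induction {p : ℤ → TensorAlgebra k V → Prop}
    (one : p 0 1) (zero : ∀ q, p q 0)
    (smul : ∀ q (r : k) w, p q w → p q (r • w))
    (add : ∀ q v w, p q v → p q w → p q (v + w))
    (cons : ∀ i q a w, a ∈ gr i → w ∈ wordGr gr q → p q w → p (i + q) (ι k a * w))
    {q : ℤ} {w : TensorAlgebra k V} (hw : w ∈ wordGr gr q) : p q w := by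
  induction hw using Submodule.span_induction with
  | mem w hw =>
    obtain ⟨l, rfl, rfl⟩ := hw
    induction l with
    | nil => simpa using one
    | cons x l ih =>
      simp only [List.map_cons, List.sum_cons, List.prod_cons]
      exact cons _ _ _ _ x.2.2 (Submodule.subset_span ⟨l, rfl, rfl⟩) ih
  | zero => exact zero q
  | add v w _ _ hv hw => exact add q v w hv hw
  | smul r w _ hw => exact smul q r w hw

/-- Membership in a submodule depending on the degree can be checked on words. -/
theorem map_wordGr {N : Type u} [AddCommGroup N] [Module k N] {S : ℤ → Submodule k N}
    {φ : TensorAlgebra k V →ₗ[k] N} (one : φ 1 ∈ S 0)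
    (cons : ∀ i q a w, a ∈ gr i → w ∈ wordGr gr q → φ w ∈ S q → φ (ι k a * w) ∈ S (i + q))
    {q : ℤ} {w : TensorAlgebra k V} (hw : w ∈ wordGr gr q) : φ w ∈ S q :=
  wordGr_induction (p := fun q w => φ w ∈ S q) one (by simp)
    (fun q r w h => by rw [map_smul]; exact Submodule.smul_mem _ _ h)
    (fun q v w hv hw => by rw [map_add]; exact Submodule.add_mem _ hv hw) cons hw

theorem mul_mem_wordGr {p q n : ℤ} (h : p + q = n) {v w : TensorAlgebra k V}
    (hv : v ∈ wordGr gr p) (hw : w ∈ wordGr gr q) : v * w ∈ wordGr gr n := by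
  subst h
  refine map_wordGr (φ := LinearMap.mulRight k w) (S := fun p => wordGr gr (p + q)) ?_ ?_ hv
  · simpa using hw
  · intro i r a v ha _ hv
    simp only [LinearMap.mulRight_apply, mul_assoc] at hv ⊢
    exact cons_mem_wordGr (by ring) ha hv

theorem ιInv_mem {q : ℤ} {w : TensorAlgebra k V} (hw : w ∈ wordGr gr q) : ιInv w ∈ gr q := by
  have h0 : ∀ {q w}, w ∈ wordGr gr q → q = 0 ∨ algebraMapInv w = 0 := by
    intro q w hw
    refine wordGr_induction (p := fun q w => q = 0 ∨ algebraMapInv w = 0) (.inl rfl)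
      (fun q => .inr (map_zero _)) ?_ ?_ ?_ hw
    · rintro q r w (h | h)
      · exact .inl h
      · exact .inr (by rw [map_smul, h, smul_zero])
    · rintro q v w (h | h) (h' | h')
      all_goals first | exact .inl h | exact .inl h' | exact .inr (by rw [map_add, h, h', add_zero])
    · exact fun i q a w _ _ _ => .inr (algebraMapInv_ι_mul a w)
  refine map_wordGr (φ := ιInv) ?_ ?_ hw
  · simp
  · intro i q a w ha hw _
    rw [ιInv_ι_mul]
    rcases h0 hw with rfl | h
    · rw [add_zero]; exact Submodule.smul_mem _ _ ha
    · rw [h, zero_smul]; exact Submodule.zero_mem _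

theorem lenProj_mem_wordGr (n : ℕ) {q : ℤ} {w : TensorAlgebra k V} (hw : w ∈ wordGr gr q) :
    lenProj k V n w ∈ wordGr gr q := by
  induction n generalizing q w with
  | zero =>
    refine map_wordGr ?_ (fun i q a w _ _ _ => ?_) hw
    · rw [lenProj_zero, unitCounit_one]; exact one_mem_wordGr
    · have := LinearMap.congr_fun (unitCounit_cons (k := k) (W := V) a) w
      simp only [LinearMap.comp_apply, LinearMap.mulLeft_apply, LinearMap.zero_apply] at this
      rw [lenProj_zero, this]
      exact Submodule.zero_mem _
  | succ n ih =>
    refine map_wordGr ?_ (fun i q a w ha hw _ => ?_) hw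
    · rw [lenProj_succ_one]; exact Submodule.zero_mem _
    · rw [lenProj_succ_cons]; exact cons_mem_wordGr rfl ha (ih hw)

variable {gr' : ℤ → Submodule k W}

theorem wordMap_mem_wordGr {f : V →ₗ[k] W} (hf : ∀ {i a}, a ∈ gr i → f a ∈ gr' i)
    {q : ℤ} {w : TensorAlgebra k V} (hw : w ∈ wordGr gr q) : wordMap f w ∈ wordGr gr' q := by
  refine map_wordGr ?_ (fun i q a w ha _ ih => ?_) hw
  · rw [wordMap_one]; exact one_mem_wordGr
  · rw [wordMap_ι_mul]; exact cons_mem_wordGr rfl (hf ha) ih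

theorem conv_mem_wordGr {f : V →ₗ[k] W} (hf : ∀ {i a}, a ∈ gr i → f a ∈ gr' i) {p : ℤ}
    {φ : TensorAlgebra k V →ₗ[k] W} (hφ : ∀ q, ∀ w ∈ wordGr gr q, φ w ∈ gr' (q + p))
    {q : ℤ} {w : TensorAlgebra k V} (hw : w ∈ wordGr gr q) :
    conv (ι k ∘ₗ φ) (wordMap f) w ∈ wordGr gr' (q + p) := by
  refine wordGr_induction (gr := gr) (p := fun q w => ∀ p (φ : TensorAlgebra k V →ₗ[k] W),
    (∀ q, ∀ w ∈ wordGr gr q, φ w ∈ gr' (q + p)) →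
      conv (ι k ∘ₗ φ) (wordMap f) w ∈ wordGr gr' (q + p)) ?_ ?_ ?_ ?_ ?_ hw p φ hφ
  · intro p φ hφ
    rw [conv_one, wordMap_one, mul_one]
    exact ι_mem_wordGr (hφ _ _ one_mem_wordGr)
  · simp
  · intro q r w h p φ hφ
    rw [map_smul]; exact Submodule.smul_mem _ _ (h p φ hφ)
  · intro q v w hv hw p φ hφ
    rw [map_add]; exact Submodule.add_mem _ (hv p φ hφ) (hw p φ hφ)
  · intro i q a w ha hw ih p φ hφ
    rw [conv_cons, LinearMap.comp_assoc]
    refine Submodule.add_mem _ ?_ ?_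
    · exact mul_mem_wordGr (by ring) (ι_mem_wordGr (hφ _ _ one_mem_wordGr))
        (wordMap_mem_wordGr hf (cons_mem_wordGr rfl ha hw))
    · have := ih (i + p) (φ ∘ₗ LinearMap.mulLeft k (ι k a)) fun q w hw => by
        have := hφ _ _ (cons_mem_wordGr rfl ha hw)
        rwa [show i + q + p = q + (i + p) by ring] at this
      rwa [show q + (i + p) = i + q + p by ring] at this

/-- The limit of a sequence of maps of degree `p` has degree `p`. -/
theorem exists_limit_graded {p : ℤ} (φ : ℕ → TensorAlgebra k V →ₗ[k] W)
    (h : ∀ n, ∀ w ∈ lenLT k V n, φ (n + 1) w = φ n w)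
    (hφ : ∀ n q, ∀ w ∈ wordGr gr q, φ n w ∈ gr' (q + p)) :
    ∃ ψ : TensorAlgebra k V →ₗ[k] W, (∀ n, ∀ w ∈ lenLT k V n, ψ w = φ n w) ∧
      ∀ q, ∀ w ∈ wordGr gr q, ψ w ∈ gr' (q + p) := by
  obtain ⟨ψ, hψ⟩ := exists_limit φ h
  refine ⟨ψ, hψ, fun q w hw => ?_⟩
  obtain ⟨n, hn⟩ := exists_mem_lenLT w
  rw [hψ n w hn]
  exact hφ n q w hw

end

section

variable {gr : ℤ → Submodule k V} [DirectSum.Decomposition gr] {gr' : ℤ → Submodule k W}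
  [DirectSum.Decomposition gr']

theorem homogeneous_induction (gr : ℤ → Submodule k V) [DirectSum.Decomposition gr]
    {p : V → Prop} (hom : ∀ i a, a ∈ gr i → p a)
    (add : ∀ a b, p a → p b → p (a + b)) (a : V) : p a :=
  DirectSum.Decomposition.inductionOn gr (hom 0 0 (Submodule.zero_mem _))
    (fun {i} m => hom i m m.2) add a

theorem homogeneous_ext (gr : ℤ → Submodule k V) [DirectSum.Decomposition gr] {f g : V →ₗ[k] W}
    (h : ∀ i, ∀ a ∈ gr i, f a = g a) : f = g :=
  LinearMap.ext fun a => homogeneous_induction gr (p := fun a => f a = g a) h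
    (fun a b ha hb => by rw [map_add, map_add, ha, hb]) a

theorem letterSign_apply (p : ℤ) {i : ℤ} {a : V} (ha : a ∈ gr i) :
    letterSign gr p a = koszulSign k (p * i) • a := by
  rw [letterSign, LinearMap.comp_apply, LinearEquiv.coe_coe, DirectSum.decomposeLinearEquiv_apply,
    DirectSum.decompose_of_mem gr ha, ← DirectSum.lof_eq_of k, DirectSum.toModule_lof]
  rfl

theorem iSup_wordGr : (⨆ q, wordGr gr q) = ⊤ := by
  rw [eq_top_iff]
  rintro w -
  induction w using word_induction with
  | one => exact Submodule.mem_iSup_of_mem 0 one_mem_wordGr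
  | smul r w hw => exact Submodule.smul_mem _ _ hw
  | add v w hv hw => exact Submodule.add_mem _ hv hw
  | cons a w hw =>
    induction a using homogeneous_induction gr with
    | add a b ha hb => rw [map_add, add_mul]; exact Submodule.add_mem _ ha hb
    | hom i a ha =>
      induction hw using Submodule.iSup_induction' with
      | mem q w hw => exact Submodule.mem_iSup_of_mem _ (cons_mem_wordGr rfl ha hw)
      | zero => simp
      | add v w _ _ hv hw => rw [mul_add]; exact Submodule.add_mem _ hv hw

theorem wordGr_ext (gr : ℤ → Submodule k V) [DirectSum.Decomposition gr] {N : Type u}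
    [AddCommGroup N] [Module k N] {f g : TensorAlgebra k V →ₗ[k] N}
    (h : ∀ q, ∀ x ∈ wordGr gr q, f x = g x) : f = g := by
  ext w
  have hw : w ∈ ⨆ q, wordGr gr q := by rw [iSup_wordGr]; trivial
  induction hw using Submodule.iSup_induction' with
  | mem q w hw => exact h q w hw
  | zero => simp
  | add v w _ _ hv hw => simp [hv, hw]

/-- The map `w ↦ (-1) ^ (p |w|) w` on words. -/
noncomputable def wordSign (gr : ℤ → Submodule k V) [DirectSum.Decomposition gr] (p : ℤ) :
    TensorAlgebra k V →ₗ[k] TensorAlgebra k V := wordMap (letterSign gr p)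

theorem wordSign_apply (p : ℤ) {q : ℤ} {w : TensorAlgebra k V} (hw : w ∈ wordGr gr q) :
    wordSign gr p w = koszulSign k (p * q) • w := by
  refine wordGr_induction (p := fun q w => wordSign gr p w = koszulSign k (p * q) • w)
    ?_ ?_ ?_ ?_ ?_ hw
  · simp [wordSign, koszulSign_zero]
  · simp
  · intro q r w hw
    rw [map_smul, hw, smul_comm]
  · intro q v w hv hw
    rw [map_add, hv, hw, smul_add]
  · intro i q a w ha _ hw
    rw [wordSign] at hw ⊢
    rw [wordMap_ι_mul, hw, letterSign_apply p ha, map_smul, smul_mul_smul_comm,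
      ← koszulSign_add, mul_add]

theorem wordSign_comp (p q : ℤ) : wordSign gr p ∘ₗ wordSign gr q = wordSign gr (p + q) :=
  wordGr_ext gr fun r x hx => by
    rw [LinearMap.comp_apply, wordSign_apply q hx, map_smul, wordSign_apply p hx,
      wordSign_apply (p + q) hx, smul_smul, ← koszulSign_add]
    congr 2; ring

theorem comp_letterSign {f : V →ₗ[k] W} (hf : ∀ {i a}, a ∈ gr i → f a ∈ gr' i) (p : ℤ) :
    f ∘ₗ letterSign gr p = letterSign gr' p ∘ₗ f :=
  homogeneous_ext gr fun i a ha => by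
    rw [LinearMap.comp_apply, letterSign_apply p ha, LinearMap.comp_apply,
      letterSign_apply p (hf ha), map_smul]

/-- The module of graded coderivations of degree `p` of the tensor coalgebra. -/
def coder (gr : ℤ → Submodule k V) [DirectSum.Decomposition gr] (p : ℤ) :
    Submodule k (Module.End k (TensorAlgebra k V)) where
  carrier := {δ | (∀ q, ∀ x ∈ wordGr gr q, δ x ∈ wordGr gr (q + p)) ∧
    IsCoderAlong LinearMap.id (wordSign gr p) δ}
  zero_mem' := ⟨fun _ _ _ => Submodule.zero_mem _, by simp [IsCoderAlong]⟩
  add_mem' := fun ⟨h1, h2⟩ ⟨h1', h2'⟩ =>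
    ⟨fun q x hx => Submodule.add_mem _ (h1 q x hx) (h1' q x hx), h2.add h2'⟩
  smul_mem' := fun r _ ⟨h1, h2⟩ => ⟨fun q x hx => Submodule.smul_mem _ _ (h1 q x hx), h2.smul r⟩

theorem coder_along {p : ℤ} {δ : Module.End k (TensorAlgebra k V)} (h : δ ∈ coder gr p) :
    IsCoderAlong (wordMap LinearMap.id) (wordMap (letterSign gr p)) δ := by
  rw [wordMap_id]
  exact h.2

theorem coderOf_mem {p : ℤ} {φ : TensorAlgebra k V →ₗ[k] V}
    (hφ : ∀ q, ∀ w ∈ wordGr gr q, φ w ∈ gr (q + p)) :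
    coderOf (letterSign gr p) φ ∈ coder gr p := by
  refine ⟨fun q x hx => ?_, isCoderAlong_coderOf _ _⟩
  refine map_wordGr (S := fun q => wordGr gr (q + p)) ?_ (fun i q a w ha hw ih => ?_) hx
  · rw [coderOf_one]
    exact ι_mem_wordGr (hφ _ _ one_mem_wordGr)
  · rw [coderOf_cons, ← wordMap_id]
    refine Submodule.add_mem _
      (conv_mem_wordGr (fun h => h) hφ (cons_mem_wordGr rfl ha hw)) ?_
    rw [letterSign_apply p ha]
    exact cons_mem_wordGr (by ring) (Submodule.smul_mem _ _ ha) ih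

theorem ιInv_coder_mem {p : ℤ} {δ : Module.End k (TensorAlgebra k V)} (h : δ ∈ coder gr p)
    (q : ℤ) (w : TensorAlgebra k V) (hw : w ∈ wordGr gr q) : ιInv (δ w) ∈ gr (q + p) :=
  ιInv_mem (h.1 q w hw)

theorem comp_wordSign {p : ℤ} (q : ℤ) {δ : Module.End k (TensorAlgebra k V)}
    (hδ : δ ∈ coder gr p) :
    δ ∘ₗ wordSign gr q = koszulSign k (p * q) • (wordSign gr q ∘ₗ δ) :=
  wordGr_ext gr fun r x hx => by
    rw [LinearMap.comp_apply, wordSign_apply q hx, map_smul, LinearMap.smul_apply,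
      LinearMap.comp_apply, wordSign_apply q (hδ.1 r x hx), smul_smul, mul_add, koszulSign_add,
      mul_comm q p, mul_left_comm, koszulSign_sq, mul_one]

theorem commutator_mem_coder {p q n : ℤ} (h : p + q = n)
    {δ ε : Module.End k (TensorAlgebra k V)} (hδ : δ ∈ coder gr p) (hε : ε ∈ coder gr q) :
    δ * ε - koszulSign k (p * q) • (ε * δ) ∈ coder gr n := by
  subst h
  refine ⟨fun r x hx => Submodule.sub_mem _ ?_ (Submodule.smul_mem _ _ ?_), ?_⟩
  · have := hδ.1 _ _ (hε.1 _ _ hx)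
    rwa [show r + q + p = r + (p + q) by ring] at this
  · have := hε.1 _ _ (hδ.1 _ _ hx)
    rwa [show r + p + q = r + (p + q) by ring] at this
  · have e1 := comp_wordSign q hδ
    have e2 := comp_wordSign p hε
    have t2 : wordSign gr q ∘ₗ wordSign gr p = wordSign gr (p + q) := by
      rw [wordSign_comp, add_comm]
    rw [IsCoderAlong, Module.End.mul_eq_comp, Module.End.mul_eq_comp, LinearMap.comp_sub,
      LinearMap.comp_smul, ← LinearMap.comp_assoc, ← LinearMap.comp_assoc,
      hδ.2, hε.2, LinearMap.comp_assoc, LinearMap.comp_assoc, hδ.2, hε.2, ← LinearMap.comp_assoc,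
      ← LinearMap.comp_assoc, ← LinearMap.smul_comp, ← LinearMap.sub_comp]
    congr 1
    have h3 : δ ∘ₗ ε - koszulSign k (p * q) • (ε ∘ₗ δ) =
        δ ∘ₗ ε + (-koszulSign k (p * q)) • (ε ∘ₗ δ) := by module
    have h4 : koszulSign k (p * q) * koszulSign k (q * p) = 1 := by
      rw [mul_comm q p, koszulSign_sq]
    rw [h3]
    simp only [LinearMap.add_comp, LinearMap.comp_add, ← TensorProduct.map_comp, e1, e2,
      wordSign_comp, t2, LinearMap.id_comp, LinearMap.comp_id, TensorProduct.map_smul_left,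
      TensorProduct.map_smul_right, TensorProduct.map_add_left,
      TensorProduct.map_add_right, smul_add, smul_smul, h4]
    module

/-- The square of an odd coderivation is a coderivation. -/
theorem isCoderAlong_sq {δ : Module.End k (TensorAlgebra k V)} (hδ : δ ∈ coder gr 1) :
    IsCoderAlong (wordMap LinearMap.id) (wordMap (letterSign gr 2)) (δ ∘ₗ δ) := by
  have e1 := comp_wordSign 1 hδ
  have t2 : wordSign gr 1 ∘ₗ wordSign gr 1 = wordSign gr 2 := wordSign_comp 1 1
  rw [wordMap_id]
  change IsCoderAlong _ (wordSign gr 2) _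
  rw [IsCoderAlong, ← LinearMap.comp_assoc, hδ.2, LinearMap.comp_assoc, hδ.2,
    ← LinearMap.comp_assoc]
  congr 1
  simp only [LinearMap.add_comp, LinearMap.comp_add, ← TensorProduct.map_comp, e1, t2,
    LinearMap.id_comp, LinearMap.comp_id, TensorProduct.map_smul_left, one_mul, koszulSign_one]
  module

theorem IsCoderAlong.comp_wordMap {f : V →ₗ[k] W} {t : V →ₗ[k] V}
    {g : TensorAlgebra k V →ₗ[k] TensorAlgebra k W} (hg : IsCoderAlong (wordMap f) (wordMap t) g)
    {e : X →ₗ[k] V} {t' : X →ₗ[k] X} (h : t ∘ₗ e = e ∘ₗ t') :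
    IsCoderAlong (wordMap (f ∘ₗ e)) (wordMap t') (g ∘ₗ wordMap e) := by
  rw [IsCoderAlong, ← LinearMap.comp_assoc, hg, LinearMap.comp_assoc, deconcat_wordMap,
    ← LinearMap.comp_assoc]
  congr 1
  rw [LinearMap.add_comp, ← TensorProduct.map_comp, ← TensorProduct.map_comp, LinearMap.comp_assoc,
    wordMap_comp, wordMap_comp, wordMap_comp, wordMap_comp, h, LinearMap.comp_assoc]

theorem IsCoderAlong.wordMap_comp {f : V →ₗ[k] W} {t : V →ₗ[k] V}
    {g : TensorAlgebra k V →ₗ[k] TensorAlgebra k W} (hg : IsCoderAlong (wordMap f) (wordMap t) g)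
    (e : W →ₗ[k] X) :
    IsCoderAlong (wordMap (e ∘ₗ f)) (wordMap t) (wordMap e ∘ₗ g) := by
  rw [IsCoderAlong, ← LinearMap.comp_assoc, deconcat_wordMap, LinearMap.comp_assoc, hg,
    ← LinearMap.comp_assoc]
  congr 1
  rw [LinearMap.comp_add, ← TensorProduct.map_comp, ← TensorProduct.map_comp,
    ← LinearMap.comp_assoc, TensorAlgebra.wordMap_comp]

end

end Graded

end TensorAlgebra

/-! ### Dg Lie algebras of operators -/

/-- A family of spaces of operators on a module, of degrees `p : ℤ`, which is closed under graded
commutators and contains an operator `D` of degree `1` and square zero. -/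
structure OperatorLie (k : Type u) [CommRing k] where
  space : Type u
  [addCommGroup : AddCommGroup space]
  [module : Module k space]
  gr : ℤ → Submodule k (Module.End k space)
  comm_mem : ∀ {p q : ℤ} {δ ε : Module.End k space}, δ ∈ gr p → ε ∈ gr q →
    δ * ε - koszulSign k (p * q) • (ε * δ) ∈ gr (p + q)
  D : Module.End k space
  D_mem : D ∈ gr 1
  D_D : D * D = 0

namespace OperatorLie

attribute [instance] OperatorLie.addCommGroup OperatorLie.module

variable {k : Type u} [CommRing k]

/-- The operators with the differential `δ ↦ [D, δ]`. -/
noncomputable def complex (L : OperatorLie k) : InternalComplex k where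
  carrier := Module.End k L.space
  gr := L.gr
  d p := LinearMap.mulLeft k L.D - koszulSign k p • LinearMap.mulRight k L.D
  d_mem {p δ} h := by
    have := L.comm_mem L.D_mem h
    rwa [one_mul, add_comm] at this
  d_d {p δ} _ := by
    have h1 : L.D * (L.D * δ) = 0 := by rw [← mul_assoc, L.D_D, zero_mul]
    have h2 : δ * L.D * L.D = 0 := by rw [mul_assoc, L.D_D, mul_zero]
    simp only [LinearMap.sub_apply, LinearMap.smul_apply, LinearMap.mulLeft_apply,
      LinearMap.mulRight_apply, mul_sub, sub_mul, mul_smul_comm, smul_mul_assoc, h1, h2,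
      koszulSign_add, koszulSign_one, mul_assoc]
    module

/-- The graded commutator. -/
noncomputable def bracket (L : OperatorLie k) {p q n : ℤ} (h : p + q = n) :
    L.gr p →ₗ[k] L.gr q →ₗ[k] L.gr n :=
  LinearMap.mk₂ k
    (fun δ ε => ⟨δ.1 * ε.1 - koszulSign k (p * q) • (ε.1 * δ.1), h ▸ L.comm_mem δ.2 ε.2⟩)
    (by
      intros; ext1
      simp only [Submodule.coe_add, add_mul, mul_add]; module)
    (by
      intros; ext1
      simp only [Submodule.coe_smul, smul_mul_assoc, mul_smul_comm]; module)
    (by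
      intros; ext1
      simp only [Submodule.coe_add, add_mul, mul_add]; module)
    (by
      intros; ext1
      simp only [Submodule.coe_smul, smul_mul_assoc, mul_smul_comm]; module)

theorem bracket_coe (L : OperatorLie k) {p q n : ℤ} (h : p + q = n) (δ : L.gr p) (ε : L.gr q) :
    (L.bracket h δ ε : Module.End k L.space) =
      δ.1 * ε.1 - koszulSign k (p * q) • (ε.1 * δ.1) := rfl

theorem bracket_jacobi (L : OperatorLie k) {i j l ij jl il n : ℤ} (hij : i + j = ij)
    (hjl : j + l = jl) (hil : i + l = il) (h₁ : i + jl = n) (h₂ : ij + l = n) (h₃ : j + il = n)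
    (x : L.gr i) (y : L.gr j) (z : L.gr l) :
    L.bracket h₁ x (L.bracket hjl y z) =
      L.bracket h₂ (L.bracket hij x y) z +
        koszulSign k (i * j) • L.bracket h₃ y (L.bracket hil x z) := by
  subst hij hjl hil
  refine Subtype.ext ?_
  have hs := koszulSign_sq (k := k) (i * j)
  simp only [Submodule.coe_add, Submodule.coe_smul, bracket_coe, mul_sub, sub_mul,
    mul_smul_comm, smul_mul_assoc, mul_assoc, mul_add, add_mul, koszulSign_add, smul_sub,
    smul_smul, mul_comm j i]
  match_scalars <;> grind

theorem bracket_antisymm (L : OperatorLie k) {i j n : ℤ} (h : i + j = n) (h' : j + i = n)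
    (x : L.gr i) (y : L.gr j) :
    L.bracket h x y = -(koszulSign k (i * j) • L.bracket h' y x) := by
  refine Subtype.ext ?_
  simp only [Submodule.coe_neg, Submodule.coe_smul, bracket_coe, smul_sub, smul_smul,
    mul_comm j i, koszulSign_sq]
  module

theorem bracket_self (L : OperatorLie k) {i n : ℤ} (h : i + i = n) (x : L.gr i) (hi : Even i) :
    L.bracket h x x = 0 := by
  refine Subtype.ext ?_
  rw [bracket_coe, koszulSign_even (hi.mul_right i), one_smul, sub_self]
  rfl

theorem bracket_bracket_self (L : OperatorLie k) {i n m : ℤ} (h : i + i = n) (h' : i + n = m)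
    (x : L.gr i) (hi : Odd i) : L.bracket h' x (L.bracket h x x) = 0 := by
  refine Subtype.ext ?_
  subst h
  simp only [bracket_coe, koszulSign_odd (hi.mul hi), ZeroMemClass.coe_zero,
    koszulSign_even ((show Even (i + i) from ⟨i, rfl⟩).mul_left i), mul_sub, sub_mul,
    mul_smul_comm, smul_mul_assoc, mul_assoc]
  module

theorem toComplex_d_eq (L : OperatorLie k) {p q : ℤ} (h : p + 1 = q) (h' : 1 + p = q)
    (z : L.gr p) : L.complex.toComplex.d p q z = L.bracket h' ⟨L.D, L.D_mem⟩ z := by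
  subst h
  refine (L.complex.toComplex_d p z).trans (Subtype.ext ?_)
  rw [bracket_coe, one_mul]
  rfl

/-- The dg Lie algebra of operators, with the graded commutator as bracket. -/
noncomputable def toLie (L : OperatorLie k) : DGLieAlgebra k where
  toComplex := L.complex.toComplex
  bracket h := L.bracket h
  antisymm h h' x y := L.bracket_antisymm h h' x y
  bracket_self h x hi := L.bracket_self h x hi
  bracket_bracket_self h h' x hi := L.bracket_bracket_self h h' x hi
  jacobi hij hjl hil h₁ h₂ h₃ x y z := L.bracket_jacobi hij hjl hil h₁ h₂ h₃ x y z
  leibniz {i j n i' j' n'} h hi hj hn h₁ h₂ x y := by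
    let D : L.gr 1 := ⟨L.D, L.D_mem⟩
    have key : ∀ (dx : L.gr i') (dy : L.gr j') (dz : L.gr n'),
        dx = L.bracket (show 1 + i = i' by omega) D x →
        dy = L.bracket (show 1 + j = j' by omega) D y →
        dz = L.bracket (show 1 + n = n' by omega) D (L.bracket h x y) →
        dz = L.bracket h₁ dx y + koszulSign k i • L.bracket h₂ x dy := by
      rintro _ _ _ rfl rfl rfl
      have := L.bracket_jacobi (show 1 + i = i' by omega) h (show 1 + j = j' by omega)
        (show 1 + n = n' by omega) h₁ h₂ D x y
      rwa [one_mul] at this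
    exact key _ _ _ (L.toComplex_d_eq hi (by omega) x) (L.toComplex_d_eq hj (by omega) y)
      (L.toComplex_d_eq hn (by omega) _)

/-- A map between spaces of operators which respects degrees, products and the operators `D`
induces a morphism of dg Lie algebras. -/
structure IsLieMap (L M : OperatorLie k)
    (Φ : Module.End k L.space →ₗ[k] Module.End k M.space) : Prop where
  map_mem : ∀ {p δ}, δ ∈ L.gr p → Φ δ ∈ M.gr p
  map_mul : ∀ {p q δ ε}, δ ∈ L.gr p → ε ∈ L.gr q → Φ (δ * ε) = Φ δ * Φ ε
  map_D : Φ L.D = M.D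

variable {L M : OperatorLie k} {Φ : Module.End k L.space →ₗ[k] Module.End k M.space}

theorem IsLieMap.map_commutator (h : IsLieMap L M Φ) {p : ℤ} {δ : Module.End k L.space}
    (hδ : δ ∈ L.gr p) : Φ (L.D * δ - koszulSign k p • (δ * L.D)) =
      M.D * Φ δ - koszulSign k p • (Φ δ * M.D) := by
  rw [map_sub, map_smul, h.map_mul L.D_mem hδ, h.map_mul hδ L.D_mem, h.map_D]

theorem IsLieMap.isChainMap (h : IsLieMap L M Φ) :
    InternalComplex.IsChainMap L.complex M.complex Φ where
  map_mem hx := h.map_mem hx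
  map_d hδ := h.map_commutator hδ

/-- The morphism of dg Lie algebras induced by a map of operators. -/
noncomputable def IsLieMap.hom (h : IsLieMap L M Φ) : DGLieAlgebra.Hom L.toLie M.toLie where
  toComplexHom := h.isChainMap.toComplexHom
  map_bracket {i j n} e x y := by
    have key : ∀ (x : L.gr i) (y : L.gr j), Φ (L.bracket e x y) =
        Φ x.1 * Φ y.1 - koszulSign k (i * j) • (Φ y.1 * Φ x.1) := fun x y => by
      rw [bracket_coe, map_sub, map_smul, h.map_mul x.2 y.2, h.map_mul y.2 x.2]
    exact Subtype.ext (key x y)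

theorem IsLieMap.quasiIsomorphic (h : IsLieMap L M Φ)
    (hq : InternalComplex.IsQuasiIso L.complex M.complex Φ) :
    DGLieAlgebra.QuasiIsomorphic L.toLie M.toLie :=
  .rel _ _ ⟨h.hom, h.isChainMap.quasiIso_iff.2 hq⟩

end OperatorLie

/-! ### `A∞`-algebras -/

/-- A graded module with a differential of degree `1`. -/
structure DGModule (k : Type u) [CommRing k] where
  carrier : Type u
  [addCommGroup : AddCommGroup carrier]
  [module : Module k carrier]
  gr : ℤ → Submodule k carrier
  [decomposition : DirectSum.Decomposition gr]
  b : carrier →ₗ[k] carrier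
  b_mem : ∀ {i : ℤ} {a : carrier}, a ∈ gr i → b a ∈ gr (i + 1)
  b_b : ∀ a : carrier, b (b a) = 0

namespace DGModule

attribute [instance] DGModule.addCommGroup DGModule.module DGModule.decomposition

variable {k : Type u} [CommRing k]

/-- The underlying complex. -/
noncomputable def complex (V : DGModule k) : InternalComplex k where
  carrier := V.carrier
  gr := V.gr
  d _ := V.b
  d_mem h := V.b_mem h
  d_d _ := V.b_b _

end DGModule

open TensorAlgebra

/-- A (non-unital) `A∞`-algebra, given by its suspension `V` and by its bar construction: a
coderivation `D` of degree `1` and square zero on the tensor coalgebra of `V`, with `D 1 = 0`. -/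
structure AInfinityAlgebra (k : Type u) [CommRing k] where
  carrier : Type u
  [addCommGroup : AddCommGroup carrier]
  [module : Module k carrier]
  gr : ℤ → Submodule k carrier
  [decomposition : DirectSum.Decomposition gr]
  D : Module.End k (TensorAlgebra k carrier)
  D_mem : D ∈ coder gr 1
  D_D : D * D = 0
  D_one : D 1 = 0

namespace AInfinityAlgebra

attribute [instance] AInfinityAlgebra.addCommGroup AInfinityAlgebra.module
  AInfinityAlgebra.decomposition

variable {k : Type u} [CommRing k] (A : AInfinityAlgebra k)

/-- The coderivations of the bar construction. -/
noncomputable def coderLie : OperatorLie k where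
  space := TensorAlgebra k A.carrier
  gr := coder A.gr
  comm_mem hδ hε := commutator_mem_coder rfl hδ hε
  D := A.D
  D_mem := A.D_mem
  D_D := A.D_D

/-- The differential on the suspension `V`, the linear component of `D`. -/
noncomputable def b : A.carrier →ₗ[k] A.carrier := ιInv ∘ₗ A.D ∘ₗ ι k

theorem D_vanish (w : TensorAlgebra k A.carrier) (hw : w ∈ lenLT k A.carrier 1) :
    ιInv (A.D w) = 0 := by
  suffices lenLT k A.carrier 1 ≤ LinearMap.ker (ιInv ∘ₗ A.D) from this hw
  refine lenLT_succ_le ?_ fun a w hw => ?_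
  · simp [A.D_one]
  · rw [lenLT_zero, Submodule.mem_bot] at hw
    simp [hw]

theorem D_ι (a : A.carrier) : A.D (ι k a) = ι k (A.b a) :=
  (coder_along A.D_mem).eq_of_vanish A.D_vanish (ι_mem_lenLT 0 a)

theorem D_mem_lenLT {n : ℕ} {w : TensorAlgebra k A.carrier} (hw : w ∈ lenLT k A.carrier n) :
    A.D w ∈ lenLT k A.carrier n := by
  rcases n with _ | n
  · rw [lenLT_zero, Submodule.mem_bot] at hw
    simp [hw]
  · exact (coder_along A.D_mem).mem_lenLT A.D_vanish hw

theorem D_D_apply (w : TensorAlgebra k A.carrier) : A.D (A.D w) = 0 :=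
  LinearMap.congr_fun A.D_D w

theorem b_mem {i : ℤ} {a : A.carrier} (ha : a ∈ A.gr i) : A.b a ∈ A.gr (i + 1) :=
  ιInv_mem (A.D_mem.1 i _ (ι_mem_wordGr ha))

theorem b_b (a : A.carrier) : A.b (A.b a) = 0 := by
  have := A.D_D_apply (ι k a)
  rw [D_ι, D_ι, ← (ι k).map_zero] at this
  exact ι_leftInverse.injective this

/-- The underlying complex of the suspension. -/
noncomputable def toDGModule : DGModule k where
  carrier := A.carrier
  gr := A.gr
  b := A.b
  b_mem h := A.b_mem h
  b_b := A.b_b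

end AInfinityAlgebra

namespace DGAlgebra

variable {k : Type u} [CommRing k] (A : DGAlgebra k)

/-- The grading of the suspension `A[1]`. -/
def suspGr (i : ℤ) : Submodule k A.carrier := A.gr (i + 1)

noncomputable instance : DirectSum.Decomposition A.suspGr := by
  refine DirectSum.IsInternal.chooseDecomposition _ ?_
  have h := (DirectSum.isInternal_submodule_iff_iSupIndep_and_iSup_eq_top A.gr).1
    (DirectSum.Decomposition.isInternal A.gr)
  refine (DirectSum.isInternal_submodule_iff_iSupIndep_and_iSup_eq_top _).2 ⟨?_, ?_⟩
  · exact h.1.comp (add_left_injective 1)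
  · rw [← h.2]
    exact (Equiv.addRight (1 : ℤ)).iSup_comp (g := A.gr)

theorem letterTwist_eq (p : ℤ) : A.letterTwist p = letterSign A.suspGr p :=
  homogeneous_ext A.suspGr fun i a ha => by
    rw [letterSign_apply p ha, letterTwist_apply p ha, add_sub_cancel_right]

theorem barTwist_eq (p : ℤ) : A.barTwist p = wordSign A.suspGr p := by
  rw [wordSign, ← letterTwist_eq]
  rfl

theorem barGr_eq (q : ℤ) : A.barGr q = wordGr A.suspGr q := by
  apply le_antisymm
  · intro w hw
    induction hw using barGr_induction with
    | one => exact one_mem_wordGr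
    | zero => exact Submodule.zero_mem _
    | smul q r w _ hw => exact Submodule.smul_mem _ _ hw
    | add q v w _ _ hv hw => exact Submodule.add_mem _ hv hw
    | cons i q a w ha _ hw =>
      exact cons_mem_wordGr rfl (by rwa [suspGr, sub_add_cancel]) hw
  · intro w hw
    refine map_wordGr (φ := LinearMap.id) one_mem_barGr (fun i q a w ha _ ih => ?_) hw
    exact cons_mem_barGr (by ring) ha ih

theorem coder_eq (p : ℤ) : A.coder p = TensorAlgebra.coder A.suspGr p := by
  ext δ
  change (_ ∧ _) ↔ (_ ∧ _)
  simp only [barGr_eq, barTwist_eq, IsCoderAlong, LinearMap.id_comp]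

/-- The bar construction of a dg algebra. -/
noncomputable def toAInfinity : AInfinityAlgebra k where
  carrier := A.carrier
  gr := A.suspGr
  D := A.barD
  D_mem := by rw [← coder_eq]; exact barD_mem_coder
  D_D := LinearMap.ext barD_barD
  D_one := barD_one

theorem toAInfinity_b (a : A.carrier) : A.toAInfinity.b a = -A.d a := by
  have h : A.barD (ι k a) = -ι k (A.d a) := by
    rw [← mul_one (ι k a), barD_ι_mul, mulHead_one, barD_one]
    simp
  change ιInv (A.barD (ι k a)) = _
  rw [h, map_neg, ιInv_ι]

theorem toAInfinity_complex_d {p : ℤ} (x : A.coder p) :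
    A.toAInfinity.coderLie.complex.d p x.1 = (A.coderD rfl x).1 :=
  (coderD_coe rfl x).symm

/-- The identity map on coderivations of the bar construction. -/
noncomputable def coderEquiv (p : ℤ) : A.coder p ≃ₗ[k] TensorAlgebra.coder A.suspGr p :=
  LinearEquiv.ofEq _ _ (A.coder_eq p)

theorem coderEquiv_coe {p : ℤ} (x : A.coder p) :
    (A.coderEquiv p x : Module.End k A.Bar) = x.1 := LinearEquiv.coe_ofEq_apply _ x

theorem coderEquiv_d {p : ℤ} (x : A.coder p) :
    (⟨_, A.toAInfinity.coderLie.complex.d_mem (A.coderEquiv p x).2⟩ :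
      TensorAlgebra.coder A.suspGr (p + 1)) = A.coderEquiv (p + 1) (A.coderD rfl x) :=
  Subtype.ext <| (congrArg (A.toAInfinity.coderLie.complex.d p) (A.coderEquiv_coe x)).trans <|
    (A.toAInfinity_complex_d x).trans (A.coderEquiv_coe _).symm

/-- The dg Lie algebra of coderivations only depends on the bar construction. -/
theorem hochschildLie_quasiIsomorphic :
    DGLieAlgebra.QuasiIsomorphic A.hochschildLie A.toAInfinity.coderLie.toLie := by
  let φ : A.hochschildLie.toComplex ≅ A.toAInfinity.coderLie.toLie.toComplex :=
    HomologicalComplex.Hom.isoOfComponents (fun p => (A.coderEquiv p).toModuleIso) (by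
        rintro i j (rfl : i + 1 = j)
        ext x
        have h1 := A.toAInfinity.coderLie.complex.toComplex_d i (A.coderEquiv i x)
        have h2 := congrArg (A.coderEquiv (i + 1)) (coderComplex_d (A := A) rfl x)
        exact h1.trans ((A.coderEquiv_d x).trans h2.symm))
  refine .rel _ _ ⟨⟨φ.hom, fun {i j n} h x y => Subtype.ext ?_⟩, inferInstance⟩
  rfl

/-- The complex underlying a dg algebra. -/
noncomputable def toInternalComplex : InternalComplex k where
  carrier := A.carrier
  gr := A.gr
  d _ := A.d
  d_mem h := A.d_mem h
  d_d _ := A.d_d _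

end DGAlgebra

namespace InternalComplex

variable {k : Type u} [CommRing k]

/-- The desuspension of a complex. -/
noncomputable def desusp (M : InternalComplex k) : InternalComplex k where
  carrier := M.carrier
  gr i := M.gr (i - 1)
  d i := -M.d (i - 1)
  d_mem {i x} h := by
    have := Submodule.neg_mem _ (M.d_mem h)
    rwa [show i - 1 + 1 = i + 1 - 1 by ring] at this
  d_d {i x} h := by
    have := M.d_d h
    rw [show i - 1 + 1 = i + 1 - 1 by ring] at this
    rw [LinearMap.neg_apply, LinearMap.neg_apply, map_neg, this, neg_zero, neg_zero]

theorem IsAcyclicFibration.desusp {M N : InternalComplex k} {p : M.carrier →ₗ[k] N.carrier}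
    (h : IsAcyclicFibration M N p) : IsAcyclicFibration M.desusp N.desusp p := by
  refine .of_acyclic_ker ⟨fun hx => h.map_mem hx, fun {i x} hx => ?_⟩ (fun y hy => h.surj y hy)
    fun i x hx hdx h0 => ?_
  · exact (map_neg p (M.d (i - 1) x)).trans (congrArg Neg.neg (h.map_d hx))
  · have e : i + 1 - 1 = i - 1 + 1 := by ring
    have hx' : x ∈ M.gr (i - 1 + 1) := by rw [← e]; exact hx
    have hdx' : M.d (i - 1 + 1) x = 0 := by rw [← e]; exact neg_eq_zero.1 hdx
    obtain ⟨x', hx', h0', hd⟩ := h.acyclic_ker hx' hdx' h0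
    refine ⟨-x', Submodule.neg_mem _ hx', (map_neg p x').trans (neg_eq_zero.2 h0'), ?_⟩
    change -M.d (i - 1) (-x') = x
    rw [map_neg, neg_neg, hd]

end InternalComplex

namespace DGAlgebra

variable {k : Type u} [CommRing k] (A : DGAlgebra k)

/-- The suspended complex underlying a dg algebra with cofibrant underlying complex has the
lifting property among complexes inside a module. -/
theorem isCofibrant_toAInfinity (hA : IsCofibrantComplex A.toComplex) :
    A.toAInfinity.toDGModule.complex.IsCofibrant := by
  intro M N p hp g hg
  have hp' := hp.desusp
  have hg' : InternalComplex.IsChainMap A.toInternalComplex N.desusp g := by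
    refine ⟨fun {i x} hx => ?_, fun {i x} hx => ?_⟩
    · exact hg.map_mem (i := i - 1) (x := x)
        (show x ∈ A.gr (i - 1 + 1) by rw [sub_add_cancel]; exact hx)
    · have h2 : g (-A.d x) = N.d (i - 1) (g x) :=
        (congrArg g (A.toAInfinity_b x).symm).trans (hg.map_d (i := i - 1) (x := x)
          (show x ∈ A.gr (i - 1 + 1) by rw [sub_add_cancel]; exact hx))
      change g (A.d x) = -N.d (i - 1) (g x)
      rw [← h2, ← neg_eq_iff_eq_neg]
      exact (map_neg g _).symm
  obtain ⟨l, hl⟩ := hA hp'.toIsChainMap.toComplexHom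
    (fun n y => by
      obtain ⟨x, hx, e⟩ := hp'.surj y.1 y.2
      exact ⟨⟨x, hx⟩, Subtype.ext e⟩)
    (hp'.toIsChainMap.quasiIso_iff.2 hp'.quasiIso) hg'.toComplexHom
  let l' : ∀ i, A.gr i →ₗ[k] M.carrier := fun i => (M.desusp.gr i).subtype ∘ₗ (l.f i).hom
  let F : A.carrier →ₗ[k] M.carrier := DirectSum.toModule k ℤ M.carrier l' ∘ₗ
    (DirectSum.decomposeLinearEquiv A.gr).toLinearMap
  have hF : ∀ i (x : A.gr i), F x = l' i x := fun i x => by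
    simp only [F]
    rw [LinearMap.comp_apply, LinearEquiv.coe_coe, DirectSum.decomposeLinearEquiv_apply,
      DirectSum.decompose_coe, ← DirectSum.lof_eq_of k, DirectSum.toModule_lof]
  have hF1 : ∀ i, ∀ x ∈ A.gr i, F x ∈ M.desusp.gr i := fun i x hx => by
    rw [hF i ⟨x, hx⟩]
    exact ((l.f i).hom ⟨x, hx⟩).2
  have hF2 : ∀ i, ∀ x ∈ A.gr i, F (A.d x) = -M.d (i - 1) (F x) := fun i x hx => by
    have h1 := congr($(l.comm i (i + 1)).hom ⟨x, hx⟩)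
    have h2 := A.toInternalComplex.toComplex_d i ⟨x, hx⟩
    have h3 := M.desusp.toComplex_d i ((l.f i).hom ⟨x, hx⟩)
    have h4 : (l.f (i + 1)).hom ⟨A.d x, A.d_mem hx⟩ =
        (⟨M.desusp.d i ((l.f i).hom ⟨x, hx⟩).1, M.desusp.d_mem ((l.f i).hom ⟨x, hx⟩).2⟩ :
          M.desusp.gr (i + 1)) :=
      (congrArg (l.f (i + 1)).hom h2).symm.trans (h1.symm.trans h3)
    rw [hF i ⟨x, hx⟩, hF (i + 1) ⟨A.d x, A.d_mem hx⟩]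
    exact congrArg Subtype.val h4
  refine ⟨F, ⟨fun {i x} hx => ?_, fun {i x} hx => ?_⟩, ?_⟩
  · have := hF1 (i + 1) x hx
    change F x ∈ M.gr (i + 1 - 1) at this
    rwa [add_sub_cancel_right] at this
  · have := hF2 (i + 1) x hx
    rw [add_sub_cancel_right] at this
    exact (congrArg F (A.toAInfinity_b x)).trans ((map_neg F _).trans (neg_eq_iff_eq_neg.2 this))
  · have : p ∘ₗ F = g := homogeneous_ext A.gr fun i x hx => by
      rw [LinearMap.comp_apply, hF i ⟨x, hx⟩]
      exact congrArg Subtype.val congr($(hl).f i |>.hom ⟨x, hx⟩)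
    exact LinearMap.congr_fun this

end DGAlgebra

/-! ### Complexes of multilinear maps -/

namespace TensorAlgebra

variable {k : Type u} [CommRing k] {V W : Type u} [AddCommGroup V] [Module k V]
  [AddCommGroup W] [Module k W]

/-- The linear map `a ↦ φ (a ⬝ -)`. -/
noncomputable def curryWord (φ : TensorAlgebra k V →ₗ[k] W) :
    V →ₗ[k] TensorAlgebra k V →ₗ[k] W :=
  (LinearMap.mul k (TensorAlgebra k V)).compr₂ φ ∘ₗ ι k

@[simp] theorem curryWord_apply (φ : TensorAlgebra k V →ₗ[k] W) (a : V) (w : TensorAlgebra k V) :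
    curryWord φ a w = φ (ι k a * w) := rfl

end TensorAlgebra

namespace DGModule

variable {k : Type u} [CommRing k] (V : DGModule k)

/-- The differential of the tensor coalgebra which extends the differential of the letters. -/
noncomputable def wordD : Module.End k (TensorAlgebra k V.carrier) :=
  coderOf (letterSign V.gr 1) (V.b ∘ₗ ιInv)

theorem wordD_mem : V.wordD ∈ coder V.gr 1 :=
  coderOf_mem fun _ _ hw => V.b_mem (ιInv_mem hw)

theorem ιInv_wordD (w : TensorAlgebra k V.carrier) : ιInv (V.wordD w) = V.b (ιInv w) :=
  ιInv_coderOf _ _ _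

theorem wordD_one : V.wordD 1 = 0 := by simp [wordD, coderOf_one]

theorem wordD_cons (a : V.carrier) (w : TensorAlgebra k V.carrier) :
    V.wordD (ι k a * w) = ι k (V.b a) * w + ι k (letterSign V.gr 1 a) * V.wordD w := by
  have h1 : (ι k ∘ₗ V.b ∘ₗ ιInv) ∘ₗ LinearMap.mulLeft k (ι k a) =
      LinearMap.mulLeft k (ι k (V.b a)) ∘ₗ unitCounit := by
    ext x; simp [unitCounit, Algebra.algebraMap_eq_smul_one]
  rw [wordD, coderOf_cons, conv_cons, h1, conv_mulLeft, unitCounit_conv]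
  simp

theorem wordD_cons_hom {i : ℤ} {a : V.carrier} (ha : a ∈ V.gr i)
    (w : TensorAlgebra k V.carrier) :
    V.wordD (ι k a * w) = ι k (V.b a) * w + koszulSign k i • (ι k a * V.wordD w) := by
  rw [wordD_cons, letterSign_apply 1 ha, one_mul, map_smul, smul_mul_assoc]

theorem wordD_wordD (w : TensorAlgebra k V.carrier) : V.wordD (V.wordD w) = 0 := by
  have h := isCoderAlong_sq V.wordD_mem
  obtain ⟨n, hn⟩ := exists_mem_lenLT w
  exact h.eq_zero_of_vanish (n := n) (fun w _ => by
    rw [LinearMap.comp_apply, ιInv_wordD, ιInv_wordD, V.b_b]) hn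

theorem wordD_lenProj (n : ℕ) (w : TensorAlgebra k V.carrier) :
    V.wordD (lenProj k V.carrier n w) = lenProj k V.carrier n (V.wordD w) := by
  induction n generalizing w with
  | zero =>
    have h := coder_along V.wordD_mem
    rw [lenProj_zero, h.counit]
    simp [unitCounit, Algebra.algebraMap_eq_smul_one, wordD_one]
  | succ n ih =>
    induction w using word_induction with
    | one => simp [lenProj_succ_one, wordD_one]
    | smul r w hw => simp [hw]
    | add v w hv hw => simp [hv, hw]
    | cons a w _ =>
      rw [lenProj_succ_cons, wordD_cons, wordD_cons, map_add, lenProj_succ_cons,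
        lenProj_succ_cons, ih]

section

variable (Y : DGModule k)

/-- The maps of degree `p` to `Y` from the words of length `n` in the letters of `V`, as maps which
are defined on all words and vanish on the words of a different length. -/
noncomputable def wordHomGr (n : ℕ) (p : ℤ) :
    Submodule k (TensorAlgebra k V.carrier →ₗ[k] Y.carrier) where
  carrier := {φ | (∀ q, ∀ w ∈ wordGr V.gr q, φ w ∈ Y.gr (q + p)) ∧
    ∀ w, φ (lenProj k V.carrier n w) = φ w}
  zero_mem' := ⟨fun _ _ _ => Submodule.zero_mem _, fun _ => rfl⟩
  add_mem' := fun ⟨h1, h2⟩ ⟨h1', h2'⟩ => ⟨fun q x hx =>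
    Submodule.add_mem _ (h1 q x hx) (h1' q x hx), fun w => by simp [h2, h2']⟩
  smul_mem' := fun r _ ⟨h1, h2⟩ => ⟨fun q x hx => Submodule.smul_mem _ _ (h1 q x hx),
    fun w => by simp [h2]⟩

/-- The differential `φ ↦ b ∘ φ - (-1) ^ p φ ∘ wordD` on maps of degree `p`. -/
noncomputable def wordHomD (p : ℤ) : (TensorAlgebra k V.carrier →ₗ[k] Y.carrier) →ₗ[k]
    TensorAlgebra k V.carrier →ₗ[k] Y.carrier :=
  LinearMap.compRight k Y.b - koszulSign k p • LinearMap.lcomp k _ V.wordD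

variable {V Y}

theorem wordHomD_apply (p : ℤ) (φ : TensorAlgebra k V.carrier →ₗ[k] Y.carrier)
    (w : TensorAlgebra k V.carrier) :
    V.wordHomD Y p φ w = Y.b (φ w) - koszulSign k p • φ (V.wordD w) := rfl

theorem wordHomD_mem {n : ℕ} {p : ℤ} {φ : TensorAlgebra k V.carrier →ₗ[k] Y.carrier}
    (h : φ ∈ V.wordHomGr Y n p) : V.wordHomD Y p φ ∈ V.wordHomGr Y n (p + 1) := by
  refine ⟨fun q w hw => Submodule.sub_mem _ ?_ (Submodule.smul_mem _ _ ?_), fun w => ?_⟩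
  · have := Y.b_mem (h.1 q w hw)
    rwa [add_assoc] at this
  · have := h.1 _ _ (V.wordD_mem.1 q w hw)
    rwa [show q + 1 + p = q + (p + 1) by ring] at this
  · rw [wordHomD_apply, wordHomD_apply, h.2, wordD_lenProj, h.2]

theorem wordHomD_wordHomD (p : ℤ) (φ : TensorAlgebra k V.carrier →ₗ[k] Y.carrier) :
    V.wordHomD Y (p + 1) (V.wordHomD Y p φ) = 0 := by
  refine LinearMap.ext fun w => ?_
  rw [wordHomD_apply, wordHomD_apply, wordHomD_apply, map_sub, map_smul, Y.b_b, V.wordD_wordD,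
    koszulSign_add, koszulSign_one, map_zero, LinearMap.zero_apply]
  module

end

/-- The complex of maps to `Y` from the words of length `n` in the letters of `V`. -/
noncomputable def wordHom (n : ℕ) (Y : DGModule k) : InternalComplex k where
  carrier := TensorAlgebra k V.carrier →ₗ[k] Y.carrier
  gr := V.wordHomGr Y n
  d := V.wordHomD Y
  d_mem h := wordHomD_mem h
  d_d _ := wordHomD_wordHomD _ _

variable {V} {Y : DGModule k}

theorem mem_wordHomGr_succ{n : ℕ} {p : ℤ} {φ : TensorAlgebra k V.carrier →ₗ[k] Y.carrier} :
    φ ∈ V.wordHomGr Y (n + 1) p ↔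
      φ 1 = 0 ∧ ∀ i, ∀ a ∈ V.gr i, curryWord φ a ∈ V.wordHomGr Y n (i + p) := by
  constructor
  · rintro ⟨h1, h2⟩
    refine ⟨by rw [← h2, lenProj_succ_one, map_zero], fun i a ha => ⟨fun q w hw => ?_, fun w => ?_⟩⟩
    · have := h1 _ _ (cons_mem_wordGr rfl ha hw)
      rw [show i + q + p = q + (i + p) by ring] at this
      exact this
    · have := h2 (ι k a * w)
      rw [lenProj_succ_cons] at this
      exact this
  · rintro ⟨h0, h⟩
    refine ⟨fun q w hw => ?_, fun w => ?_⟩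
    · refine map_wordGr (S := fun q => Y.gr (q + p)) ?_ (fun i q a w ha hw _ => ?_) hw
      · rw [h0]; exact Submodule.zero_mem _
      · have := (h i a ha).1 q w hw
        rw [show q + (i + p) = i + q + p by ring] at this
        exact this
    · have : φ ∘ₗ lenProj k V.carrier (n + 1) = φ := by
        refine word_ext (by simp [lenProj_succ_one, h0]) fun a w _ => ?_
        rw [LinearMap.comp_apply, lenProj_succ_cons]
        induction a using homogeneous_induction V.gr with
        | hom i a ha => exact (h i a ha).2 w
        | add a b ha hb => simp only [map_add, add_mul, ha, hb]
      exact LinearMap.congr_fun this w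

theorem curryWord_d (p : ℤ) (φ : TensorAlgebra k V.carrier →ₗ[k] Y.carrier) {i : ℤ}
    {a : V.carrier} (ha : a ∈ V.gr i) :
    curryWord (V.wordHomD Y p φ) a =
      V.wordHomD Y (i + p) (curryWord φ a) - koszulSign k p • curryWord φ (V.b a) := by
  refine LinearMap.ext fun w => ?_
  change Y.b (φ (ι k a * w)) - koszulSign k p • φ (V.wordD (ι k a * w)) =
    Y.b (φ (ι k a * w)) - koszulSign k (i + p) • φ (ι k a * V.wordD w) -
      koszulSign k p • φ (ι k (V.b a) * w)
  rw [wordD_cons_hom V ha, map_add, map_smul, koszulSign_add]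
  module

open InternalComplex

theorem comp_wordHomD {Z : DGModule k} {f : Y.carrier →ₗ[k] Z.carrier}
    (hf : IsChainMap Y.complex Z.complex f) {n : ℕ} {p : ℤ}
    {φ : TensorAlgebra k V.carrier →ₗ[k] Y.carrier} (h : φ ∈ V.wordHomGr Y n p) :
    f ∘ₗ V.wordHomD Y p φ = V.wordHomD Z p (f ∘ₗ φ) := by
  have h1 : f ∘ₗ Y.b ∘ₗ φ = Z.b ∘ₗ f ∘ₗ φ :=
    wordGr_ext V.gr fun q w hw => hf.map_d (h.1 q w hw)
  refine LinearMap.ext fun w => ?_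
  rw [LinearMap.comp_apply, wordHomD_apply, map_sub, map_smul]
  exact congrArg (· - _) (LinearMap.congr_fun h1 w)

theorem comp_mem_wordHomGr {Z : DGModule k} {f : Y.carrier →ₗ[k] Z.carrier}
    (hf : IsChainMap Y.complex Z.complex f) {n : ℕ} {p : ℤ}
    {φ : TensorAlgebra k V.carrier →ₗ[k] Y.carrier} (h : φ ∈ V.wordHomGr Y n p) :
    f ∘ₗ φ ∈ V.wordHomGr Z n p :=
  ⟨fun q w hw => hf.map_mem (h.1 q w hw), fun w => congrArg f (h.2 w)⟩

theorem isChainMap_wordHom {Z : DGModule k} {f : Y.carrier →ₗ[k] Z.carrier}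
    (hf : IsChainMap Y.complex Z.complex f) (n : ℕ) :
    IsChainMap (V.wordHom n Y) (V.wordHom n Z) (LinearMap.compRight k f) :=
  ⟨fun h => comp_mem_wordHomGr hf h, fun h => comp_wordHomD hf h⟩

/-- A criterion for composition with `f` to be an acyclic fibration. -/
theorem isAcyclicFibration_wordHom_of {Z : DGModule k} {f : Y.carrier →ₗ[k] Z.carrier}
    (hf : IsChainMap Y.complex Z.complex f) {n : ℕ}
    (surj : ∀ p, ∀ y ∈ V.wordHomGr Z n p, ∃ x ∈ V.wordHomGr Y n p, f ∘ₗ x = y)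
    (ker : ∀ p, ∀ x ∈ V.wordHomGr Y n (p + 1), V.wordHomD Y (p + 1) x = 0 → f ∘ₗ x = 0 →
      ∃ x' ∈ V.wordHomGr Y n p, f ∘ₗ x' = 0 ∧ V.wordHomD Y p x' = x) :
    IsAcyclicFibration (V.wordHom n Y) (V.wordHom n Z) (LinearMap.compRight k f) :=
  .of_acyclic_ker (isChainMap_wordHom hf n) (fun y hy => surj _ y hy)
    fun p x hx hd h0 => ker p x hx hd h0

/-- The lifting property of `V` against the complexes of maps on words. -/
theorem lift_wordHom (hV : V.complex.IsCofibrant) {Z : DGModule k}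
    {f : Y.carrier →ₗ[k] Z.carrier} {n : ℕ}
    (hq : IsAcyclicFibration (V.wordHom n Y) (V.wordHom n Z) (LinearMap.compRight k f)) (p : ℤ)
    (o : V.carrier →ₗ[k] TensorAlgebra k V.carrier →ₗ[k] Y.carrier)
    (b : V.carrier →ₗ[k] TensorAlgebra k V.carrier →ₗ[k] Z.carrier)
    (ho : ∀ i, ∀ a ∈ V.gr i, o a ∈ V.wordHomGr Y n (i + p + 1))
    (hb : ∀ i, ∀ a ∈ V.gr i, b a ∈ V.wordHomGr Z n (i + p))
    (hdo : ∀ i, ∀ a ∈ V.gr i,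
      V.wordHomD Y (i + p + 1) (o a) + koszulSign k p • o (V.b a) = 0)
    (hqo : ∀ i, ∀ a ∈ V.gr i,
      f ∘ₗ o a = V.wordHomD Z (i + p) (b a) - koszulSign k p • b (V.b a)) :
    ∃ l : V.carrier →ₗ[k] TensorAlgebra k V.carrier →ₗ[k] Y.carrier,
      (∀ i, ∀ a ∈ V.gr i, l a ∈ V.wordHomGr Y n (i + p)) ∧ (∀ a, f ∘ₗ l a = b a) ∧
      ∀ i, ∀ a ∈ V.gr i, V.wordHomD Y (i + p) (l a) - koszulSign k p • l (V.b a) = o a :=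
  hV.lift_homotopy hq p o b ho hb hdo hqo

/-- If the complex of letters is cofibrant, then so are its tensor powers, in the sense that maps
out of them preserve acyclic fibrations. This follows by currying. -/
theorem isAcyclicFibration_wordHom (hV : V.complex.IsCofibrant) {Z : DGModule k}
    {f : Y.carrier →ₗ[k] Z.carrier} (hf : IsAcyclicFibration Y.complex Z.complex f) (n : ℕ) :
    IsAcyclicFibration (V.wordHom n Y) (V.wordHom n Z) (LinearMap.compRight k f) := by
  induction n with
  | zero =>
    have hmem : ∀ {p : ℤ} {v : Y.carrier}, v ∈ Y.gr p →
        LinearMap.toSpanSingleton k _ v ∘ₗ algebraMapInv.toLinearMap ∈ V.wordHomGr Y 0 p := by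
      intro p v hv
      refine ⟨fun q w hw => ?_, fun w => by simp [lenProj_zero, unitCounit]⟩
      refine map_wordGr (S := fun q => Y.gr (q + p)) ?_ (fun i q a w _ _ _ => ?_) hw
      · simpa using hv
      · simp
    have hext : ∀ {X : DGModule k} {p q : ℤ} {φ ψ : TensorAlgebra k V.carrier →ₗ[k] X.carrier},
        φ ∈ V.wordHomGr X 0 p → ψ ∈ V.wordHomGr X 0 q → φ 1 = ψ 1 → φ = ψ := by
      intro X p q φ ψ hφ hψ h1
      ext w
      rw [← hφ.2 w, ← hψ.2 w]
      simp [lenProj_zero, unitCounit, Algebra.algebraMap_eq_smul_one, h1]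
    have hone : ∀ {X : DGModule k} {p : ℤ} {φ : TensorAlgebra k V.carrier →ₗ[k] X.carrier},
        φ ∈ V.wordHomGr X 0 p → φ 1 ∈ X.gr p := by
      intro X p φ h
      have := h.1 0 1 one_mem_wordGr
      rwa [zero_add] at this
    refine isAcyclicFibration_wordHom_of hf.toIsChainMap (fun p y hy => ?_)
      fun p x hx hdx h0 => ?_
    · obtain ⟨v, hv, e⟩ : ∃ v : Y.carrier, v ∈ Y.gr p ∧ f v = y 1 := hf.surj _ (hone hy)
      refine ⟨_, hmem hv, hext (comp_mem_wordHomGr hf.toIsChainMap (hmem hv)) hy ?_⟩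
      simpa using e
    · have hd1 : Y.b (x 1) = 0 := by
        have := LinearMap.congr_fun hdx 1
        rwa [wordHomD_apply, wordD_one, map_zero, smul_zero, sub_zero] at this
      obtain ⟨v, hv, hfv, e⟩ : ∃ v : Y.carrier, v ∈ Y.gr p ∧ f v = 0 ∧ Y.b v = x 1 :=
        hf.acyclic_ker (hone hx) hd1 (LinearMap.congr_fun h0 1)
      refine ⟨_, hmem hv, ?_, hext (wordHomD_mem (hmem hv)) hx ?_⟩
      · ext w
        simp [hfv]
      · rw [wordHomD_apply, wordD_one, map_zero, smul_zero, sub_zero, ← e]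
        simp
  | succ n ih =>
    refine isAcyclicFibration_wordHom_of hf.toIsChainMap (fun p y hy => ?_)
      fun p x hx hdx h0 => ?_
    · have hdy := wordHomD_mem hy
      obtain ⟨o, ho, hqo, hdo⟩ := lift_wordHom hV ih (p + 1) 0 (curryWord (V.wordHomD Z p y))
        (fun _ _ _ => Submodule.zero_mem _) (fun i a ha => (mem_wordHomGr_succ.1 hdy).2 i a ha)
        (by simp) fun i a ha => by
          rw [← curryWord_d (p + 1) (V.wordHomD Z p y) ha, wordHomD_wordHomD]
          ext w
          simp
      obtain ⟨l, hl, hql, hdl⟩ := lift_wordHom hV ih p o (curryWord y)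
        (fun i a ha => by rw [add_assoc]; exact ho i a ha)
        (fun i a ha => (mem_wordHomGr_succ.1 hy).2 i a ha)
        (fun i a ha => by
          have := hdo i a ha
          rw [koszulSign_add, koszulSign_one, mul_neg_one, neg_smul, sub_neg_eq_add] at this
          rw [add_assoc]
          exact this)
        fun i a ha => (hqo a).trans (curryWord_d p y ha)
      refine ⟨uncurryWord l, mem_wordHomGr_succ.2 ⟨uncurryWord_one l, fun i a ha => ?_⟩,
        word_ext ?_ fun a w _ => ?_⟩
      · have : curryWord (uncurryWord l) a = l a := LinearMap.ext fun w => by simp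
        rw [this]
        exact hl i a ha
      · rw [LinearMap.comp_apply, uncurryWord_one, map_zero, (mem_wordHomGr_succ.1 hy).1]
      · rw [LinearMap.comp_apply, uncurryWord_cons]
        exact LinearMap.congr_fun (hql a) w
    · obtain ⟨l, hl, hql, hdl⟩ := lift_wordHom hV ih p (curryWord x) 0
        (fun i a ha => by rw [add_assoc]; exact (mem_wordHomGr_succ.1 hx).2 i a ha)
        (fun _ _ _ => Submodule.zero_mem _)
        (fun i a ha => by
          have := curryWord_d (p + 1) x ha
          rw [hdx, koszulSign_add, koszulSign_one, mul_neg_one, neg_smul, sub_neg_eq_add] at this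
          rw [add_assoc, ← this]
          ext w
          simp)
        fun i a ha => by
          rw [LinearMap.zero_apply, LinearMap.zero_apply, map_zero, smul_zero, sub_zero]
          exact LinearMap.ext fun w => LinearMap.congr_fun h0 (ι k a * w)
      have hcu : ∀ a, curryWord (uncurryWord l) a = l a := fun a => LinearMap.ext fun w => by simp
      refine ⟨uncurryWord l, mem_wordHomGr_succ.2 ⟨uncurryWord_one l, fun i a ha => ?_⟩,
        word_ext ?_ fun a w _ => ?_, word_ext ?_ fun a w _ => ?_⟩
      · rw [hcu]
        exact hl i a ha
      · rw [LinearMap.comp_apply, uncurryWord_one, map_zero, LinearMap.zero_apply]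
      · rw [LinearMap.comp_apply, uncurryWord_cons]
        exact LinearMap.congr_fun (hql a) w
      · rw [wordHomD_apply, uncurryWord_one, wordD_one, map_zero, map_zero, smul_zero, sub_zero]
        exact (mem_wordHomGr_succ.1 hx).1.symm
      · induction a using homogeneous_induction V.gr with
        | hom i a ha =>
          have h1 := curryWord_d p (uncurryWord l) ha
          rw [hcu, hcu] at h1
          exact LinearMap.congr_fun (h1.trans (hdl i a ha)) w
        | add a b ha hb => simp only [map_add, add_mul, ha, hb]

end DGModule

/-! ### Transfer of `A∞`-structures along acyclic fibrations -/

theorem AInfinityAlgebra.ιInv_D {k : Type u} [CommRing k] (A : AInfinityAlgebra k)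
    {w : TensorAlgebra k A.carrier} (hw : w ∈ lenLT k A.carrier 2) :
    ιInv (A.D w) = A.b (ιInv w) := by
  suffices lenLT k A.carrier 2 ≤ LinearMap.eqLocus (ιInv ∘ₗ A.D) (A.b ∘ₗ ιInv) from this hw
  refine lenLT_succ_le ?_ fun a w hw => ?_
  · simp [A.D_one]
  · suffices lenLT k A.carrier 1 ≤ LinearMap.eqLocus
        ((ιInv ∘ₗ A.D) ∘ₗ LinearMap.mulLeft k (ι k a))
        ((A.b ∘ₗ ιInv) ∘ₗ LinearMap.mulLeft k (ι k a)) from this hw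
    refine lenLT_succ_le ?_ fun a w hw => ?_
    · simp [A.D_ι]
    · rw [lenLT_zero, Submodule.mem_bot] at hw
      simp [hw]

namespace DGModule

open InternalComplex

variable {k : Type u} [CommRing k] (V : DGModule k) (Z : AInfinityAlgebra k)
  (f : V.carrier →ₗ[k] Z.carrier)

/-- The coderivation of degree `1` with corestriction `φ`. -/
noncomputable def oddCoder (φ : TensorAlgebra k V.carrier →ₗ[k] V.carrier) :
    Module.End k (TensorAlgebra k V.carrier) := coderOf (letterSign V.gr 1) φ

/-- The map `φ` is the corestriction of an `A∞`-structure on `V` with linear component `b` for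
which `f` is a strict morphism, up to terms which vanish on words with fewer than `n` letters. -/
structure IsPartialTransfer (n : ℕ) (φ : TensorAlgebra k V.carrier →ₗ[k] V.carrier) : Prop where
  mem : ∀ q, ∀ w ∈ wordGr V.gr q, φ w ∈ V.gr (q + 1)
  linear : ∀ w ∈ lenLT k V.carrier 2, φ w = V.b (ιInv w)
  comm : ∀ w ∈ lenLT k V.carrier n, f (φ w) = ιInv (Z.D (wordMap f w))
  sq : ∀ w ∈ lenLT k V.carrier n, φ (V.oddCoder φ w) = 0

variable {V Z f}

namespace IsPartialTransfer

variable {n : ℕ} {φ : TensorAlgebra k V.carrier →ₗ[k] V.carrier}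

theorem oddCoder_mem (h : V.IsPartialTransfer Z f n φ) : V.oddCoder φ ∈ coder V.gr 1 :=
  coderOf_mem h.mem

theorem ιInv_oddCoder (φ : TensorAlgebra k V.carrier →ₗ[k] V.carrier)
    (w : TensorAlgebra k V.carrier) : ιInv (V.oddCoder φ w) = φ w :=
  ιInv_coderOf _ _ _

theorem vanish (h : V.IsPartialTransfer Z f n φ) (w : TensorAlgebra k V.carrier)
    (hw : w ∈ lenLT k V.carrier 1) : ιInv (V.oddCoder φ w) = 0 := by
  rw [ιInv_oddCoder]
  suffices lenLT k V.carrier 1 ≤ LinearMap.ker φ from this hw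
  refine lenLT_succ_le ?_ fun a w hw => ?_
  · rw [LinearMap.mem_ker, h.linear _ (one_mem_lenLT 1), ιInv_one, map_zero]
  · rw [lenLT_zero, Submodule.mem_bot] at hw
    simp [hw]

theorem oddCoder_ι (h : V.IsPartialTransfer Z f n φ) (a : V.carrier) :
    V.oddCoder φ (ι k a) = ι k (V.b a) := by
  rw [(coder_along h.oddCoder_mem).eq_of_vanish h.vanish (ι_mem_lenLT 0 a), ιInv_oddCoder,
    h.linear _ (ι_mem_lenLT 0 a), ιInv_ι]

/-- The quadratic and higher components decrease the length of words. -/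
theorem sub_wordD_mem (h : V.IsPartialTransfer Z f n φ) {l : ℕ} {w : TensorAlgebra k V.carrier}
    (hw : w ∈ lenLT k V.carrier (l + 2)) :
    V.oddCoder φ w - V.wordD w ∈ lenLT k V.carrier (l + 1) :=
  ((coder_along h.oddCoder_mem).sub (coder_along V.wordD_mem)).mem_lenLT (m := 2)
    (fun w hw => by
      rw [LinearMap.sub_apply, map_sub, ιInv_oddCoder, ιInv_wordD, h.linear w hw, sub_self]) hw

theorem sq_eq_zero (h : V.IsPartialTransfer Z f n φ) {w : TensorAlgebra k V.carrier}
    (hw : w ∈ lenLT k V.carrier n) : V.oddCoder φ (V.oddCoder φ w) = 0 :=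
  (isCoderAlong_sq h.oddCoder_mem).eq_zero_of_vanish
    (fun w hw => (ιInv_oddCoder _ _).trans (h.sq w hw)) hw

theorem sq_eq (h : V.IsPartialTransfer Z f n φ) {w : TensorAlgebra k V.carrier}
    (hw : w ∈ lenLT k V.carrier (n + 1)) :
    V.oddCoder φ (V.oddCoder φ w) = ι k (φ (V.oddCoder φ w)) :=
  ((isCoderAlong_sq h.oddCoder_mem).eq_of_vanish
    (fun w hw => (ιInv_oddCoder _ _).trans (h.sq w hw)) hw).trans
      (congrArg (ι k) (ιInv_oddCoder _ _))

end IsPartialTransfer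

theorem wordD_mem_lenLT {n : ℕ} {w : TensorAlgebra k V.carrier}
    (hw : w ∈ lenLT k V.carrier (n + 1)) : V.wordD w ∈ lenLT k V.carrier (n + 1) := by
  refine (coder_along V.wordD_mem).mem_lenLT (m := 1) (fun w hw => ?_) hw
  rw [ιInv_wordD]
  suffices lenLT k V.carrier 1 ≤ LinearMap.ker (V.b ∘ₗ ιInv) from this hw
  refine lenLT_succ_le (by simp) fun a w hw => ?_
  rw [lenLT_zero, Submodule.mem_bot] at hw
  simp [hw]

namespace IsPartialTransfer

variable {n : ℕ} {φ : TensorAlgebra k V.carrier →ₗ[k] V.carrier}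

/-- The obstruction to `D ^ 2 = 0` on words of length `n` is a cocycle. -/
theorem b_obstruction (h : V.IsPartialTransfer Z f (n + 1) φ) {w : TensorAlgebra k V.carrier}
    (hw : w ∈ lenLT k V.carrier (n + 2)) :
    V.b (φ (V.oddCoder φ w)) = φ (V.oddCoder φ (V.wordD w)) := by
  have h1 := congrArg (V.oddCoder φ) (h.sq_eq hw)
  rw [h.oddCoder_ι] at h1
  have h2 := h.sq_eq_zero (h.sub_wordD_mem hw)
  rw [map_sub, map_sub, sub_eq_zero, h1, h.sq_eq (wordD_mem_lenLT hw)] at h2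
  exact ι_leftInverse.injective h2

variable (Z f φ) in
/-- The failure of `f` to be a strict morphism. -/
noncomputable def defect : TensorAlgebra k V.carrier →ₗ[k] Z.carrier :=
  ιInv ∘ₗ Z.D ∘ₗ wordMap f - f ∘ₗ φ

/-- The failure of `f` to be a strict morphism bounds the image of the obstruction. -/
theorem comp_obstruction (hf : ∀ {i a}, a ∈ V.gr i → f a ∈ Z.gr i)
    (h : V.IsPartialTransfer Z f (n + 1) φ)
    {w : TensorAlgebra k V.carrier} (hw : w ∈ lenLT k V.carrier (n + 2)) :
    f (φ (V.oddCoder φ w)) =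
      -Z.b (defect Z f φ w) - defect Z f φ (V.wordD w) := by
  let g : TensorAlgebra k V.carrier →ₗ[k] TensorAlgebra k Z.carrier :=
    Z.D ∘ₗ wordMap f - wordMap f ∘ₗ V.oddCoder φ
  have hg : IsCoderAlong (wordMap f) (wordMap (letterSign V.gr 1)) g :=
    ((coder_along Z.D_mem).comp_wordMap (comp_letterSign (gr := V.gr) (gr' := Z.gr) hf 1).symm).sub
      ((coder_along h.oddCoder_mem).wordMap_comp f)
  have hι : ∀ w, ιInv (g w) = defect Z f φ w := fun w => by
    change ιInv (Z.D (wordMap f w) - wordMap f (V.oddCoder φ w)) = _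
    rw [map_sub, ιInv_wordMap, ιInv_oddCoder]
    rfl
  have hv : ∀ w ∈ lenLT k V.carrier (n + 1), ιInv (g w) = 0 := fun w hw => by
    rw [hι, defect, LinearMap.sub_apply, LinearMap.comp_apply f, h.comm w hw]
    exact sub_self _
  have h1 : ∀ w ∈ lenLT k V.carrier (n + 2), g w = ι k (defect Z f φ w) := fun w hw => by
    rw [← hι]
    exact hg.eq_of_vanish hv hw
  have h2 : g (V.oddCoder φ w) = ι k (defect Z f φ (V.wordD w)) := by
    have := hg.eq_zero_of_vanish hv (h.sub_wordD_mem hw)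
    rw [map_sub, sub_eq_zero] at this
    rw [this, h1 _ (wordD_mem_lenLT hw)]
  have h3 : Z.D (g w) = ι k (Z.b (defect Z f φ w)) := by rw [h1 w hw, Z.D_ι]
  have h4 : Z.D (g w) + g (V.oddCoder φ w) = -wordMap f (V.oddCoder φ (V.oddCoder φ w)) := by
    change Z.D (Z.D (wordMap f w) - wordMap f (V.oddCoder φ w)) +
      (Z.D (wordMap f (V.oddCoder φ w)) - wordMap f (V.oddCoder φ (V.oddCoder φ w))) = _
    rw [map_sub, Z.D_D_apply]
    abel
  rw [h2, h3, h.sq_eq hw, wordMap_ι, ← map_add, ← map_neg] at h4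
  have := ι_leftInverse.injective h4
  rw [← neg_neg (f _), ← this]
  abel

/-- A partial `A∞`-structure can be corrected on words of length `n + 1`, because maps on these
words preserve acyclic fibrations. -/
theorem step (hV : V.complex.IsCofibrant)
    (hf : IsAcyclicFibration V.complex Z.toDGModule.complex f)
    (h : V.IsPartialTransfer Z f (n + 2) φ) :
    ∃ φ', V.IsPartialTransfer Z f (n + 3) φ' ∧ ∀ w ∈ lenLT k V.carrier (n + 2), φ' w = φ w := by
  have hfm : ∀ {i a}, a ∈ V.gr i → f a ∈ Z.gr i := fun ha => hf.map_mem ha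
  have hfib := isAcyclicFibration_wordHom hV (Y := V) (Z := Z.toDGModule) hf (n + 2)
  let P := lenProj k V.carrier (n + 2)
  have hP : ∀ w, P w ∈ lenLT k V.carrier (n + 3) := fun w => lenProj_mem (n + 2) w
  have hPP : ∀ w, P (P w) = P w := fun w => lenProj_lenProj _ w
  have hPd : ∀ w, P (V.wordD w) = V.wordD (P w) := fun w => (V.wordD_lenProj _ w).symm
  -- The correction `ψ` has to be a lift of the defect `E` with boundary the cocycle `O`. Any lift `ψ₀`
  -- of `E` has the right boundary up to a cocycle in the kernel of `f`, which is acyclic.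
  let O : TensorAlgebra k V.carrier →ₗ[k] V.carrier := -(φ ∘ₗ V.oddCoder φ ∘ₗ P)
  let E : TensorAlgebra k V.carrier →ₗ[k] Z.carrier := defect Z f φ ∘ₗ P
  have hO : O ∈ V.wordHomGr V (n + 2) (1 + 1) := by
    refine ⟨fun q w hw => Submodule.neg_mem _ ?_, fun w => ?_⟩
    · have := h.mem _ _ (h.oddCoder_mem.1 _ _ (lenProj_mem_wordGr (n + 2) hw))
      rw [add_assoc] at this
      exact this
    · change -(φ (V.oddCoder φ (P (P w)))) = -(φ (V.oddCoder φ (P w)))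
      rw [hPP]
  have hE : E ∈ V.wordHomGr Z.toDGModule (n + 2) 1 := by
    refine ⟨fun q w hw => Submodule.sub_mem _ ?_ (hfm (h.mem _ _ (lenProj_mem_wordGr _ hw))),
      fun w => congrArg (defect Z f φ) (hPP w)⟩
    exact ιInv_mem (Z.D_mem.1 _ _ (wordMap_mem_wordGr hfm (lenProj_mem_wordGr _ hw)))
  obtain ⟨ψ₀, hψ₀, hE₀⟩ : ∃ ψ₀ : TensorAlgebra k V.carrier →ₗ[k] V.carrier,
      ψ₀ ∈ V.wordHomGr V (n + 2) 1 ∧ f ∘ₗ ψ₀ = E := hfib.surj E hE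
  obtain ⟨x, hx, hfx, hdx⟩ : ∃ x : TensorAlgebra k V.carrier →ₗ[k] V.carrier,
      x ∈ V.wordHomGr V (n + 2) 1 ∧ f ∘ₗ x = 0 ∧
        V.wordHomD V 1 x = O - V.wordHomD V 1 ψ₀ := by
    refine hfib.acyclic_ker (x := O - V.wordHomD V 1 ψ₀)
      (Submodule.sub_mem _ hO (wordHomD_mem hψ₀)) ?_ ?_
    · change V.wordHomD V (1 + 1) (O - V.wordHomD V 1 ψ₀) = 0
      rw [map_sub, wordHomD_wordHomD, sub_zero]
      refine LinearMap.ext fun w => ?_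
      have hb := h.b_obstruction (hP w)
      rw [wordHomD_apply, koszulSign_add, koszulSign_sq, one_smul]
      change V.b (-(φ (V.oddCoder φ (P w)))) - -(φ (V.oddCoder φ (P (V.wordD w)))) = 0
      rw [map_neg, hb, hPd]
      abel
    · change f ∘ₗ (O - V.wordHomD V 1 ψ₀) = 0
      have h1 : f ∘ₗ V.wordHomD V 1 ψ₀ = V.wordHomD Z.toDGModule 1 E :=
        (comp_wordHomD hf.toIsChainMap hψ₀).trans (congrArg _ hE₀)
      rw [LinearMap.comp_sub, h1]
      refine LinearMap.ext fun w => ?_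
      have hb := h.comp_obstruction hfm (hP w)
      change f (-(φ (V.oddCoder φ (P w)))) - (Z.b (defect Z f φ (P w)) -
        koszulSign k 1 • defect Z f φ (P (V.wordD w))) = 0
      rw [koszulSign_one, map_neg, hb, hPd, neg_one_smul]
      abel
  obtain ⟨ψ, rfl⟩ : ∃ ψ, x = ψ - ψ₀ := ⟨ψ₀ + x, by rw [add_sub_cancel_left]⟩
  have hψ : ψ ∈ V.wordHomGr V (n + 2) 1 := by
    have := Submodule.add_mem _ hψ₀ hx
    rwa [add_sub_cancel] at this
  have hfψ : ∀ w, f (ψ w) = defect Z f φ (P w) := fun w => by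
    have h1 := LinearMap.congr_fun hE₀ w
    have h2 := LinearMap.congr_fun hfx w
    rw [LinearMap.comp_apply, LinearMap.sub_apply, map_sub, LinearMap.zero_apply, sub_eq_zero] at h2
    exact h2.trans h1
  have hdψ : ∀ w, V.b (ψ w) + ψ (V.wordD w) = -φ (V.oddCoder φ (P w)) := fun w => by
    have h1 : V.wordHomD V 1 ψ = O := by rwa [map_sub, sub_left_inj] at hdx
    have h2 := LinearMap.congr_fun h1 w
    rw [wordHomD_apply, koszulSign_one, neg_one_smul, sub_neg_eq_add] at h2
    exact h2
  have hψ0 : ∀ w ∈ lenLT k V.carrier (n + 2), ψ w = 0 := fun w hw => by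
    rw [← hψ.2, lenProj_eq_zero hw, map_zero]
  have hmem : ∀ q, ∀ w ∈ wordGr V.gr q, (φ + ψ) w ∈ V.gr (q + 1) := fun q w hw =>
    Submodule.add_mem _ (h.mem q w hw) (hψ.1 q w hw)
  have hlin : ∀ w ∈ lenLT k V.carrier 2, (φ + ψ) w = V.b (ιInv w) := fun w hw => by
    rw [LinearMap.add_apply, hψ0 w (lenLT_mono (by omega) hw), add_zero, h.linear w hw]
  have hsub : ∀ w ∈ lenLT k V.carrier (n + 3), w - P w ∈ lenLT k V.carrier (n + 2) :=
    fun w hw => sub_lenProj_mem hw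
  refine ⟨φ + ψ, ⟨hmem, hlin, fun w hw => ?_, fun w hw => ?_⟩, fun w hw => ?_⟩
  · have h1 : defect Z f φ (w - P w) = 0 := by
      rw [defect, LinearMap.sub_apply, LinearMap.comp_apply f, h.comm _ (hsub w hw)]
      exact sub_self _
    rw [map_sub, sub_eq_zero] at h1
    rw [LinearMap.add_apply, map_add, hfψ, ← h1]
    exact add_sub_cancel _ _
  · have hS : IsCoderAlong (wordMap LinearMap.id) (wordMap (letterSign V.gr 1))
        (V.oddCoder (φ + ψ) - V.oddCoder φ) :=
      (coder_along (coderOf_mem hmem)).sub (coder_along h.oddCoder_mem)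
    have hι : ∀ w, ιInv ((V.oddCoder (φ + ψ) - V.oddCoder φ) w) = ψ w := fun w => by
      rw [LinearMap.sub_apply, map_sub, ιInv_oddCoder, ιInv_oddCoder, LinearMap.add_apply,
        add_sub_cancel_left]
    have h1 := hS.eq_of_vanish (n := n + 2) (fun w hw => (hι w).trans (hψ0 w hw)) hw
    rw [hι, LinearMap.sub_apply, sub_eq_iff_eq_add] at h1
    have h2 := hψ0 _ (h.sub_wordD_mem (l := n + 1) hw)
    rw [map_sub, sub_eq_zero] at h2
    have h3 := h.sq _ (hsub w hw)
    rw [map_sub, map_sub, sub_eq_zero] at h3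
    rw [h1, map_add, hlin _ (ι_mem_lenLT 0 _), ιInv_ι, LinearMap.add_apply, h2, h3]
    have := hdψ w
    rw [← neg_eq_iff_eq_neg] at this
    rw [← this]
    abel
  · rw [LinearMap.add_apply, hψ0 w hw, add_zero]

end IsPartialTransfer

/-- The `A∞`-structure of `Z` lifts to `V` along an acyclic fibration `f : V → Z`, if `V` is
cofibrant. -/
theorem exists_transfer (hV : V.complex.IsCofibrant)
    (hf : IsAcyclicFibration V.complex Z.toDGModule.complex f) :
    ∃ D : Module.End k (TensorAlgebra k V.carrier), D ∈ coder V.gr 1 ∧ D * D = 0 ∧ D 1 = 0 ∧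
      (∀ a, D (ι k a) = ι k (V.b a)) ∧ wordMap f ∘ₗ D = Z.D ∘ₗ wordMap f := by
  have hfm : ∀ {i a}, a ∈ V.gr i → f a ∈ Z.gr i := fun ha => hf.map_mem ha
  have hfb : f ∘ₗ V.b = Z.b ∘ₗ f := homogeneous_ext V.gr fun i a ha => hf.map_d ha
  have base : V.IsPartialTransfer Z f 2 (V.b ∘ₗ ιInv) := by
    refine ⟨fun q w hw => V.b_mem (ιInv_mem hw), fun w _ => rfl, fun w hw => ?_, fun w hw => ?_⟩
    · rw [Z.ιInv_D (wordMap_mem_lenLT f hw), ιInv_wordMap]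
      exact LinearMap.congr_fun hfb _
    · change V.b (ιInv (V.wordD w)) = 0
      rw [ιInv_wordD, V.b_b]
  choose! next hnext hext using fun (n : ℕ) (φ : TensorAlgebra k V.carrier →ₗ[k] V.carrier)
    (h : V.IsPartialTransfer Z f (n + 2) φ) => h.step hV hf
  let seq : ℕ → TensorAlgebra k V.carrier →ₗ[k] V.carrier := fun n =>
    Nat.rec (V.b ∘ₗ ιInv) next n
  have hseq : ∀ n, V.IsPartialTransfer Z f (n + 2) (seq n) := fun n => by
    induction n with
    | zero => exact base
    | succ n ih => exact hnext n _ ih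
  obtain ⟨φ, hφ, hmem⟩ := exists_limit_graded (gr := V.gr) (gr' := V.gr) (p := 1) seq
    (fun n w hw => hext n _ (hseq n) w (lenLT_mono (by omega) hw)) fun n => (hseq n).mem
  have h0 : φ 1 = 0 := by
    rw [hφ 2 1 (one_mem_lenLT 1), (hseq 2).linear 1 (one_mem_lenLT 1), ιInv_one, map_zero]
  have hD : V.oddCoder φ ∈ coder V.gr 1 := coderOf_mem hmem
  have hι : ∀ w, ιInv (V.oddCoder φ w) = φ w := IsPartialTransfer.ιInv_oddCoder φ
  have hagree : ∀ n, ∀ w ∈ lenLT k V.carrier n, V.oddCoder φ w = V.oddCoder (seq n) w :=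
    fun n w hw => sub_eq_zero.1 <|
      ((coder_along hD).sub (coder_along (hseq n).oddCoder_mem)).eq_zero_of_vanish
        (fun w hw => by
          rw [LinearMap.sub_apply, map_sub, hι, IsPartialTransfer.ιInv_oddCoder, hφ n w hw,
            sub_self]) hw
  refine ⟨V.oddCoder φ, hD, ?_, ?_, fun a => ?_, ?_⟩
  · refine (isCoderAlong_sq hD).ext (g' := 0) ?_ fun w => ?_
    · simp [IsCoderAlong]
    · obtain ⟨n, hn⟩ := exists_mem_lenLT w
      have hn : w ∈ lenLT k V.carrier (n + 1) := lenLT_mono n.le_succ hn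
      have h1 := (coder_along (hseq (n + 1)).oddCoder_mem).mem_lenLT (hseq (n + 1)).vanish hn
      rw [LinearMap.comp_apply, hι, hagree _ w hn, hφ _ _ h1,
        (hseq (n + 1)).sq w (lenLT_mono (by omega) hn)]
      simp
  · exact (coderOf_one _ _).trans (by rw [h0, map_zero])
  · rw [hagree 2 _ (ι_mem_lenLT 0 a), (hseq 2).oddCoder_ι]
  · refine ((coder_along hD).wordMap_comp f).ext ((coder_along Z.D_mem).comp_wordMap
      (comp_letterSign (gr := V.gr) (gr' := Z.gr) hfm 1).symm) fun w => ?_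
    obtain ⟨n, hn⟩ := exists_mem_lenLT w
    rw [LinearMap.comp_apply, ιInv_wordMap, hι, hφ n w hn,
      (hseq n).comm w (lenLT_mono (by omega) hn)]
    rfl

end DGModule

/-! ### Comparison of coderivations along a strict contraction -/

namespace TensorAlgebra

variable {k : Type u} [CommRing k] {V : Type u} [AddCommGroup V] [Module k V]

theorem coderOf_add {gr : ℤ → Submodule k V} [DirectSum.Decomposition gr] {p : ℤ}
    {φ ψ : TensorAlgebra k V →ₗ[k] V} (hφ : ∀ q, ∀ w ∈ wordGr gr q, φ w ∈ gr (q + p))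
    (hψ : ∀ q, ∀ w ∈ wordGr gr q, ψ w ∈ gr (q + p)) :
    coderOf (letterSign gr p) (φ + ψ) =
      coderOf (letterSign gr p) φ + coderOf (letterSign gr p) ψ :=
  (coder_along (coderOf_mem fun q w hw => Submodule.add_mem _ (hφ q w hw) (hψ q w hw))).ext
    ((coder_along (coderOf_mem hφ)).add (coder_along (coderOf_mem hψ)))
    fun w => by simp [ιInv_coderOf]

end TensorAlgebra

namespace AInfinityAlgebra

variable {k : Type u} [CommRing k] (V : AInfinityAlgebra k)

/-- The differential `δ ↦ D δ - (-1) ^ p δ D` on operators of degree `p`. -/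
noncomputable def comm (p : ℤ) : Module.End k (TensorAlgebra k V.carrier) →ₗ[k]
    Module.End k (TensorAlgebra k V.carrier) :=
  LinearMap.mulLeft k V.D - koszulSign k p • LinearMap.mulRight k V.D

theorem comm_apply (p : ℤ) (δ : Module.End k (TensorAlgebra k V.carrier))
    (w : TensorAlgebra k V.carrier) :
    V.comm p δ w = V.D (δ w) - koszulSign k p • δ (V.D w) := rfl

variable {V}

theorem comm_mem {p : ℤ} {δ : Module.End k (TensorAlgebra k V.carrier)}
    (h : δ ∈ coder V.gr p) : V.comm p δ ∈ coder V.gr (p + 1) := V.coderLie.complex.d_mem h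

theorem comm_comm {p : ℤ} {δ : Module.End k (TensorAlgebra k V.carrier)}
    (h : δ ∈ coder V.gr p) : V.comm (p + 1) (V.comm p δ) = 0 := V.coderLie.complex.d_d h

theorem comm_congr {p : ℤ} {δ δ' : Module.End k (TensorAlgebra k V.carrier)}
    (h : δ ∈ coder V.gr p) (h' : δ' ∈ coder V.gr p) {n : ℕ}
    (heq : ∀ w ∈ lenLT k V.carrier n, ιInv (δ w) = ιInv (δ' w))
    {w : TensorAlgebra k V.carrier} (hw : w ∈ lenLT k V.carrier n) :
    V.comm p δ w = V.comm p δ' w := by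
  have key : ∀ w ∈ lenLT k V.carrier n, δ w = δ' w := fun w hw => sub_eq_zero.1 <|
    ((coder_along h).sub (coder_along h')).eq_zero_of_vanish
      (fun w hw => by rw [LinearMap.sub_apply, map_sub, heq w hw, sub_self]) hw
  rw [comm_apply, comm_apply, key w hw, key _ (V.D_mem_lenLT hw)]

/-- Successive approximation: if a coderivation in the `n`-th stage `G n` of a filtration can be
moved to the next stage by subtracting a boundary `[D, η]`, where `η` vanishes on words with fewer
than `n` letters, then by subtracting a single boundary it can be moved to all stages, up to terms
which vanish on words with fewer than `n` letters. -/
theorem exists_sub_comm {p : ℤ} {G : ℕ → Module.End k (TensorAlgebra k V.carrier) → Prop}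
    {N : Submodule k V.carrier}
    (step : ∀ n, ∀ δ ∈ coder V.gr (p + 1), G n δ →
      ∃ φ : TensorAlgebra k V.carrier →ₗ[k] V.carrier,
        (∀ q, ∀ w ∈ wordGr V.gr q, φ w ∈ V.gr (q + p)) ∧ (∀ w, φ w ∈ N) ∧
          (∀ w ∈ lenLT k V.carrier n, φ w = 0) ∧
            G (n + 1) (δ - V.comm p (coderOf (letterSign V.gr p) φ)))
    {δ : Module.End k (TensorAlgebra k V.carrier)} (hδ : δ ∈ coder V.gr (p + 1)) (h0 : G 0 δ) :
    ∃ η ∈ coder V.gr p, (∀ w, ιInv (η w) ∈ N) ∧ ∀ n, ∃ δ', G n δ' ∧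
      ∀ w ∈ lenLT k V.carrier n, (δ - V.comm p η) w = δ' w := by
  let St : ℕ → (TensorAlgebra k V.carrier →ₗ[k] V.carrier) → Prop := fun n θ =>
    (∀ q, ∀ w ∈ wordGr V.gr q, θ w ∈ V.gr (q + p)) ∧ (∀ w, θ w ∈ N) ∧
      G n (δ - V.comm p (coderOf (letterSign V.gr p) θ))
  have base : St 0 0 := by
    have h : coderOf (letterSign V.gr p) (0 : TensorAlgebra k V.carrier →ₗ[k] V.carrier) = 0 := by
      have := coderOf_add (gr := V.gr) (p := p) (φ := 0) (ψ := 0)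
        (fun _ _ _ => Submodule.zero_mem _) fun _ _ _ => Submodule.zero_mem _
      rwa [add_zero, left_eq_add] at this
    refine ⟨fun _ _ _ => Submodule.zero_mem _, fun _ => Submodule.zero_mem _, ?_⟩
    rwa [h, map_zero, sub_zero]
  have hstep : ∀ n θ, St n θ → ∃ θ', St (n + 1) θ' ∧ ∀ w ∈ lenLT k V.carrier n, θ' w = θ w := by
    rintro n θ ⟨h1, h2, h3⟩
    obtain ⟨φ, e1, e2, e3, e4⟩ := step n _
      (Submodule.sub_mem _ hδ (comm_mem (coderOf_mem h1))) h3
    refine ⟨θ + φ, ⟨fun q w hw => Submodule.add_mem _ (h1 q w hw) (e1 q w hw),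
      fun w => Submodule.add_mem _ (h2 w) (e2 w), ?_⟩, fun w hw => ?_⟩
    · rwa [coderOf_add h1 e1, map_add, ← sub_sub]
    · rw [LinearMap.add_apply, e3 w hw, add_zero]
  choose! next hnext hext using hstep
  let seq : ℕ → TensorAlgebra k V.carrier →ₗ[k] V.carrier := fun n => Nat.rec 0 next n
  have hseq : ∀ n, St n (seq n) := fun n => by
    induction n with
    | zero => exact base
    | succ n ih => exact hnext n _ ih
  obtain ⟨θ, hθ, hmem⟩ := exists_limit_graded (gr := V.gr) (gr' := V.gr) (p := p) seq
    (fun n => hext n _ (hseq n)) fun n => (hseq n).1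
  refine ⟨_, coderOf_mem hmem, fun w => ?_, fun n => ⟨_, (hseq n).2.2, fun w hw => ?_⟩⟩
  · obtain ⟨n, hn⟩ := exists_mem_lenLT w
    rw [ιInv_coderOf, hθ n w hn]
    exact (hseq n).2.1 w
  · rw [LinearMap.sub_apply, LinearMap.sub_apply, comm_congr (coderOf_mem hmem)
      (coderOf_mem (hseq n).1) (fun w hw => ?_) hw]
    rw [ιInv_coderOf, ιInv_coderOf, hθ n w hw]

variable (V)

/-- The part of `D` which preserves the length of words. -/
noncomputable def linD : Module.End k (TensorAlgebra k V.carrier) := V.toDGModule.wordD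

variable {V}

theorem linD_cons {i : ℤ} {a : V.carrier} (ha : a ∈ V.gr i) (w : TensorAlgebra k V.carrier) :
    V.linD (ι k a * w) = ι k (V.b a) * w + koszulSign k i • (ι k a * V.linD w) :=
  V.toDGModule.wordD_cons_hom ha w

theorem linD_one : V.linD 1 = 0 := V.toDGModule.wordD_one

theorem ιInv_linD (w : TensorAlgebra k V.carrier) : ιInv (V.linD w) = V.b (ιInv w) :=
  V.toDGModule.ιInv_wordD w

theorem D_sub_linD_mem {n : ℕ} {w : TensorAlgebra k V.carrier}
    (hw : w ∈ lenLT k V.carrier (n + 1)) : V.D w - V.linD w ∈ lenLT k V.carrier n := by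
  have h1 : IsCoderAlong (wordMap LinearMap.id) (wordMap (letterSign V.gr 1)) (V.D - V.linD) :=
    (coder_along V.D_mem).sub (coder_along V.toDGModule.wordD_mem)
  have h2 : ∀ w ∈ lenLT k V.carrier 2, ιInv ((V.D - V.linD) w) = 0 := fun w hw => by
    rw [LinearMap.sub_apply, map_sub, V.ιInv_D hw, ιInv_linD, sub_self]
  rcases n with _ | n
  · have := h1.eq_zero_of_vanish h2 (lenLT_mono (by omega) hw)
    rw [LinearMap.sub_apply] at this
    rw [this]
    exact Submodule.zero_mem _
  · exact h1.mem_lenLT (m := 2) h2 hw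

variable (V) (A : AInfinityAlgebra k)

/-- A strict morphism `f : V → A` of `A∞`-algebras with a section `s` and a homotopy `h` from
`s ∘ f` to the identity of the underlying complexes. -/
structure IsContraction (f : V.carrier →ₗ[k] A.carrier) (s : A.carrier →ₗ[k] V.carrier)
    (h : V.carrier →ₗ[k] V.carrier) : Prop where
  f_mem : ∀ {i a}, a ∈ V.gr i → f a ∈ A.gr i
  s_mem : ∀ {i a}, a ∈ A.gr i → s a ∈ V.gr i
  h_mem : ∀ {i a}, a ∈ V.gr i → h a ∈ V.gr (i - 1)
  f_D : wordMap f ∘ₗ V.D = A.D ∘ₗ wordMap f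
  s_b : ∀ a, s (A.b a) = V.b (s a)
  f_s : ∀ a, f (s a) = a
  f_h : ∀ a, f (h a) = 0
  homotopy : ∀ a, V.b (h a) + h (V.b a) = a - s (f a)

variable {V A}

/-- The homotopy `a ⬝ w ↦ h a ⬝ w + (-1) ^ |a| e a ⬝ H w` on words, which is a tensor power of the
homotopy `h` on letters, from the idempotent `e` to the identity. -/
noncomputable def wordHomotopy (e h : V.carrier →ₗ[k] V.carrier) :
    Module.End k (TensorAlgebra k V.carrier) :=
  wordRec 0 <| LinearMap.mk₂ k
    (fun a z => ι k (h a) * z.1 + ι k (e (letterSign V.gr 1 a)) * z.2)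
    (by intros; simp only [map_add, add_mul]; abel)
    (by intros; simp only [map_smul, smul_mul_assoc, smul_add])
    (by intros; simp only [Prod.fst_add, Prod.snd_add, mul_add]; abel)
    (by intros; simp only [Prod.smul_fst, Prod.smul_snd, mul_smul_comm, smul_add])

theorem wordHomotopy_one (e h : V.carrier →ₗ[k] V.carrier) : wordHomotopy e h 1 = 0 :=
  wordRec_one _ _

theorem wordHomotopy_cons (e h : V.carrier →ₗ[k] V.carrier) (a : V.carrier)
    (w : TensorAlgebra k V.carrier) : wordHomotopy e h (ι k a * w) =
      ι k (h a) * w + ι k (e (letterSign V.gr 1 a)) * wordHomotopy e h w :=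
  wordRec_ι_mul _ _ _ _

namespace IsContraction

variable {f : V.carrier →ₗ[k] A.carrier} {s : A.carrier →ₗ[k] V.carrier}
  {h : V.carrier →ₗ[k] V.carrier} (c : V.IsContraction A f s h)

include c

theorem wordMap_wordMap (w : TensorAlgebra k A.carrier) : wordMap f (wordMap s w) = w := by
  have h1 : f ∘ₗ s = LinearMap.id := LinearMap.ext c.f_s
  have := LinearMap.congr_fun (wordMap_comp f s) w
  rwa [h1, wordMap_id] at this

theorem f_D_apply (w : TensorAlgebra k V.carrier) : wordMap f (V.D w) = A.D (wordMap f w) :=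
  LinearMap.congr_fun c.f_D w

theorem f_b (a : V.carrier) : f (V.b a) = A.b (f a) := by
  have := c.f_D_apply (ι k a)
  rw [V.D_ι, wordMap_ι, wordMap_ι, A.D_ι] at this
  exact ι_leftInverse.injective this

theorem wordMap_wordHomotopy (w : TensorAlgebra k V.carrier) :
    wordMap f (wordHomotopy (s ∘ₗ f) h w) = 0 := by
  have : wordMap f ∘ₗ wordHomotopy (s ∘ₗ f) h = 0 :=
    word_ext (by simp [wordHomotopy_one]) fun a w hw => by
      rw [LinearMap.comp_apply] at hw
      rw [LinearMap.comp_apply, wordHomotopy_cons, map_add, wordMap_ι_mul, wordMap_ι_mul, c.f_h, hw]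
      simp
  exact LinearMap.congr_fun this w

theorem wordHomotopy_mem {q : ℤ} {w : TensorAlgebra k V.carrier} (hw : w ∈ wordGr V.gr q) :
    wordHomotopy (s ∘ₗ f) h w ∈ wordGr V.gr (q - 1) := by
  refine map_wordGr (S := fun q => wordGr V.gr (q - 1)) ?_ (fun i q a w ha hw ih => ?_) hw
  · rw [wordHomotopy_one]
    exact Submodule.zero_mem _
  · rw [wordHomotopy_cons, letterSign_apply 1 ha]
    exact Submodule.add_mem _ (cons_mem_wordGr (by ring) (c.h_mem ha) hw)
      (cons_mem_wordGr (by ring) (c.s_mem (c.f_mem (Submodule.smul_mem _ _ ha))) ih)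

omit c in
theorem wordHomotopy_mem_lenLT {n : ℕ} {w : TensorAlgebra k V.carrier}
    (hw : w ∈ lenLT k V.carrier n) :
    wordHomotopy (s ∘ₗ f) h w ∈ lenLT k V.carrier n := by
  suffices lenLT k V.carrier n ≤ (lenLT k V.carrier n).comap (wordHomotopy (s ∘ₗ f) h) from this hw
  clear hw w
  induction n with
  | zero => simp [lenLT_zero]
  | succ n ih =>
    refine lenLT_succ_le ?_ fun a w hw => ?_
    · rw [Submodule.mem_comap, wordHomotopy_one]
      exact Submodule.zero_mem _
    · rw [Submodule.mem_comap, wordHomotopy_cons]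
      exact Submodule.add_mem _ (cons_mem_lenLT _ hw) (cons_mem_lenLT _ (ih hw))

theorem linD_wordHomotopy (w : TensorAlgebra k V.carrier) :
    V.linD (wordHomotopy (s ∘ₗ f) h w) + wordHomotopy (s ∘ₗ f) h (V.linD w) =
      w - wordMap s (wordMap f w) := by
  have : V.linD ∘ₗ wordHomotopy (s ∘ₗ f) h + wordHomotopy (s ∘ₗ f) h ∘ₗ V.linD =
      LinearMap.id - wordMap s ∘ₗ wordMap f := by
    refine word_ext (by simp [wordHomotopy_one, linD_one]) fun a w hw => ?_
    simp only [LinearMap.add_apply, LinearMap.comp_apply, LinearMap.sub_apply,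
      LinearMap.id_apply, wordMap_ι_mul] at hw ⊢
    induction a using homogeneous_induction V.gr with
    | hom i a ha =>
      have hsf := c.s_mem (c.f_mem ha)
      have h1 : (ι k (V.b (h a)) + ι k (h (V.b a))) * w = (ι k a - ι k (s (f a))) * w := by
        rw [← map_add, c.homotopy, map_sub]
      have h2 := congrArg (ι k (s (f a)) * ·) hw
      simp only [mul_add, mul_sub] at h2
      rw [linD_cons ha, map_add, map_smul, wordHomotopy_cons, wordHomotopy_cons,
        wordHomotopy_cons, letterSign_apply 1 ha, letterSign_apply 1 (V.b_mem ha), map_add,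
        linD_cons (c.h_mem ha), map_smul, map_smul, smul_mul_assoc, map_smul, LinearMap.comp_apply,
        linD_cons hsf, map_smul, map_smul, LinearMap.comp_apply, c.f_b, c.s_b, one_mul, one_mul,
        koszulSign_add, sub_eq_add_neg, koszulSign_add, koszulSign_neg, koszulSign_one,
        mul_neg_one, neg_smul, neg_smul, smul_add, smul_add, smul_smul, koszulSign_sq, one_smul,
        smul_mul_assoc, neg_mul, smul_mul_assoc, smul_smul, koszulSign_sq, one_smul]
      rw [add_mul, sub_mul] at h1
      linear_combination (norm := module) h1 + h2
    | add a b ha hb =>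
      simp only [map_add, add_mul]
      rw [add_sub_add_comm, ← ha, ← hb]
      abel
  exact LinearMap.congr_fun this w

end IsContraction

end AInfinityAlgebra

namespace AInfinityAlgebra

variable {k : Type u} [CommRing k] {V A : AInfinityAlgebra k}

/-- The coderivations of the bar construction of `V` of degree `p` which induce coderivations of
the bar construction of `A` along a map of letters `f`. -/
def projectable (A : AInfinityAlgebra k) (f : V.carrier →ₗ[k] A.carrier) (p : ℤ) :
    Submodule k (Module.End k (TensorAlgebra k V.carrier)) where
  carrier := {δ | δ ∈ coder V.gr p ∧ ∃ ε ∈ coder A.gr p, wordMap f ∘ₗ δ = ε ∘ₗ wordMap f}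
  zero_mem' := ⟨Submodule.zero_mem _, 0, Submodule.zero_mem _, by simp⟩
  add_mem' := by
    rintro δ δ' ⟨h, ε, hε, e⟩ ⟨h', ε', hε', e'⟩
    exact ⟨Submodule.add_mem _ h h', ε + ε', Submodule.add_mem _ hε hε', by
      rw [LinearMap.comp_add, LinearMap.add_comp, e, e']⟩
  smul_mem' := by
    rintro r δ ⟨h, ε, hε, e⟩
    exact ⟨Submodule.smul_mem _ r h, r • ε, Submodule.smul_mem _ r hε, by
      rw [LinearMap.comp_smul, LinearMap.smul_comp, e]⟩

theorem comp_mul_eq {f : V.carrier →ₗ[k] A.carrier}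
    {δ δ' : Module.End k (TensorAlgebra k V.carrier)}
    {ε ε' : Module.End k (TensorAlgebra k A.carrier)} (e : wordMap f ∘ₗ δ = ε ∘ₗ wordMap f)
    (e' : wordMap f ∘ₗ δ' = ε' ∘ₗ wordMap f) :
    wordMap f ∘ₗ (δ * δ') = (ε * ε') ∘ₗ wordMap f := by
  rw [Module.End.mul_eq_comp, Module.End.mul_eq_comp, ← LinearMap.comp_assoc, e,
    LinearMap.comp_assoc, e', LinearMap.comp_assoc]

/-- The dg Lie algebra of coderivations which are projectable along a strict morphism. -/
noncomputable def projectableLie (f : V.carrier →ₗ[k] A.carrier)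
    (hf : wordMap f ∘ₗ V.D = A.D ∘ₗ wordMap f) : OperatorLie k where
  space := TensorAlgebra k V.carrier
  gr := projectable A f
  comm_mem := by
    rintro p q δ δ' ⟨h, ε, hε, e⟩ ⟨h', ε', hε', e'⟩
    refine ⟨commutator_mem_coder rfl h h', _, commutator_mem_coder rfl hε hε', ?_⟩
    rw [LinearMap.comp_sub, LinearMap.comp_smul, comp_mul_eq e e', comp_mul_eq e' e,
      LinearMap.sub_comp, LinearMap.smul_comp]
  D := V.D
  D_mem := ⟨V.D_mem, A.D, A.D_mem, hf⟩
  D_D := V.D_D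

namespace IsContraction

variable {f : V.carrier →ₗ[k] A.carrier} {s : A.carrier →ₗ[k] V.carrier}
  {h : V.carrier →ₗ[k] V.carrier} (c : V.IsContraction A f s h)

include c

omit c in
theorem wordMap_comp_along {p : ℤ} {δ : Module.End k (TensorAlgebra k V.carrier)}
    (hδ : δ ∈ coder V.gr p) :
    IsCoderAlong (wordMap f) (wordMap (letterSign V.gr p)) (wordMap f ∘ₗ δ) :=
  (coder_along hδ).wordMap_comp f

theorem comp_wordMap_along {p : ℤ} {ε : Module.End k (TensorAlgebra k A.carrier)}
    (hε : ε ∈ coder A.gr p) :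
    IsCoderAlong (wordMap f) (wordMap (letterSign V.gr p)) (ε ∘ₗ wordMap f) :=
  (coder_along hε).comp_wordMap
    (comp_letterSign (gr := V.gr) (gr' := A.gr) (fun ha => c.f_mem ha) p).symm

/-- The coderivation of the bar construction of `A` induced by a coderivation of that of `V` by
means of the section. -/
theorem exists_pushforward {p : ℤ} {δ : Module.End k (TensorAlgebra k V.carrier)}
    (hδ : δ ∈ coder V.gr p) :
    ∃ ε ∈ coder A.gr p, ∀ w, ιInv (ε w) = f (ιInv (δ (wordMap s w))) :=
  ⟨coderOf (letterSign A.gr p) (f ∘ₗ ιInv ∘ₗ δ ∘ₗ wordMap s), coderOf_mem fun q _ hw =>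
    c.f_mem (ιInv_coder_mem hδ q _ (wordMap_mem_wordGr (fun ha => c.s_mem ha) hw)),
    fun _ => ιInv_coderOf _ _ _⟩

theorem mem_projectable_iff {p : ℤ} {δ : Module.End k (TensorAlgebra k V.carrier)} :
    δ ∈ projectable A f p ↔
      δ ∈ coder V.gr p ∧ ∀ w, wordMap f w = 0 → f (ιInv (δ w)) = 0 := by
  constructor
  · rintro ⟨h, ε, hε, e⟩
    refine ⟨h, fun w hw => ?_⟩
    have := LinearMap.congr_fun e w
    rw [LinearMap.comp_apply, LinearMap.comp_apply, hw, map_zero] at this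
    rw [← ιInv_wordMap, this, map_zero]
  · rintro ⟨hδ, h0⟩
    obtain ⟨ε, hε, e⟩ := c.exists_pushforward hδ
    refine ⟨hδ, ε, hε, (wordMap_comp_along hδ).ext (c.comp_wordMap_along hε) fun w => ?_⟩
    rw [LinearMap.comp_apply, LinearMap.comp_apply, ιInv_wordMap, e, ← sub_eq_zero, ← map_sub,
      ← map_sub, ← map_sub]
    exact h0 _ (by rw [map_sub, c.wordMap_wordMap, sub_self])

/-- On the kernel of `f`, the image under `f` of a coderivation whose corestriction vanishes on the
shorter words of the kernel is its corestriction. -/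
theorem wordMap_coder_eq {p : ℤ} {δ : Module.End k (TensorAlgebra k V.carrier)}
    (hδ : δ ∈ coder V.gr p) {n : ℕ}
    (h0 : ∀ w ∈ lenLT k V.carrier n, wordMap f w = 0 → f (ιInv (δ w)) = 0)
    {w : TensorAlgebra k V.carrier} (hw : w ∈ lenLT k V.carrier (n + 1)) (hfw : wordMap f w = 0) :
    wordMap f (δ w) = ι k (f (ιInv (δ w))) := by
  obtain ⟨ε, hε, e⟩ := c.exists_pushforward hδ
  have h1 := ((wordMap_comp_along hδ).sub (c.comp_wordMap_along hε)).eq_of_vanish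
    (fun w hw => by
      rw [LinearMap.sub_apply, map_sub, LinearMap.comp_apply, LinearMap.comp_apply, ιInv_wordMap, e,
        ← map_sub, ← map_sub, ← map_sub]
      exact h0 _ (Submodule.sub_mem _ hw (wordMap_mem_lenLT s (wordMap_mem_lenLT f hw)))
        (by rw [map_sub, c.wordMap_wordMap, sub_self])) hw
  rw [LinearMap.sub_apply, LinearMap.comp_apply, LinearMap.comp_apply, hfw, map_zero, sub_zero,
    ιInv_wordMap] at h1
  exact h1

theorem f_comm {p : ℤ} {δ : Module.End k (TensorAlgebra k V.carrier)}
    (w : TensorAlgebra k V.carrier) : f (ιInv (V.comm p δ w)) =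
      ιInv (A.D (wordMap f (δ w))) - koszulSign k p • f (ιInv (δ (V.D w))) := by
  rw [comm_apply, map_sub, map_sub, map_smul, map_smul, ← ιInv_wordMap f (V.D _), c.f_D_apply]

/-- The kernel of the projection to the coderivations of `A` is acyclic: a cocycle in the kernel is
a boundary, by successive approximation with the homotopy `δ ↦ h ∘ δ` on corestrictions. -/
theorem exists_comm_eq_of_ker {p : ℤ} {δ : Module.End k (TensorAlgebra k V.carrier)}
    (hδ : δ ∈ coder V.gr (p + 1)) (hd : V.comm (p + 1) δ = 0) (h0 : ∀ w, f (ιInv (δ w)) = 0) :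
    ∃ η ∈ coder V.gr p, (∀ w, f (ιInv (η w)) = 0) ∧ V.comm p η = δ := by
  obtain ⟨η, hη, hη0, hlim⟩ := exists_sub_comm (p := p) (N := LinearMap.ker f)
    (G := fun n δ => V.comm (p + 1) δ = 0 ∧ (∀ w, f (ιInv (δ w)) = 0) ∧
      ∀ w ∈ lenLT k V.carrier n, ιInv (δ w) = 0)
    (fun n δ hδ ⟨hd, h0, hn⟩ => by
      have hmem : ∀ q, ∀ w ∈ wordGr V.gr q, (h ∘ₗ ιInv ∘ₗ δ) w ∈ V.gr (q + p) := fun q w hw => by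
        have := c.h_mem (ιInv_coder_mem hδ q w hw)
        rwa [show q + (p + 1) - 1 = q + p by ring] at this
      have hφn : ∀ w ∈ lenLT k V.carrier n, (h ∘ₗ ιInv ∘ₗ δ) w = 0 := fun w hw => by
        rw [LinearMap.comp_apply, LinearMap.comp_apply, hn w hw, map_zero]
      refine ⟨h ∘ₗ ιInv ∘ₗ δ, hmem, fun w => c.f_h _, hφn, ?_, fun w => ?_, fun w hw => ?_⟩
      all_goals set η := coderOf (letterSign V.gr p) (h ∘ₗ ιInv ∘ₗ δ) with hηdef
      all_goals have hη : η ∈ coder V.gr p := coderOf_mem hmem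
      all_goals have hι : ∀ w, ιInv (η w) = h (ιInv (δ w)) := ιInv_coderOf _ _
      · rw [map_sub, hd, comm_comm hη, sub_zero]
      · have h1 : wordMap f ∘ₗ η = 0 := (wordMap_comp_along hη).ext
          (by simp [IsCoderAlong]) fun w => by
            rw [LinearMap.comp_apply, ιInv_wordMap, hι, c.f_h, LinearMap.zero_apply, map_zero]
        have h2 := LinearMap.congr_fun h1 w
        rw [LinearMap.comp_apply, LinearMap.zero_apply] at h2
        rw [LinearMap.sub_apply, map_sub, map_sub, h0, c.f_comm, h2, hι, c.f_h, map_zero, map_zero,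
          smul_zero, sub_zero, sub_zero]
      · have h1 : η w = ι k (h (ιInv (δ w))) := by
          rw [← hι]
          exact (coder_along hη).eq_of_vanish (fun w hw => (hι w).trans (hφn w hw)) hw
        have h2 : δ w = ι k (ιInv (δ w)) := (coder_along hδ).eq_of_vanish hn hw
        have h3 := congrArg (fun ψ => h (ιInv (ψ w))) hd
        simp only [comm_apply, LinearMap.zero_apply, map_zero] at h3
        rw [h2, V.D_ι, map_sub, ιInv_ι, map_smul, map_sub, map_smul, koszulSign_add,
          koszulSign_one, mul_neg_one, neg_smul, sub_neg_eq_add] at h3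
        have h4 := c.homotopy (ιInv (δ w))
        rw [h0, map_zero, sub_zero] at h4
        rw [LinearMap.sub_apply, map_sub, comm_apply, map_sub, map_smul, hι, h1, V.D_ι, ιInv_ι,
          sub_eq_zero]
        nth_rw 1 [← h4]
        rw [← sub_eq_zero, ← h3]
        abel)
    hδ ⟨hd, h0, fun w hw => by
      rw [lenLT_zero, Submodule.mem_bot] at hw
      rw [hw, map_zero, map_zero]⟩
  refine ⟨η, hη, hη0, (coder_along (comm_mem hη)).ext (coder_along hδ) fun w => ?_⟩
  obtain ⟨n, hn⟩ := exists_mem_lenLT w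
  obtain ⟨δ', ⟨-, -, h1⟩, h2⟩ := hlim n
  have := h1 w hn
  rw [← h2 w hn, LinearMap.sub_apply, map_sub, sub_eq_zero] at this
  exact this.symm

/-- A coderivation whose boundary is projectable is projectable up to a boundary, by successive
approximation with the homotopy `δ ↦ ± s f δ H` on corestrictions, where `H` is the homotopy on
words. -/
theorem exists_sub_comm_mem_projectable {p : ℤ} {δ : Module.End k (TensorAlgebra k V.carrier)}
    (hδ : δ ∈ coder V.gr (p + 1)) (hd : V.comm (p + 1) δ ∈ projectable A f (p + 1 + 1)) :
    ∃ η ∈ coder V.gr p, δ - V.comm p η ∈ projectable A f (p + 1) := by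
  let H := wordHomotopy (s ∘ₗ f) h
  have hH : ∀ w, wordMap f (H w) = 0 := c.wordMap_wordHomotopy
  have hHn : ∀ {n w}, w ∈ lenLT k V.carrier n → H w ∈ lenLT k V.carrier n :=
    fun hw => wordHomotopy_mem_lenLT hw
  obtain ⟨η, hη, -, hlim⟩ := exists_sub_comm (p := p) (N := ⊤)
    (G := fun n δ => (∀ w, wordMap f w = 0 → f (ιInv (V.comm (p + 1) δ w)) = 0) ∧
      ∀ w ∈ lenLT k V.carrier n, wordMap f w = 0 → f (ιInv (δ w)) = 0)
    (fun n δ hδ ⟨hd, hn⟩ => by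
      let φ : TensorAlgebra k V.carrier →ₗ[k] V.carrier :=
        koszulSign k (p + 1) • (s ∘ₗ f ∘ₗ ιInv ∘ₗ δ ∘ₗ H)
      have hφ : ∀ w, φ w = koszulSign k (p + 1) • s (f (ιInv (δ (H w)))) := fun w => rfl
      have hmem : ∀ q, ∀ w ∈ wordGr V.gr q, φ w ∈ V.gr (q + p) := fun q w hw => by
        have := c.s_mem (c.f_mem (ιInv_coder_mem hδ _ _ (c.wordHomotopy_mem hw)))
        rw [show q - 1 + (p + 1) = q + p by ring] at this
        exact Submodule.smul_mem _ _ this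
      have hφn : ∀ w ∈ lenLT k V.carrier n, φ w = 0 := fun w hw => by
        rw [hφ, hn _ (hHn hw) (hH w), map_zero, smul_zero]
      refine ⟨φ, hmem, fun _ => trivial, hφn, fun w hw => ?_, fun w hw hfw => ?_⟩
      all_goals set η := coderOf (letterSign V.gr p) φ with hηdef
      all_goals have hη : η ∈ coder V.gr p := coderOf_mem hmem
      all_goals have hι : ∀ w, ιInv (η w) = φ w := ιInv_coderOf _ _
      · rw [map_sub, comm_comm hη, sub_zero, hd w hw]
      · have hfφ : ∀ w, f (φ w) = koszulSign k (p + 1) • f (ιInv (δ (H w))) := fun w => by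
          rw [hφ, map_smul, c.f_s]
        have h1 : wordMap f (η w) = ι k (f (φ w)) := by
          rw [← hι]
          exact c.wordMap_coder_eq hη (fun w hw _ => by rw [hι, hφn w hw, map_zero]) hw hfw
        have h2 := hd _ (hH w)
        rw [c.f_comm, c.wordMap_coder_eq hδ hn (hHn hw) (hH w), A.D_ι, ιInv_ι, sub_eq_zero] at h2
        -- up to shorter words, `H` is a homotopy from the identity to zero on the kernel of `f`
        have h3 : V.D (H w) + H (V.D w) - w ∈ lenLT k V.carrier n := by
          have e := c.linD_wordHomotopy w
          rw [hfw, map_zero, sub_zero] at e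
          have e1 := D_sub_linD_mem (hHn hw)
          have e2 := hHn (D_sub_linD_mem hw)
          have : V.D (H w) + H (V.D w) - w =
              (V.D (H w) - V.linD (H w)) + H (V.D w - V.linD w) := by
            rw [map_sub]
            nth_rw 3 [← e]
            change _ - (V.linD (H w) + H (V.linD w)) = _
            abel
          rw [this]
          exact Submodule.add_mem _ e1 e2
        have h4 := hn _ h3 (by
          rw [map_sub, map_add, c.f_D_apply, hH, hH, hfw, map_zero, add_zero, sub_zero])
        rw [map_sub, map_sub, map_sub, map_add, map_add, map_add, sub_eq_zero] at h4
        rw [LinearMap.sub_apply, map_sub, map_sub, c.f_comm, h1, A.D_ι, ιInv_ι, hι, hfφ, hfφ,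
          map_smul, h2, smul_smul, koszulSign_sq, one_smul, smul_smul, koszulSign_add,
          koszulSign_one, mul_neg_one, mul_neg, koszulSign_sq, ← h4]
        module)
    hδ ⟨((c.mem_projectable_iff).1 hd).2, fun w hw _ => by
      rw [lenLT_zero, Submodule.mem_bot] at hw
      rw [hw, map_zero, map_zero, map_zero]⟩
  refine ⟨η, hη, c.mem_projectable_iff.2 ⟨Submodule.sub_mem _ hδ (comm_mem hη), fun w hw => ?_⟩⟩
  obtain ⟨n, hn⟩ := exists_mem_lenLT w
  obtain ⟨δ', ⟨-, h1⟩, h2⟩ := hlim n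
  rw [h2 w hn]
  exact h1 w hn hw

/-- Projection of coderivations along `f`, by means of the section. -/
noncomputable def project (f : V.carrier →ₗ[k] A.carrier) (s : A.carrier →ₗ[k] V.carrier) :
    Module.End k (TensorAlgebra k V.carrier) →ₗ[k] Module.End k (TensorAlgebra k A.carrier) :=
  LinearMap.lcomp k _ (wordMap s) ∘ₗ LinearMap.compRight k (wordMap f)

theorem project_eq {δ : Module.End k (TensorAlgebra k V.carrier)}
    {ε : Module.End k (TensorAlgebra k A.carrier)} (e : wordMap f ∘ₗ δ = ε ∘ₗ wordMap f) :
    project f s δ = ε := LinearMap.ext fun w => by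
  have := LinearMap.congr_fun e (wordMap s w)
  rw [LinearMap.comp_apply, LinearMap.comp_apply, c.wordMap_wordMap] at this
  exact this

open InternalComplex OperatorLie

theorem isLieMap_project : IsLieMap (projectableLie f c.f_D) A.coderLie (project f s) where
  map_mem := by
    rintro p δ ⟨-, ε, hε, e⟩
    change project f s δ ∈ coder A.gr p
    rwa [c.project_eq e]
  map_mul := by
    rintro p q δ δ' ⟨-, ε, -, e⟩ ⟨-, ε', -, e'⟩
    exact (c.project_eq (comp_mul_eq e e')).trans
      (congrArg₂ (· * ·) (c.project_eq e).symm (c.project_eq e').symm)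
  map_D := c.project_eq c.f_D

theorem isQuasiIso_project : IsQuasiIso (projectableLie f c.f_D).complex A.coderLie.complex
    (project f s) := by
  refine (IsAcyclicFibration.of_acyclic_ker c.isLieMap_project.isChainMap
    (fun {p} (ε : Module.End k (TensorAlgebra k A.carrier)) hε => ?_)
    fun p (δ : Module.End k (TensorAlgebra k V.carrier)) hδ hd h0 => ?_).quasiIso
  · have hε' : ε ∈ coder A.gr p := hε
    have hmem : coderOf (letterSign V.gr p) (s ∘ₗ ιInv ∘ₗ ε ∘ₗ wordMap f) ∈ coder V.gr p :=
      coderOf_mem fun q w hw => c.s_mem (ιInv_coder_mem hε' q _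
        (wordMap_mem_wordGr (fun ha => c.f_mem ha) hw))
    have e := (wordMap_comp_along hmem).ext (c.comp_wordMap_along hε') fun w => by
      rw [LinearMap.comp_apply, ιInv_wordMap, ιInv_coderOf]
      exact c.f_s _
    exact ⟨_, ⟨hmem, ε, hε', e⟩, c.project_eq e⟩
  · obtain ⟨hδ', ε, hε, e⟩ := hδ
    have hε0 : ε = 0 := (c.project_eq e).symm.trans h0
    rw [hε0, LinearMap.zero_comp] at e
    obtain ⟨η, hη, hη0, hηd⟩ := c.exists_comm_eq_of_ker hδ' hd fun w => by
      have := LinearMap.congr_fun e w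
      rw [LinearMap.comp_apply] at this
      rw [← ιInv_wordMap, this, LinearMap.zero_apply, map_zero]
    have e0 : wordMap f ∘ₗ η = 0 ∘ₗ wordMap f :=
      (wordMap_comp_along hη).ext (c.comp_wordMap_along (Submodule.zero_mem _)) fun w => by
        rw [LinearMap.comp_apply, ιInv_wordMap, hη0, LinearMap.comp_apply, LinearMap.zero_apply,
          map_zero]
    exact ⟨η, ⟨hη, 0, Submodule.zero_mem _, e0⟩, c.project_eq e0, hηd⟩

omit c in
theorem isLieMap_id (hf : wordMap f ∘ₗ V.D = A.D ∘ₗ wordMap f) :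
    IsLieMap (projectableLie f hf) V.coderLie LinearMap.id :=
  ⟨fun h => h.1, fun _ _ => rfl, rfl⟩

theorem isQuasiIso_id :
    IsQuasiIso (projectableLie f c.f_D).complex V.coderLie.complex LinearMap.id := by
  refine ⟨fun p (δ : Module.End k (TensorAlgebra k V.carrier)) hδ hd
    (η : Module.End k (TensorAlgebra k V.carrier)) hη e => ?_,
    fun p (δ : Module.End k (TensorAlgebra k V.carrier)) hδ hd => ?_⟩
  · obtain ⟨p, rfl⟩ : ∃ q, p = q + 1 := ⟨p - 1, by ring⟩
    have e' : V.comm (p + 1) η = δ := e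
    obtain ⟨θ, hθ, hmem⟩ := c.exists_sub_comm_mem_projectable hη (e' ▸ hδ)
    refine ⟨η - V.comm p θ, hmem, ?_⟩
    change V.comm (p + 1) (η - V.comm p θ) = δ
    rw [map_sub, e', comm_comm hθ, sub_zero]
  · have hd' : V.comm (p + 1) δ = 0 := hd
    obtain ⟨θ, hθ, hmem⟩ := c.exists_sub_comm_mem_projectable hδ
      (hd' ▸ Submodule.zero_mem _)
    refine ⟨δ - V.comm p θ, hmem, ?_, -θ, Submodule.neg_mem _ hθ, ?_⟩
    · change V.comm (p + 1) (δ - V.comm p θ) = 0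
      rw [map_sub, hd', comm_comm hθ, sub_zero]
    · change V.comm p (-θ) = δ - V.comm p θ - δ
      rw [map_neg]
      abel

/-- A strict morphism which is a contraction induces a zigzag of quasi-isomorphisms between the dg
Lie algebras of coderivations. -/
theorem quasiIsomorphic :
    DGLieAlgebra.QuasiIsomorphic V.coderLie.toLie A.coderLie.toLie :=
  (((isLieMap_id c.f_D).quasiIsomorphic c.isQuasiIso_id).symm).trans _ _ _
    (c.isLieMap_project.quasiIsomorphic c.isQuasiIso_project)

end IsContraction

end AInfinityAlgebra

/-! ### Cofibrant replacement of complexes -/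

namespace InternalComplex

variable {k : Type u} [CommRing k] {L M N : InternalComplex k}

theorem IsAcyclicFibration.comp {f : M.carrier →ₗ[k] N.carrier} {g : L.carrier →ₗ[k] M.carrier}
    (hf : IsAcyclicFibration M N f) (hg : IsAcyclicFibration L M g) :
    IsAcyclicFibration L N (f ∘ₗ g) := by
  refine .of_acyclic_ker ⟨fun hx => hf.map_mem (hg.map_mem hx), fun hx => ?_⟩ (fun z hz => ?_)
    fun i x hx hdx h0 => ?_
  · rw [LinearMap.comp_apply, hg.map_d hx, hf.map_d (hg.map_mem hx)]
    rfl
  · obtain ⟨y, hy, rfl⟩ := hf.surj z hz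
    obtain ⟨x, hx, rfl⟩ := hg.surj y hy
    exact ⟨x, hx, rfl⟩
  · obtain ⟨y, hy, hy0, hyd⟩ := hf.acyclic_ker (hg.map_mem hx)
      (by rw [← hg.map_d hx, hdx, map_zero]) h0
    obtain ⟨x₁, hx₁, rfl⟩ := hg.surj y hy
    obtain ⟨x₂, hx₂, h2, hd₂⟩ := hg.acyclic_ker (x := x - L.d i x₁)
      (Submodule.sub_mem _ hx (L.d_mem hx₁)) (by rw [map_sub, hdx, L.d_d hx₁, sub_zero])
      (by rw [map_sub, hg.map_d hx₁, hyd, sub_self])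
    exact ⟨x₂ + x₁, Submodule.add_mem _ hx₂ hx₁,
      by rw [LinearMap.comp_apply, map_add, map_add, h2, hy0, map_zero, zero_add],
      by rw [map_add, hd₂, sub_add_cancel]⟩

/-- A section of an acyclic fibration is a quasi-isomorphism. -/
theorem IsAcyclicFibration.section {p : M.carrier →ₗ[k] N.carrier}
    (hp : IsAcyclicFibration M N p) {s : N.carrier →ₗ[k] M.carrier} (hs : IsChainMap N M s)
    (hps : ∀ x, p (s x) = x) : IsQuasiIso N M s := by
  refine ⟨fun i x hx _ y hy e => ⟨p y, hp.map_mem hy, ?_⟩, fun i y hy hdy => ?_⟩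
  · rw [← hp.map_d hy, e, hps]
  · have hpy : N.d (i + 1) (p y) = 0 := by rw [← hp.map_d hy, hdy, map_zero]
    obtain ⟨y', hy', -, e⟩ := hp.acyclic_ker (x := s (p y) - y)
      (Submodule.sub_mem _ (hs.map_mem (hp.map_mem hy)) hy)
      (by rw [map_sub, ← hs.map_d (hp.map_mem hy), hpy, map_zero, hdy, sub_zero])
      (by rw [map_sub, hps, sub_self])
    exact ⟨p y, hp.map_mem hy, hpy, y', hy', e⟩

end InternalComplex

section Decomposition

variable {k : Type u} [CommRing k] {M : Type u} [AddCommGroup M] [Module k M]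

/-- A grading is determined by the projections to its components. -/
theorem isInternal_of_projections {gr : ℤ → Submodule k M} (π : ℤ → M →ₗ[k] M)
    (h1 : ∀ i, ∀ x ∈ gr i, π i x = x) (h0 : ∀ i j, i ≠ j → ∀ x ∈ gr i, π j x = 0)
    (htop : (⨆ i, gr i) = ⊤) : DirectSum.IsInternal gr := by
  refine (DirectSum.isInternal_submodule_iff_iSupIndep_and_iSup_eq_top _).2 ⟨fun i => ?_, htop⟩
  rw [disjoint_iff_inf_le]
  rintro x ⟨hx, hx'⟩
  have h : (⨆ j, ⨆ (_ : j ≠ i), gr j) ≤ LinearMap.ker (π i) :=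
    iSup₂_le fun j hj y hy => h0 j i hj y hy
  rw [Submodule.mem_bot, ← h1 i x hx]
  exact h hx'

end Decomposition

namespace DGModule

open InternalComplex

variable {k : Type u} [CommRing k] (A Z : DGModule k)

/-- The free module on the homogeneous elements of `Z`. -/
abbrev Gen : Type u := (Σ i : ℤ, Z.gr i) →₀ k

/-- The free module on the homogeneous elements of degree `i`. -/
noncomputable def genGr (i : ℤ) : Submodule k Z.Gen := Finsupp.supported k k {x | x.1 = i}

variable {Z} in
theorem genGr_eq {i : ℤ} {N : Type u} [AddCommGroup N] [Module k N] {f g : Z.Gen →ₗ[k] N}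
    (h : ∀ z : Z.gr i, f (Finsupp.single ⟨i, z⟩ 1) = g (Finsupp.single ⟨i, z⟩ 1)) {x : Z.Gen}
    (hx : x ∈ Z.genGr i) : f x = g x := by
  rw [genGr, Finsupp.supported_eq_span_single] at hx
  refine (show _ ≤ LinearMap.eqLocus f g from Submodule.span_le.2 ?_) hx
  rintro _ ⟨⟨_, z⟩, rfl, rfl⟩
  exact h z

variable {Z} in
theorem genGr_le {i : ℤ} {N : Type u} [AddCommGroup N] [Module k N] {f : Z.Gen →ₗ[k] N}
    {S : Submodule k N} (h : ∀ z : Z.gr i, f (Finsupp.single ⟨i, z⟩ 1) ∈ S) {x : Z.Gen}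
    (hx : x ∈ Z.genGr i) : f x ∈ S := by
  rw [genGr, Finsupp.supported_eq_span_single] at hx
  refine (show _ ≤ S.comap f from Submodule.span_le.2 ?_) hx
  rintro _ ⟨⟨_, z⟩, rfl, rfl⟩
  exact h z

theorem single_mem_genGr {i : ℤ} (z : Z.gr i) (r : k) :
    Finsupp.single ⟨i, z⟩ r ∈ Z.genGr i := Finsupp.single_mem_supported k r rfl

/-- The grading of the sum of `A` with the cone on the free module on the homogeneous elements
of `Z`. -/
noncomputable def coneGr (i : ℤ) : Submodule k (A.carrier × Z.Gen × Z.Gen) :=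
  (A.gr i).prod ((Z.genGr i).prod (Z.genGr (i - 1)))

theorem isInternal_coneGr : DirectSum.IsInternal (A.coneGr Z) := by
  let πA : ℤ → A.carrier →ₗ[k] A.carrier := fun i =>
    (A.gr i).subtype ∘ₗ DirectSum.component k ℤ (fun i => A.gr i) i ∘ₗ
      (DirectSum.decomposeLinearEquiv A.gr).toLinearMap
  let πZ : ℤ → Z.Gen →ₗ[k] Z.Gen := fun i =>
    Finsupp.linearCombination k fun x => if x.1 = i then Finsupp.single x 1 else 0
  have hA : ∀ i a, πA i a = DirectSum.decompose A.gr a i := fun i a => rfl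
  have hZ1 : ∀ i, ∀ x ∈ Z.genGr i, πZ i x = x := fun i x hx =>
    genGr_eq (g := LinearMap.id) (fun z => by simp [πZ]) hx
  have hZ0 : ∀ i j, i ≠ j → ∀ x ∈ Z.genGr i, πZ j x = 0 := fun i j hij x hx =>
    genGr_eq (g := 0) (fun z => by simp [πZ, hij]) hx
  refine isInternal_of_projections
    (fun i => (πA i).prodMap ((πZ i).prodMap (πZ (i - 1)))) ?_ ?_ ?_
  · rintro i ⟨a, x, y⟩ ⟨ha, hx, hy⟩
    refine Prod.ext ?_ (Prod.ext (hZ1 i x hx) (hZ1 (i - 1) y hy))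
    exact (hA i a).trans (DirectSum.decompose_of_mem_same A.gr ha)
  · rintro i j hij ⟨a, x, y⟩ ⟨ha, hx, hy⟩
    refine Prod.ext ?_ (Prod.ext (hZ0 i j hij x hx) (hZ0 _ _ (by omega) y hy))
    exact (hA j a).trans (DirectSum.decompose_of_mem_ne A.gr ha hij)
  · have hzero : ∀ i, (0 : Z.Gen) ∈ Z.genGr i := fun i => Submodule.zero_mem _
    rw [eq_top_iff]
    rintro ⟨a, x, y⟩ -
    have e : ((a, x, y) : A.carrier × Z.Gen × Z.Gen) = (a, 0, 0) + (0, x, 0) + (0, 0, y) := by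
      simp
    rw [e]
    refine Submodule.add_mem _ (Submodule.add_mem _ ?_ ?_) ?_
    · induction a using homogeneous_induction A.gr with
      | hom i a ha => exact Submodule.mem_iSup_of_mem i ⟨ha, hzero _, hzero _⟩
      | add a b ha hb =>
        have := Submodule.add_mem _ (ha (by simp)) (hb (by simp))
        simpa using this
    · induction x using Finsupp.induction_linear with
      | zero => exact Submodule.zero_mem _
      | add x y hx hy =>
        have := Submodule.add_mem _ (hx (by simp)) (hy (by simp))
        simpa using this
      | single s r =>
        exact Submodule.mem_iSup_of_mem s.1
          ⟨Submodule.zero_mem _, Z.single_mem_genGr s.2 r, hzero _⟩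
    · induction y using Finsupp.induction_linear with
      | zero => exact Submodule.zero_mem _
      | add x y hx hy =>
        have := Submodule.add_mem _ (hx (by simp)) (hy (by simp))
        simpa using this
      | single s r =>
        refine Submodule.mem_iSup_of_mem (s.1 + 1) ⟨Submodule.zero_mem _, hzero _, ?_⟩
        rw [add_sub_cancel_right]
        exact Z.single_mem_genGr s.2 r

/-- The sum of `A` with the cone on the free module on the homogeneous elements of `Z`. -/
noncomputable def addCone : DGModule k where
  carrier := A.carrier × Z.Gen × Z.Gen
  gr := A.coneGr Z
  decomposition := (A.isInternal_coneGr Z).chooseDecomposition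
  b := A.b.prodMap (LinearMap.inr k Z.Gen Z.Gen ∘ₗ LinearMap.fst k Z.Gen Z.Gen)
  b_mem := by
    rintro i ⟨a, x, y⟩ ⟨ha, hx, hy⟩
    refine ⟨A.b_mem ha, Submodule.zero_mem _, ?_⟩
    rw [add_sub_cancel_right]
    exact hx
  b_b := by
    rintro ⟨a, x, y⟩
    exact Prod.ext (A.b_b a) rfl

variable {A Z}

theorem isCofibrant_addCone (hA : A.complex.IsCofibrant) : (A.addCone Z).complex.IsCofibrant := by
  intro M N q hq g₀ hg
  let g : A.carrier × Z.Gen × Z.Gen →ₗ[k] N.carrier := g₀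
  obtain ⟨lA, hlA, eA⟩ : ∃ l : A.carrier →ₗ[k] M.carrier, IsChainMap A.complex M l ∧
      ∀ a, q (l a) = g (a, 0, 0) :=
    hA q hq (g ∘ₗ LinearMap.inl k A.carrier (Z.Gen × Z.Gen))
      ⟨fun {i a} ha => hg.map_mem (x := ((a, 0, 0) : A.carrier × Z.Gen × Z.Gen))
        ⟨ha, Submodule.zero_mem _, Submodule.zero_mem _⟩,
      fun {i a} ha => hg.map_d (x := ((a, 0, 0) : A.carrier × Z.Gen × Z.Gen))
        ⟨ha, Submodule.zero_mem _, Submodule.zero_mem _⟩⟩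
  have hmem : ∀ x : Σ i, Z.gr i, ((0, Finsupp.single x 1, 0) : A.carrier × Z.Gen × Z.Gen) ∈
      A.coneGr Z x.1 := fun x =>
    ⟨Submodule.zero_mem _, Z.single_mem_genGr x.2 1, Submodule.zero_mem _⟩
  choose m hm em using show ∀ x : Σ i, Z.gr i, ∃ y ∈ M.gr x.1, q y = g (0, Finsupp.single x 1, 0)
    from fun x => hq.surj _ (hg.map_mem (hmem x))
  let l₁ : Z.Gen →ₗ[k] M.carrier := Finsupp.linearCombination k m
  let l₂ : Z.Gen →ₗ[k] M.carrier := Finsupp.linearCombination k fun x => M.d x.1 (m x)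
  have h1 : ∀ x, l₁ (Finsupp.single x 1) = m x := fun x => by simp [l₁]
  have h2 : ∀ x, l₂ (Finsupp.single x 1) = M.d x.1 (m x) := fun x => by simp [l₂]
  have hd1 : ∀ i, ∀ x ∈ Z.genGr i, M.d i (l₁ x) = l₂ x := fun i x hx =>
    genGr_eq (f := M.d i ∘ₗ l₁) (fun z => by rw [LinearMap.comp_apply, h1, h2]) hx
  have hd2 : ∀ i, ∀ x ∈ Z.genGr i, M.d (i + 1) (l₂ x) = 0 := fun i x hx =>
    genGr_eq (f := M.d (i + 1) ∘ₗ l₂) (g := 0)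
      (fun z => by rw [LinearMap.comp_apply, h2]; exact M.d_d (hm ⟨i, z⟩)) hx
  have hm1 : ∀ i, ∀ x ∈ Z.genGr i, l₁ x ∈ M.gr i := fun i x hx =>
    genGr_le (fun z => by rw [h1]; exact hm ⟨i, z⟩) hx
  have hm2 : ∀ i, ∀ x ∈ Z.genGr i, l₂ x ∈ M.gr (i + 1) := fun i x hx =>
    genGr_le (fun z => by rw [h2]; exact M.d_mem (hm ⟨i, z⟩)) hx
  let l : A.carrier × Z.Gen × Z.Gen →ₗ[k] M.carrier := lA.coprod (l₁.coprod l₂)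
  have hl : ∀ a x y, l (a, x, y) = lA a + (l₁ x + l₂ y) := fun a x y => by simp [l]
  refine ⟨l, ⟨?_, ?_⟩, ?_⟩
  · rintro i ⟨a, x, y⟩ ⟨ha, hx, hy⟩
    have := hm2 _ _ hy
    rw [sub_add_cancel] at this
    have h3 : l (a, x, y) ∈ M.gr i := by
      rw [hl]
      exact Submodule.add_mem _ (hlA.map_mem ha) (Submodule.add_mem _ (hm1 i x hx) this)
    exact h3
  · rintro i ⟨a, x, y⟩ ⟨ha, hx, hy⟩
    have h3 := hd2 _ _ hy
    rw [sub_add_cancel] at h3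
    have h4 : lA (A.b a) = M.d i (lA a) := hlA.map_d ha
    change l (A.b a, 0, x) = M.d i (l (a, x, y))
    rw [hl, hl, map_add, map_add, h3, hd1 i x hx, h4, map_zero]
    abel
  · have e1 : ∀ x, q (l₁ x) = g (0, x, 0) := fun x => by
      have : q ∘ₗ l₁ = g ∘ₗ LinearMap.inr k A.carrier (Z.Gen × Z.Gen) ∘ₗ
          LinearMap.inl k Z.Gen Z.Gen := by
        refine Finsupp.lhom_ext' fun x => LinearMap.ext_ring ?_
        exact (congrArg q (h1 x)).trans (em x)
      exact LinearMap.congr_fun this x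
    have e2 : ∀ y, q (l₂ y) = g (0, 0, y) := fun y => by
      have : q ∘ₗ l₂ = g ∘ₗ LinearMap.inr k A.carrier (Z.Gen × Z.Gen) ∘ₗ
          LinearMap.inr k Z.Gen Z.Gen := by
        refine Finsupp.lhom_ext' fun x => LinearMap.ext_ring ?_
        have e3 : g (A.b 0, 0, Finsupp.single x 1) =
          N.d x.1 (g (0, Finsupp.single x 1, 0)) := hg.map_d (hmem x)
        rw [map_zero] at e3
        refine (congrArg q (h2 x)).trans ((hq.map_d (hm x)).trans ?_)
        exact (congrArg (N.d x.1) (em x)).trans e3.symm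
      exact LinearMap.congr_fun this y
    rintro ⟨a, x, y⟩
    have e3 : ((a, x, y) : A.carrier × Z.Gen × Z.Gen) = (a, 0, 0) + ((0, x, 0) + (0, 0, y)) := by
      simp
    refine (congrArg q (hl a x y)).trans ?_
    rw [map_add, map_add, eA, e1, e2, ← map_add, ← map_add, ← e3]
    rfl

/-- If `Z` has an acyclic fibration to a cofibrant complex, then it also receives one from a
cofibrant complex. -/
theorem exists_cofibrant (hA : A.complex.IsCofibrant) {p : Z.carrier →ₗ[k] A.carrier}
    (hp : IsAcyclicFibration Z.complex A.complex p) :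
    ∃ (V : DGModule k) (f : V.carrier →ₗ[k] Z.carrier), V.complex.IsCofibrant ∧
      IsAcyclicFibration V.complex Z.complex f := by
  obtain ⟨s, hs, hps⟩ : ∃ s : A.carrier →ₗ[k] Z.carrier, IsChainMap A.complex Z.complex s ∧
      ∀ a, p (s a) = a := hA (M := Z.complex) (N := A.complex) p hp LinearMap.id (.id _)
  have hq := hp.section hs hps
  let ε : Z.Gen →ₗ[k] Z.carrier := Finsupp.linearCombination k fun x => x.2.1
  have hε : ∀ i, ∀ x ∈ Z.genGr i, ε x ∈ Z.gr i := fun i x hx =>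
    genGr_le (fun z => by simp [ε]) hx
  let f : A.carrier × Z.Gen × Z.Gen →ₗ[k] Z.carrier := s.coprod (ε.coprod (Z.b ∘ₗ ε))
  have hf : ∀ a x y, f (a, x, y) = s a + (ε x + Z.b (ε y)) := fun a x y => by simp [f]
  refine ⟨A.addCone Z, f, isCofibrant_addCone hA, ⟨?_, ?_⟩,
    fun {i} (z : Z.carrier) (hz : z ∈ Z.gr i) => ?_, ?_, ?_⟩
  · rintro i ⟨a, x, y⟩ ⟨ha, hx, hy⟩
    have := Z.b_mem (hε _ _ hy)
    rw [sub_add_cancel] at this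
    have h3 : f (a, x, y) ∈ Z.gr i := by
      rw [hf]
      exact Submodule.add_mem _ (hs.map_mem ha) (Submodule.add_mem _ (hε i x hx) this)
    exact h3
  · rintro i ⟨a, x, y⟩ ⟨ha, hx, hy⟩
    have h : s (A.b a) = Z.b (s a) := hs.map_d ha
    change f (A.b a, 0, x) = Z.b (f (a, x, y))
    rw [hf, hf, map_add, map_add, Z.b_b, h, map_zero]
    abel
  · refine ⟨(0, Finsupp.single ⟨i, z, hz⟩ 1, 0),
      ⟨Submodule.zero_mem _, Z.single_mem_genGr ⟨z, hz⟩ 1, Submodule.zero_mem _⟩, ?_⟩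
    exact (hf _ _ _).trans (by simp [ε])
  · rintro i ⟨a, x, y⟩ ⟨ha, hx, hy⟩ hd (z : Z.carrier) (hz : z ∈ Z.gr i) e
    have ha0 : A.b a = 0 := congrArg Prod.fst hd
    obtain rfl : x = 0 := congrArg (fun v => v.2.2) hd
    have hy' : y ∈ Z.genGr i := by
      have := hy
      rwa [add_sub_cancel_right] at this
    have e' : Z.b z = s a + (ε 0 + Z.b (ε y)) := Eq.trans e (hf a 0 y)
    obtain ⟨a', ha', hda'⟩ : ∃ a' ∈ A.gr i, A.b a' = a :=
      hq.inj i a ha ha0 (z - ε y) (Submodule.sub_mem _ hz (hε _ _ hy')) (by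
        change Z.b (z - ε y) = s a
        rw [map_sub, e', map_zero]
        abel)
    refine ⟨(a', y, 0), ⟨ha', hy', Submodule.zero_mem _⟩, ?_⟩
    exact Prod.ext hda' rfl
  · intro i (z : Z.carrier) (hz : z ∈ Z.gr (i + 1)) hdz
    obtain ⟨a, ha, hda, z', hz', e⟩ : ∃ a ∈ A.gr (i + 1), A.b a = 0 ∧ ∃ z' ∈ Z.gr i,
        Z.b z' = s a - z := hq.surj i z hz hdz
    refine ⟨(a, 0, 0), ⟨ha, Submodule.zero_mem _, Submodule.zero_mem _⟩, Prod.ext hda rfl,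
      z', hz', ?_⟩
    exact e.trans (congrArg (· - z) ((hf a 0 0).trans (by simp)).symm)

end DGModule

/-! ### Cofibrant `A∞`-algebras -/

namespace AInfinityAlgebra

open InternalComplex

variable {k : Type u} [CommRing k] {V A : AInfinityAlgebra k}

/-- A strict acyclic fibration of `A∞`-algebras with cofibrant underlying complexes admits a
section and a homotopy. -/
theorem exists_isContraction (hV : V.toDGModule.complex.IsCofibrant)
    (hA : A.toDGModule.complex.IsCofibrant) {f : V.carrier →ₗ[k] A.carrier}
    (hf : IsAcyclicFibration V.toDGModule.complex A.toDGModule.complex f)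
    (hfD : wordMap f ∘ₗ V.D = A.D ∘ₗ wordMap f) : ∃ s h, V.IsContraction A f s h := by
  obtain ⟨s, hs, hfs⟩ : ∃ s : A.carrier →ₗ[k] V.carrier,
      IsChainMap A.toDGModule.complex V.toDGModule.complex s ∧ ∀ a, f (s a) = a :=
    hA (M := V.toDGModule.complex) (N := A.toDGModule.complex) f hf LinearMap.id (.id _)
  have hfm : ∀ {i a}, a ∈ V.gr i → f a ∈ A.gr i := fun ha => hf.map_mem ha
  have hsm : ∀ {i a}, a ∈ A.gr i → s a ∈ V.gr i := fun ha => hs.map_mem ha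
  have hsb : s ∘ₗ A.b = V.b ∘ₗ s := homogeneous_ext A.gr fun i a ha => hs.map_d ha
  have hfb : f ∘ₗ V.b = A.b ∘ₗ f := homogeneous_ext V.gr fun i a ha => hf.map_d ha
  let K : InternalComplex k :=
    { carrier := V.carrier
      gr := fun i => V.gr i ⊓ LinearMap.ker f
      d := fun _ => V.b
      d_mem := fun {i x} hx => ⟨V.b_mem hx.1, by
        have h1 : f x = 0 := hx.2
        have h2 := LinearMap.congr_fun hfb x
        rw [LinearMap.comp_apply, LinearMap.comp_apply, h1, map_zero] at h2
        exact h2⟩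
      d_d := fun _ => V.b_b _ }
  let O : InternalComplex k :=
    { carrier := PUnit, gr := fun _ => ⊤, d := fun _ => 0, d_mem := fun _ => trivial,
      d_d := fun _ => rfl }
  have hK : IsAcyclicFibration K O 0 := by
    refine .of_acyclic_ker ⟨fun _ => trivial, fun _ => rfl⟩
      (fun y _ => ⟨0, Submodule.zero_mem _, rfl⟩) fun i x hx hdx _ => ?_
    obtain ⟨x', hx', h0, e⟩ := hf.acyclic_ker hx.1 hdx hx.2
    exact ⟨x', ⟨hx', h0⟩, rfl, e⟩
  obtain ⟨h, hh, hd⟩ : ∃ h : V.carrier →ₗ[k] V.carrier,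
      (∀ i, ∀ x ∈ V.gr i, h x ∈ V.gr (i + -1) ⊓ LinearMap.ker f) ∧
      ∀ i, ∀ x ∈ V.gr i, V.b (h x) - koszulSign k (-1) • h (V.b x) = x - s (f x) := by
    obtain ⟨h, hh, -, hd⟩ := hV.lift_homotopy hK (-1) (LinearMap.id - s ∘ₗ f) 0
      (fun i (x : V.carrier) (hx : x ∈ V.gr i) => by
        rw [neg_add_cancel_right]
        refine ⟨Submodule.sub_mem _ hx (hsm (hfm hx)), ?_⟩
        change f (x - s (f x)) = 0
        rw [map_sub, hfs, sub_self])
      (fun _ _ _ => trivial)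
      (fun i (x : V.carrier) (hx : x ∈ V.gr i) => by
        have h1 := LinearMap.congr_fun hfb x
        have h2 := LinearMap.congr_fun hsb (f x)
        simp only [LinearMap.comp_apply] at h1 h2
        change V.b (x - s (f x)) + koszulSign k (-1) • (V.b x - s (f (V.b x))) = 0
        rw [koszulSign_neg, koszulSign_one, h1, h2, map_sub, neg_one_smul, add_neg_cancel])
      fun _ _ _ => rfl
    exact ⟨h, hh, hd⟩
  refine ⟨s, h, hfm, hsm, fun ha => (hh _ _ ha).1, hfD, LinearMap.congr_fun hsb, hfs,
    LinearMap.congr_fun (homogeneous_ext V.gr (f := f ∘ₗ h) (g := 0) fun i a ha => (hh i a ha).2),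
    LinearMap.congr_fun (homogeneous_ext V.gr (f := V.b ∘ₗ h + h ∘ₗ V.b)
      (g := LinearMap.id - s ∘ₗ f) fun i a ha => ?_)⟩
  have := hd i a ha
  rw [koszulSign_neg, koszulSign_one, neg_one_smul, sub_neg_eq_add] at this
  exact this

theorem quasiIsomorphic_of_acyclicFibration (hV : V.toDGModule.complex.IsCofibrant)
    (hA : A.toDGModule.complex.IsCofibrant) {f : V.carrier →ₗ[k] A.carrier}
    (hf : IsAcyclicFibration V.toDGModule.complex A.toDGModule.complex f)
    (hfD : wordMap f ∘ₗ V.D = A.D ∘ₗ wordMap f) :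
    DGLieAlgebra.QuasiIsomorphic V.coderLie.toLie A.coderLie.toLie := by
  obtain ⟨s, h, c⟩ := exists_isContraction hV hA hf hfD
  exact c.quasiIsomorphic

/-- Every `A∞`-algebra with a strict acyclic fibration to a cofibrant one also receives a strict
acyclic fibration from a cofibrant one. -/
theorem exists_cofibrant {Z : AInfinityAlgebra k} (hA : A.toDGModule.complex.IsCofibrant)
    {p : Z.carrier →ₗ[k] A.carrier}
    (hp : IsAcyclicFibration Z.toDGModule.complex A.toDGModule.complex p) :
    ∃ (V : AInfinityAlgebra k) (f : V.carrier →ₗ[k] Z.carrier),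
      V.toDGModule.complex.IsCofibrant ∧
        IsAcyclicFibration V.toDGModule.complex Z.toDGModule.complex f ∧
          wordMap f ∘ₗ V.D = Z.D ∘ₗ wordMap f := by
  obtain ⟨V, f, hV, hf⟩ := DGModule.exists_cofibrant (Z := Z.toDGModule) hA hp
  obtain ⟨D, hD, hDD, hD1, hDι, hfD⟩ := DGModule.exists_transfer (Z := Z) (f := f) hV hf
  let W : AInfinityAlgebra k :=
    { carrier := V.carrier, gr := V.gr, D := D, D_mem := hD, D_D := hDD, D_one := hD1 }
  have hb : W.b = V.b := LinearMap.ext fun a => by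
    change ιInv (D (ι k a)) = V.b a
    rw [hDι, ιInv_ι]
  have hW : W.toDGModule.complex = V.complex := by
    change InternalComplex.mk V.carrier V.gr (fun _ => W.b) _ _ =
      InternalComplex.mk V.carrier V.gr (fun _ => V.b) _ _
    simp only [hb]
  refine ⟨W, f, ?_, ?_, hfD⟩
  · rw [hW]
    exact hV
  · refine .of_acyclic_ker ⟨fun hx => hf.map_mem hx, fun {i x} hx =>
      (congrArg f (LinearMap.congr_fun hb x)).trans (hf.map_d hx)⟩ (fun y hy => hf.surj y hy)
      fun i x hx hd h0 => ?_
    obtain ⟨x', hx', h0', e⟩ := hf.acyclic_ker hx ((LinearMap.congr_fun hb x).symm.trans hd) h0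
    exact ⟨x', hx', h0', (LinearMap.congr_fun hb x').trans e⟩

/-- Two `A∞`-algebras with cofibrant underlying complexes have quasi-isomorphic dg Lie algebras of
coderivations if they are connected by a span of strict acyclic fibrations. -/
theorem quasiIsomorphic_of_span {A' Z : AInfinityAlgebra k}
    (hA : A.toDGModule.complex.IsCofibrant) (hA' : A'.toDGModule.complex.IsCofibrant)
    {p : Z.carrier →ₗ[k] A.carrier} {p' : Z.carrier →ₗ[k] A'.carrier}
    (hp : IsAcyclicFibration Z.toDGModule.complex A.toDGModule.complex p)
    (hpD : wordMap p ∘ₗ Z.D = A.D ∘ₗ wordMap p)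
    (hp' : IsAcyclicFibration Z.toDGModule.complex A'.toDGModule.complex p')
    (hpD' : wordMap p' ∘ₗ Z.D = A'.D ∘ₗ wordMap p') :
    DGLieAlgebra.QuasiIsomorphic A.coderLie.toLie A'.coderLie.toLie := by
  obtain ⟨V, f, hV, hf, hfD⟩ := exists_cofibrant hA hp
  have key : ∀ {B : AInfinityAlgebra k} {q : Z.carrier →ₗ[k] B.carrier},
      wordMap q ∘ₗ Z.D = B.D ∘ₗ wordMap q →
        wordMap (q ∘ₗ f) ∘ₗ V.D = B.D ∘ₗ wordMap (q ∘ₗ f) := fun hq => by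
    rw [← wordMap_comp, LinearMap.comp_assoc, hfD, ← LinearMap.comp_assoc, hq,
      LinearMap.comp_assoc]
  exact (quasiIsomorphic_of_acyclicFibration hV hA (hp.comp hf) (key hpD)).symm.trans _ _ _
    (quasiIsomorphic_of_acyclicFibration hV hA' (hp'.comp hf) (key hpD'))

end AInfinityAlgebra

/-! ### Homotopy pullbacks of dg algebras -/

namespace DGAlgebra

open TensorAlgebra InternalComplex

variable {k : Type u} [CommRing k] {A A' B : DGAlgebra k}

namespace Hom

/-- The linear map underlying a morphism of dg algebras. -/
abbrev lin (f : Hom A B) : A.carrier →ₗ[k] B.carrier := f.toAlgHom.toLinearMap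

theorem isChainMap (f : Hom A B) : IsChainMap A.toInternalComplex B.toInternalComplex f.lin :=
  ⟨fun h => f.map_mem h, fun {_ x} _ => f.map_d x⟩

theorem quasiIso_iff (f : Hom A B) : QuasiIso f.toComplexHom ↔
    IsQuasiIso A.toInternalComplex B.toInternalComplex f.lin :=
  f.isChainMap.quasiIso_iff

/-- The identity morphism. -/
def id (A : DGAlgebra k) : Hom A A := ⟨AlgHom.id k _, fun h => h, fun _ => rfl⟩

/-- The composition of morphisms. -/
def comp (g : Hom A' B) (f : Hom A A') : Hom A B :=
  ⟨g.toAlgHom.comp f.toAlgHom, fun h => g.map_mem (f.map_mem h), fun a => by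
    rw [AlgHom.comp_apply, f.map_d, g.map_d]
    rfl⟩

/-- A morphism which is a degreewise surjective quasi-isomorphism. -/
def IsAcyclicFibration (f : Hom A B) : Prop :=
  InternalComplex.IsAcyclicFibration A.toInternalComplex B.toInternalComplex f.lin

theorem map_letterTwist (f : Hom A B) (p : ℤ) (a : A.carrier) :
    f.lin (A.letterTwist p a) = B.letterTwist p (f.lin a) := by
  induction a using A.letter_induction with
  | hom i a ha =>
    rw [letterTwist_apply p ha, map_smul]
    exact (letterTwist_apply p (f.map_mem ha)).symm
  | add a b ha hb => simp only [map_add, ha, hb]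

/-- A morphism of dg algebras induces a morphism of bar constructions. -/
theorem wordMap_barD (f : Hom A B) : wordMap f.lin ∘ₗ A.barD = B.barD ∘ₗ wordMap f.lin := by
  have hm : ∀ a w, wordMap f.lin (A.mulHead a w) = B.mulHead (f.lin a) (wordMap f.lin w) := by
    intro a w
    induction w using word_induction with
    | one => simp [mulHead_one]
    | smul r w hw => simp only [map_smul, hw]
    | add v w hv hw => simp only [map_add, hv, hw]
    | cons b w _ =>
      rw [mulHead_ι_mul, wordMap_ι_mul, wordMap_ι_mul, mulHead_ι_mul]
      simp
  refine word_ext (by simp [barD_one]) fun a w hw => ?_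
  rw [LinearMap.comp_apply, LinearMap.comp_apply] at hw ⊢
  have hd : f.lin (A.d a) = B.d (f.lin a) := f.map_d a
  rw [barD_ι_mul, wordMap_ι_mul, barD_ι_mul, map_add, map_sub, map_neg, wordMap_ι_mul,
    wordMap_ι_mul, hm, f.map_letterTwist, hw, hd]

theorem IsAcyclicFibration.toAInfinity {f : Hom A B} (hf : f.IsAcyclicFibration) :
    InternalComplex.IsAcyclicFibration A.toAInfinity.toDGModule.complex
      B.toAInfinity.toDGModule.complex f.lin := by
  refine .of_acyclic_ker ⟨fun hx => f.map_mem hx, fun {i} (x : A.carrier) _ => ?_⟩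
    (fun y hy => hf.surj y hy) fun i (x : A.carrier) hx hdx h0 => ?_
  · refine (congrArg f.lin (A.toAInfinity_b x)).trans ?_
    refine Eq.trans ?_ (B.toAInfinity_b (f.lin x)).symm
    rw [map_neg]
    exact congrArg Neg.neg (f.map_d x)
  · obtain ⟨x', hx', h0', e⟩ : ∃ x' ∈ A.gr (i + 1), f.lin x' = 0 ∧ A.d x' = x :=
      hf.acyclic_ker hx (neg_eq_zero.1 ((A.toAInfinity_b x).symm.trans hdx)) h0
    refine ⟨-x', Submodule.neg_mem _ hx', (map_neg f.lin x').trans (neg_eq_zero.2 h0'), ?_⟩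
    refine (A.toAInfinity_b (-x')).trans ?_
    rw [map_neg, neg_neg, e]

end Hom

/-- The map `a ↦ (-1) ^ |a| a`. -/
noncomputable def signMap (A : DGAlgebra k) : A.carrier →ₗ[k] A.carrier := -A.letterTwist 1

theorem signMap_apply {i : ℤ} {a : A.carrier} (ha : a ∈ A.gr i) :
    A.signMap a = koszulSign k i • a := by
  rw [signMap, LinearMap.neg_apply, letterTwist_apply 1 ha, one_mul, sub_eq_add_neg,
    koszulSign_add, koszulSign_neg, koszulSign_one, mul_neg_one, neg_smul, neg_neg]

theorem signMap_mul (a b : A.carrier) : A.signMap (a * b) = A.signMap a * A.signMap b := by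
  simp only [signMap, LinearMap.neg_apply, letterTwist_mul, neg_neg, neg_mul_neg]

theorem signMap_one : A.signMap 1 = 1 := by
  rw [signMap_apply (SetLike.GradedOne.one_mem : (1 : A.carrier) ∈ A.gr 0), koszulSign_zero,
    one_smul]

/-- The module underlying the homotopy pullback of two morphisms `f : A → B` and `g : A' → B`: its
elements are triples `(a, a', c)`, where `c` is a homotopy from `g a'` to `f a`. -/
def HoPullback (_f : Hom A B) (_g : Hom A' B) : Type u := A.carrier × A'.carrier × B.carrier

namespace HoPullback

variable (f : Hom A B) (g : Hom A' B)

instance : AddCommGroup (HoPullback f g) :=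
  inferInstanceAs (AddCommGroup (A.carrier × A'.carrier × B.carrier))

instance : Module k (HoPullback f g) :=
  inferInstanceAs (Module k (A.carrier × A'.carrier × B.carrier))

/-- The element `(a, a', c)`. -/
def mk (a : A.carrier) (a' : A'.carrier) (c : B.carrier) : HoPullback f g := (a, a', c)

variable {f g}

@[ext] theorem ext {x y : HoPullback f g} (h1 : x.1 = y.1) (h2 : x.2.1 = y.2.1)
    (h3 : x.2.2 = y.2.2) : x = y := Prod.ext h1 (Prod.ext h2 h3)

noncomputable instance : Mul (HoPullback f g) where
  mul x y := mk f g (x.1 * y.1) (x.2.1 * y.2.1)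
    (x.2.2 * g.lin y.2.1 + f.lin (A.signMap x.1) * y.2.2)

noncomputable instance : One (HoPullback f g) where
  one := mk f g 1 1 0

theorem lin_mul {C D : DGAlgebra k} (f : Hom C D) (a b : C.carrier) :
    f.lin (a * b) = f.lin a * f.lin b := map_mul f.toAlgHom a b

theorem lin_one {C D : DGAlgebra k} (f : Hom C D) : f.lin 1 = 1 := map_one f.toAlgHom

/-- The product `(a, a', c) (b, b', e) = (a b, a' b', c (g b') + (-1) ^ |a| (f a) e)`. -/
noncomputable instance : Ring (HoPullback f g) :=
  { (inferInstance : AddCommGroup (HoPullback f g)),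
    (inferInstance : Mul (HoPullback f g)), (inferInstance : One (HoPullback f g)) with
    left_distrib := fun x y z => ext (mul_add x.1 y.1 z.1) (mul_add x.2.1 y.2.1 z.2.1) (by
      change x.2.2 * g.lin (y.2.1 + z.2.1) + f.lin (A.signMap x.1) * (y.2.2 + z.2.2) =
        (x.2.2 * g.lin y.2.1 + f.lin (A.signMap x.1) * y.2.2) +
          (x.2.2 * g.lin z.2.1 + f.lin (A.signMap x.1) * z.2.2)
      rw [map_add, mul_add, mul_add]; abel)
    right_distrib := fun x y z => ext (add_mul x.1 y.1 z.1) (add_mul x.2.1 y.2.1 z.2.1) (by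
      change (x.2.2 + y.2.2) * g.lin z.2.1 + f.lin (A.signMap (x.1 + y.1)) * z.2.2 =
        (x.2.2 * g.lin z.2.1 + f.lin (A.signMap x.1) * z.2.2) +
          (y.2.2 * g.lin z.2.1 + f.lin (A.signMap y.1) * z.2.2)
      rw [map_add, map_add, add_mul, add_mul]; abel)
    zero_mul := fun x => ext (zero_mul x.1) (zero_mul x.2.1) (by
      change 0 * g.lin x.2.1 + f.lin (A.signMap 0) * x.2.2 = 0
      rw [map_zero, map_zero, zero_mul, zero_mul, add_zero])
    mul_zero := fun x => ext (mul_zero x.1) (mul_zero x.2.1) (by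
      change x.2.2 * g.lin 0 + f.lin (A.signMap x.1) * 0 = 0
      rw [map_zero, mul_zero, mul_zero, add_zero])
    mul_assoc := fun x y z => ext (mul_assoc x.1 y.1 z.1) (mul_assoc x.2.1 y.2.1 z.2.1) (by
      change (x.2.2 * g.lin y.2.1 + f.lin (A.signMap x.1) * y.2.2) * g.lin z.2.1 +
        f.lin (A.signMap (x.1 * y.1)) * z.2.2 = x.2.2 * g.lin (y.2.1 * z.2.1) +
          f.lin (A.signMap x.1) * (y.2.2 * g.lin z.2.1 + f.lin (A.signMap y.1) * z.2.2)
      rw [signMap_mul, lin_mul, lin_mul, add_mul, mul_add, mul_assoc, mul_assoc, mul_assoc,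
        add_assoc])
    one_mul := fun x => ext (one_mul x.1) (one_mul x.2.1) (by
      change 0 * g.lin x.2.1 + f.lin (A.signMap 1) * x.2.2 = x.2.2
      rw [signMap_one, lin_one, zero_mul, one_mul, zero_add])
    mul_one := fun x => ext (mul_one x.1) (mul_one x.2.1) (by
      change x.2.2 * g.lin 1 + f.lin (A.signMap x.1) * 0 = x.2.2
      rw [lin_one, mul_one, mul_zero, add_zero])
    neg_add_cancel := neg_add_cancel
    zsmul := fun n x => n • x
    nsmul := fun n x => n • x
    zsmul_zero' := SubNegMonoid.zsmul_zero'
    zsmul_succ' := SubNegMonoid.zsmul_succ'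
    zsmul_neg' := SubNegMonoid.zsmul_neg'
    nsmul_zero := AddMonoid.nsmul_zero
    nsmul_succ := AddMonoid.nsmul_succ
    sub_eq_add_neg := sub_eq_add_neg }

noncomputable instance : Algebra k (HoPullback f g) :=
  Algebra.ofModule
    (fun r x y => ext (smul_mul_assoc r x.1 y.1) (smul_mul_assoc r x.2.1 y.2.1) (by
      change (r • x.2.2) * g.lin y.2.1 + f.lin (A.signMap (r • x.1)) * y.2.2 =
        r • (x.2.2 * g.lin y.2.1 + f.lin (A.signMap x.1) * y.2.2)
      rw [map_smul, map_smul, smul_add, smul_mul_assoc, smul_mul_assoc]))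
    (fun r x y => ext (mul_smul_comm r x.1 y.1) (mul_smul_comm r x.2.1 y.2.1) (by
      change x.2.2 * g.lin (r • y.2.1) + f.lin (A.signMap x.1) * (r • y.2.2) =
        r • (x.2.2 * g.lin y.2.1 + f.lin (A.signMap x.1) * y.2.2)
      rw [map_smul, smul_add, mul_smul_comm, mul_smul_comm]))

variable (f g)

/-- The grading of the homotopy pullback. -/
def gr (i : ℤ) : Submodule k (HoPullback f g) :=
  ((A.gr i).prod ((A'.gr i).prod (B.gr (i - 1))) : Submodule k (A.carrier × A'.carrier × B.carrier))

theorem isInternal_gr : DirectSum.IsInternal (gr f g) := by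
  let π : ∀ (C : DGAlgebra k), ℤ → C.carrier →ₗ[k] C.carrier := fun C i =>
    (C.gr i).subtype ∘ₗ DirectSum.component k ℤ (fun i => C.gr i) i ∘ₗ
      (DirectSum.decomposeLinearEquiv C.gr).toLinearMap
  have h1 : ∀ (C : DGAlgebra k) i, ∀ x ∈ C.gr i, π C i x = x := fun C i x hx =>
    DirectSum.decompose_of_mem_same C.gr hx
  have h0 : ∀ (C : DGAlgebra k) i j, i ≠ j → ∀ x ∈ C.gr i, π C j x = 0 := fun C i j hij x hx =>
    DirectSum.decompose_of_mem_ne C.gr hx hij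
  have hA : ∀ a, mk f g a 0 0 ∈ ⨆ i, gr f g i := fun a => by
    induction a using A.letter_induction with
    | hom i a ha =>
      exact Submodule.mem_iSup_of_mem i ⟨ha, Submodule.zero_mem _, Submodule.zero_mem _⟩
    | add a b ha hb =>
      have := Submodule.add_mem _ ha hb
      rwa [show mk f g a 0 0 + mk f g b 0 0 = mk f g (a + b) 0 0 from
        ext rfl (add_zero 0) (add_zero 0)] at this
  have hA' : ∀ a, mk f g 0 a 0 ∈ ⨆ i, gr f g i := fun a => by
    induction a using A'.letter_induction with
    | hom i a ha =>
      exact Submodule.mem_iSup_of_mem i ⟨Submodule.zero_mem _, ha, Submodule.zero_mem _⟩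
    | add a b ha hb =>
      have := Submodule.add_mem _ ha hb
      rwa [show mk f g 0 a 0 + mk f g 0 b 0 = mk f g 0 (a + b) 0 from
        ext (add_zero 0) rfl (add_zero 0)] at this
  have hB : ∀ a, mk f g 0 0 a ∈ ⨆ i, gr f g i := fun a => by
    induction a using B.letter_induction with
    | hom i a ha =>
      refine Submodule.mem_iSup_of_mem (i + 1) ⟨Submodule.zero_mem _, Submodule.zero_mem _, ?_⟩
      rw [add_sub_cancel_right]
      exact ha
    | add a b ha hb =>
      have := Submodule.add_mem _ ha hb
      rwa [show mk f g 0 0 a + mk f g 0 0 b = mk f g 0 0 (a + b) from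
        ext (add_zero 0) (add_zero 0) rfl] at this
  refine isInternal_of_projections
    (fun i => (π A i).prodMap ((π A' i).prodMap (π B (i - 1)))) ?_ ?_ ?_
  · rintro i ⟨a, x, y⟩ ⟨ha, hx, hy⟩
    exact ext (h1 A i a ha) (h1 A' i x hx) (h1 B (i - 1) y hy)
  · rintro i j hij ⟨a, x, y⟩ ⟨ha, hx, hy⟩
    exact ext (h0 A i j hij a ha) (h0 A' i j hij x hx) (h0 B _ _ (by omega) y hy)
  · rw [eq_top_iff]
    rintro ⟨a, x, y⟩ -
    have e : mk f g a x y = mk f g a 0 0 + (mk f g 0 x 0 + mk f g 0 0 y) :=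
      ext (by change a = a + (0 + 0); simp) (by change x = 0 + (x + 0); simp)
          (by change y = 0 + (0 + y); simp)
    change mk f g a x y ∈ _
    rw [e]
    exact Submodule.add_mem _ (hA a) (Submodule.add_mem _ (hA' x) (hB y))

noncomputable instance : GradedAlgebra (gr f g) where
  one_mem := ⟨SetLike.GradedOne.one_mem, SetLike.GradedOne.one_mem, Submodule.zero_mem _⟩
  mul_mem := by
    rintro i j x y ⟨h1, h2, h3⟩ ⟨h1', h2', h3'⟩
    refine ⟨SetLike.mul_mem_graded h1 h1', SetLike.mul_mem_graded h2 h2',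
      Submodule.add_mem _ ?_ ?_⟩
    · have := SetLike.mul_mem_graded h3 (g.map_mem h2')
      rwa [show i - 1 + j = i + j - 1 by ring] at this
    · have := SetLike.mul_mem_graded (f.map_mem h1) h3'
      rw [show i + (j - 1) = i + j - 1 by ring] at this
      rw [signMap_apply h1, map_smul, smul_mul_assoc]
      exact Submodule.smul_mem _ _ this
  toDecomposition := (isInternal_gr f g).chooseDecomposition

/-- The differential `(a, a', c) ↦ (d a, d a', f a - g a' - d c)`. -/
noncomputable def d : HoPullback f g →ₗ[k] HoPullback f g :=
  (LinearMap.prod (A.d ∘ₗ LinearMap.fst k _ _)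
    (LinearMap.prod (A'.d ∘ₗ LinearMap.fst k _ _ ∘ₗ LinearMap.snd k _ _)
      (f.lin ∘ₗ LinearMap.fst k _ _ - g.lin ∘ₗ LinearMap.fst k _ _ ∘ₗ LinearMap.snd k _ _ -
        B.d ∘ₗ LinearMap.snd k _ _ ∘ₗ LinearMap.snd k _ _)) :
    (A.carrier × A'.carrier × B.carrier) →ₗ[k] (A.carrier × A'.carrier × B.carrier))

end HoPullback

open HoPullback in
/-- The homotopy pullback of two morphisms of dg algebras. -/
noncomputable def hoPullback (f : Hom A B) (g : Hom A' B) : DGAlgebra k where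
  carrier := HoPullback f g
  gr := HoPullback.gr f g
  d := HoPullback.d f g
  d_mem := by
    rintro i ⟨a, a', c⟩ ⟨h1, h2, h3⟩
    refine ⟨A.d_mem h1, A'.d_mem h2,
      Submodule.sub_mem _ (Submodule.sub_mem _ ?_ ?_) ?_⟩
    · rw [add_sub_cancel_right]; exact f.map_mem h1
    · rw [add_sub_cancel_right]; exact g.map_mem h2
    · have := B.d_mem h3
      rwa [show i - 1 + 1 = i + 1 - 1 by ring] at this
  d_d := by
    rintro ⟨a, a', c⟩
    refine ext (A.d_d a) (A'.d_d a') ?_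
    change f.lin (A.d a) - g.lin (A'.d a') - B.d (f.lin a - g.lin a' - B.d c) = 0
    have h1 : f.lin (A.d a) = B.d (f.lin a) := f.map_d a
    have h2 : g.lin (A'.d a') = B.d (g.lin a') := g.map_d a'
    rw [h1, h2, map_sub, map_sub, B.d_d]
    abel
  leibniz := by
    rintro i ⟨a, a', c⟩ ⟨ha, ha', hc⟩ ⟨b, b', e⟩
    refine ext (A.leibniz ha b) (A'.leibniz ha' b') ?_
    have hs := koszulSign_sq (k := k) i
    have hfa : f.lin a ∈ B.gr i := f.map_mem ha
    have h1 : f.lin (A.d a) = B.d (f.lin a) := f.map_d a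
    have h2 : g.lin (A'.d b') = B.d (g.lin b') := g.map_d b'
    change f.lin (a * b) - g.lin (a' * b') -
        B.d (c * g.lin b' + f.lin (A.signMap a) * e) =
      ((f.lin a - g.lin a' - B.d c) * g.lin b' + f.lin (A.signMap (A.d a)) * e) +
        koszulSign k i • (c * g.lin (A'.d b') +
          f.lin (A.signMap a) * (f.lin b - g.lin b' - B.d e))
    rw [signMap_apply ha, signMap_apply (A.d_mem ha), map_smul, map_smul, map_add,
      smul_mul_assoc, smul_mul_assoc, smul_mul_assoc, map_smul, B.leibniz hc, B.leibniz hfa,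
      lin_mul, lin_mul, h1, h2, sub_eq_add_neg i 1, koszulSign_add, koszulSign_add, koszulSign_neg,
      koszulSign_one]
    simp only [mul_sub, sub_mul, smul_add, smul_sub, smul_smul, hs, one_smul, mul_neg_one]
    module

namespace HoPullback

variable (f : Hom A B) (g : Hom A' B)

/-- The projection to the first factor. -/
noncomputable def fst : Hom (hoPullback f g) A where
  toAlgHom := AlgHom.ofLinearMap (LinearMap.fst k A.carrier (A'.carrier × B.carrier) :
    HoPullback f g →ₗ[k] A.carrier) rfl fun _ _ => rfl
  map_mem h := h.1
  map_d _ := rfl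

/-- The projection to the second factor. -/
noncomputable def snd : Hom (hoPullback f g) A' where
  toAlgHom := AlgHom.ofLinearMap (LinearMap.fst k A'.carrier B.carrier ∘ₗ
    LinearMap.snd k A.carrier (A'.carrier × B.carrier) :
    HoPullback f g →ₗ[k] A'.carrier) rfl fun _ _ => rfl
  map_mem h := h.2.1
  map_d _ := rfl

variable {f g}

theorem isAcyclicFibration_fst
    (hg : IsQuasiIso A'.toInternalComplex B.toInternalComplex g.lin) :
    (fst f g).IsAcyclicFibration := by
  refine .of_acyclic_ker (fst f g).isChainMap
    (fun a ha => ⟨mk f g a 0 0, ⟨ha, Submodule.zero_mem _, Submodule.zero_mem _⟩, rfl⟩) ?_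
  rintro i ⟨a, a', c⟩ ⟨-, ha', hc⟩ hd (h0 : a = 0)
  subst h0
  obtain ⟨j, rfl⟩ : ∃ j, i = j + 1 := ⟨i - 1, by ring⟩
  have hc' : c ∈ B.gr (j + 1) := by
    have : c ∈ B.gr (j + 1 + 1 - 1) := hc
    rwa [add_sub_cancel_right] at this
  have hda' : A'.d a' = 0 := congrArg (fun x => x.2.1) hd
  have hdc : f.lin 0 - g.lin a' - B.d c = 0 := congrArg (fun x => x.2.2) hd
  rw [map_zero, zero_sub, sub_eq_zero] at hdc
  obtain ⟨x, hx, e⟩ : ∃ x ∈ A'.gr (j + 1), A'.d x = a' :=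
    hg.inj (j + 1) a' ha' hda' (-c) (Submodule.neg_mem _ hc') (by
      change B.d (-c) = g.lin a'
      rw [map_neg, ← hdc, neg_neg])
  have hgx : B.d (g.lin x) = g.lin a' := by rw [← e]; exact (g.map_d x).symm
  obtain ⟨y, hy, hdy, z, hz, e'⟩ : ∃ y ∈ A'.gr (j + 1), A'.d y = 0 ∧ ∃ z ∈ B.gr j,
      B.d z = g.lin y - (c + g.lin x) :=
    hg.surj j (c + g.lin x) (Submodule.add_mem _ hc' (g.map_mem hx)) (by
      change B.d (c + g.lin x) = 0
      rw [map_add, hgx, ← hdc, neg_add_cancel])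
  refine ⟨mk f g 0 (x - y) z, ⟨Submodule.zero_mem _, Submodule.sub_mem _ hx hy, ?_⟩, rfl,
    ext (f := f) (g := g) (map_zero A.d) ?_ ?_⟩
  · change z ∈ B.gr (j + 1 - 1)
    rwa [add_sub_cancel_right]
  · change A'.d (x - y) = a'
    rw [map_sub, e, hdy, sub_zero]
  · change f.lin 0 - g.lin (x - y) - B.d z = c
    rw [e', map_zero, map_sub]
    abel

theorem isAcyclicFibration_snd
    (hf : IsQuasiIso A.toInternalComplex B.toInternalComplex f.lin) :
    (snd f g).IsAcyclicFibration := by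
  refine .of_acyclic_ker (snd f g).isChainMap
    (fun a ha => ⟨mk f g 0 a 0, ⟨Submodule.zero_mem _, ha, Submodule.zero_mem _⟩, rfl⟩) ?_
  rintro i ⟨a, a', c⟩ ⟨ha, -, hc⟩ hd (h0 : a' = 0)
  subst h0
  obtain ⟨j, rfl⟩ : ∃ j, i = j + 1 := ⟨i - 1, by ring⟩
  have hc' : c ∈ B.gr (j + 1) := by
    have : c ∈ B.gr (j + 1 + 1 - 1) := hc
    rwa [add_sub_cancel_right] at this
  have hda : A.d a = 0 := congrArg (fun x => x.1) hd
  have hdc : f.lin a - g.lin 0 - B.d c = 0 := congrArg (fun x => x.2.2) hd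
  rw [map_zero, sub_zero, sub_eq_zero] at hdc
  obtain ⟨x, hx, e⟩ : ∃ x ∈ A.gr (j + 1), A.d x = a :=
    hf.inj (j + 1) a ha hda c hc' hdc.symm
  have hfx : B.d (f.lin x) = f.lin a := by rw [← e]; exact (f.map_d x).symm
  obtain ⟨y, hy, hdy, z, hz, e'⟩ : ∃ y ∈ A.gr (j + 1), A.d y = 0 ∧ ∃ z ∈ B.gr j,
      B.d z = f.lin y - (c - f.lin x) :=
    hf.surj j (c - f.lin x) (Submodule.sub_mem _ hc' (f.map_mem hx)) (by
      change B.d (c - f.lin x) = 0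
      rw [map_sub, hfx, hdc, sub_self])
  refine ⟨mk f g (x + y) 0 z, ⟨Submodule.add_mem _ hx hy, Submodule.zero_mem _, ?_⟩, rfl,
    ext (f := f) (g := g) ?_ (map_zero A'.d) ?_⟩
  · change z ∈ B.gr (j + 1 - 1)
    rwa [add_sub_cancel_right]
  · change A.d (x + y) = a
    rw [map_add, e, hdy, add_zero]
  · change f.lin (x + y) - g.lin 0 - B.d z = c
    rw [e', map_zero, map_add]
    abel

end HoPullback

/-- Quasi-isomorphic dg algebras are connected by a span of degreewise surjective
quasi-isomorphisms: homotopy pullbacks replace cospans by spans. -/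
theorem QuasiIsomorphic.exists_span (h : QuasiIsomorphic A B) :
    ∃ (Z : DGAlgebra k) (p : Hom Z A) (q : Hom Z B),
      p.IsAcyclicFibration ∧ q.IsAcyclicFibration := by
  have hid : ∀ C : DGAlgebra k, (Hom.id C).IsAcyclicFibration := fun C =>
    .of_acyclic_ker (Hom.id C).isChainMap (fun y hy => ⟨y, hy, rfl⟩)
      fun i (x : C.carrier) _ _ (h0 : x = 0) =>
        ⟨0, Submodule.zero_mem _, rfl, (map_zero C.d).trans h0.symm⟩
  induction h with
  | rel A B h =>
    obtain ⟨f, hf⟩ := h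
    exact ⟨hoPullback f (Hom.id B), HoPullback.fst _ _, HoPullback.snd _ _,
      HoPullback.isAcyclicFibration_fst (hid B).quasiIso,
      HoPullback.isAcyclicFibration_snd (f.quasiIso_iff.1 hf)⟩
  | refl A => exact ⟨A, Hom.id A, Hom.id A, hid A, hid A⟩
  | symm A B _ ih =>
    obtain ⟨Z, p, q, hp, hq⟩ := ih
    exact ⟨Z, q, p, hq, hp⟩
  | trans A B C _ _ ih ih' =>
    obtain ⟨Z, p, q, hp, hq⟩ := ih
    obtain ⟨Z', p', q', hp', hq'⟩ := ih'
    exact ⟨hoPullback q p', p.comp (HoPullback.fst _ _), q'.comp (HoPullback.snd _ _),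
      hp.comp (HoPullback.isAcyclicFibration_fst hp'.quasiIso),
      hq'.comp (HoPullback.isAcyclicFibration_snd hq.quasiIso)⟩

end DGAlgebra

theorem mainTheorem5 (k : Type u) [CommRing k] (A A' : DGAlgebra k)
    (hA : IsCofibrantComplex A.toComplex) (hA' : IsCofibrantComplex A'.toComplex)
    (h : DGAlgebra.QuasiIsomorphic A A') :
    DGLieAlgebra.QuasiIsomorphic A.hochschildLie A'.hochschildLie := by
  obtain ⟨Z, p, q, hp, hq⟩ := h.exists_span
  have key := AInfinityAlgebra.quasiIsomorphic_of_span (A.isCofibrant_toAInfinity hA)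
    (A'.isCofibrant_toAInfinity hA') (Z := Z.toAInfinity) hp.toAInfinity p.wordMap_barD
    hq.toAInfinity q.wordMap_barD
  exact (A.hochschildLie_quasiIsomorphic.trans _ _ _ key).trans _ _ _
    A'.hochschildLie_quasiIsomorphic.symm
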